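/- Let $G$ be a group with a finite symmetric generating set $A$, i.e. a finite alphabet closed under formal inversion whose letters represent nontrivial elements of $G$ that generate $G$. The following are equivalent. 1. $(G,A)$ is almost convex: there is a constant $k$ such that for all $n\in\mathbb N$ and all $g,h\in G$ at distance exactly $n$ from the identity in the Cayley graph $\Gamma$ with $d_\Gamma(g,h)\le 2$, there is an edge path of length at most $k$ from $g$ to $h$ that lies in the closed ball $B(n)$ of radius $n$ about the identity in the metric graph $\Gamma$. 2. There is a finite symmetric presentation $\mathcal P=\langle A\mid R\rangle$ of $G$ such that the identity function $\iota$ is an intrinsic tame filling function for $G$ over $\mathcal P$. 3. There is a finite symmetric presentation $\mathcal P=\langle A\mid R\rangle$ of $G$ such that the identity function $\iota$ is an extrinsic tame filling function for $G$ over $\mathcal P$. Here a presentation is finite symmetric if $R$ is a finite set of nonempty words over $A$ closed under formal inversion, cyclic conjugation and passage to nonempty freely reduced forms. For a combinatorial 2-complex $Y$ with base vertex $y$, the coarse distance $\tilde d_Y(y,p)$ of a point $p$ is the path metric distance in the 1-skeleton if $p$ is a vertex; the minimum of the distances of the endpoints of $e$ plus $\frac12$ if $p$ is in the interior of an edge $e$;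 and the maximum of the coarse distances of the edges in $\partial\sigma$ minus $\frac14$ if $p$ is in the interior of a 2-cell $\sigma$. A 1-combing of a van Kampen diagram $\Delta$ (a finite planar contractible 2-complex) with base vertex $*$ is a continuous map $\Psi:\partial\Delta\times[0,1]\to\Delta$ with $\Psi(p,0)=*$ and $\Psi(p,1)=p$ for all $p$, $\Psi(*,t)=*$ for all $t$, and $\Psi(v,t)\in\Delta^{(1)}$ for all vertices $v$ of $\partial\Delta$ and all $t$. A map $\psi:\partial\Delta\times[0,1]\to Y$ is $f$-tame if $\tilde d_Y(y,\psi(p,s))\le f(\tilde d_Y(y,\psi(p,t)))$ for all $p$ and all $0\le s<t\le 1$. A nondecreasing function $f$ on the nonnegative multiples of $\frac14$ is an intrinsic [extrinsic] tame filling function for $G$ over $\mathcal P$ if every word $w$ over $A$ that represents the identity of $G$ has a van Kampen diagram $\Delta$ over $\mathcal P$ with a 1-combing $\Psi$ such that $\Psi$ is $f$-tame with respect to $*$ [such that $\pi_\Delta\circ\Psi$ is $f$-tame with respect to the identity vertex, where $\pi_\Delta$ is the label preserving cellular map from $\Delta$ to the Cayley 2-complex of $\mathcal P$ sending $*$ to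 the identity]. -/

import Mathlib

/-! ## Graphs and combinatorial 2-complexes -/

/-- A graph given by its directed edges: `inv` reverses a directed edge, `src` is its initial vertex,
and an undirected edge is a pair `{d, inv d}`. -/
structure SerreGraph.{u, v} where
  V : Type u
  D : Type v
  inv : D → D
  src : D → V
  inv_inv : ∀ d, inv (inv d) = d
  inv_ne : ∀ d, inv d ≠ d

namespace SerreGraph

variable (Γ : SerreGraph)

/-- The terminal vertex of a directed edge. -/
def tgt (d : Γ.D) : Γ.V := Γ.src (Γ.inv d)

/-- `Γ.IsPath u p v`: the list `p` of directed edges is an edge path from `u` to `v`. -/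
def IsPath : Γ.V → List Γ.D → Γ.V → Prop
  | u, [], v => u = v
  | u, d :: p, v => Γ.src d = u ∧ IsPath (Γ.tgt d) p v

/-- The path metric on vertices: the least length of an edge path (only used for connected graphs). -/
noncomputable def dist (u v : Γ.V) : ℕ := sInf {n | ∃ p, Γ.IsPath u p v ∧ p.length = n}

/-- The closed edge underlying `d` lies in the closed ball of radius `n` about `y` in the metric graph
`Γ`: the point at distance `t` from the initial vertex of `d` has path metric distance
`min (dist y (src d) + t) (dist y (tgt d) + (1 - t))` from `y`. -/
def EdgeInBall (y : Γ.V) (n : ℕ) (d : Γ.D) : Prop :=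
  ∀ t ∈ Set.Icc (0 : ℝ) 1,
    min ((Γ.dist y (Γ.src d) : ℝ) + t) ((Γ.dist y (Γ.tgt d) : ℝ) + (1 - t)) ≤ n

end SerreGraph

/-- A combinatorial 2-complex: a graph, together with 2-cells `f : F`, each being a polygon with
`len f ≥ 1` sides attached along the closed edge path `side f 0, side f 1, …`. -/
structure TwoComplex.{u, v, w} extends SerreGraph.{u, v} where
  F : Type w
  len : F → ℕ
  len_pos : ∀ f, 0 < len f
  side : (f : F) → Fin (len f) → D
  side_closed : ∀ f k, src (inv (side f k)) = src (side f (finRotate (len f) k))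

namespace TwoComplex

theorem finRotate_mk_of_lt {n k : ℕ} (h : k + 1 < n) :
    finRotate n ⟨k, by omega⟩ = ⟨k + 1, h⟩ := by
  obtain ⟨m, rfl⟩ : ∃ m, n = m + 1 := ⟨n - 1, by omega⟩
  rw [finRotate_of_lt (by omega)]

theorem finRotate_mk_of_ge {n k : ℕ} (hk : k < n) (h : n ≤ k + 1) :
    finRotate n ⟨k, hk⟩ = ⟨0, by omega⟩ := by
  obtain rfl : n = k + 1 := by omega
  rw [finRotate_last']

/-- The point of the unit circle at parameter `(k + t) / n`, as a point of the closed unit disc: the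
circle is cut into `n` arcs and `t ∈ [0,1]` runs through arc number `k`. -/
noncomputable def arcPoint (n k : ℕ) (t : unitInterval) : Metric.closedBall (0 : ℂ) 1 :=
  ⟨(Circle.exp (2 * Real.pi * ((k + (t : ℝ)) / n)) : ℂ), by
    rw [mem_closedBall_zero_iff, Circle.norm_coe]⟩

variable (Y : TwoComplex)

/-- Disjoint union of points, unit intervals (one for each directed edge) and closed unit discs
(one for each 2-cell). -/
abbrev Pieces : Type _ :=
  (Σ _ : Y.V, PUnit.{1}) ⊕ ((Σ _ : Y.D, unitInterval) ⊕ (Σ _ : Y.F, Metric.closedBall (0 : ℂ) 1))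

variable {Y} in
abbrev vertexPiece (v : Y.V) : Y.Pieces := Sum.inl ⟨v, PUnit.unit⟩
variable {Y} in
abbrev edgePiece (d : Y.D) (t : unitInterval) : Y.Pieces := Sum.inr (Sum.inl ⟨d, t⟩)
variable {Y} in
abbrev facePiece (f : Y.F) (z : Metric.closedBall (0 : ℂ) 1) : Y.Pieces := Sum.inr (Sum.inr ⟨f, z⟩)

/-- The gluing: the edge `d` starts at `src d`; the intervals of `d` and `inv d` are the same with
opposite directions; the `k`-th arc of the boundary of the disc `f` is glued to the edge `side f k`. -/
inductive Glue : Y.Pieces → Y.Pieces → Prop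
  | src (d : Y.D) : Glue (edgePiece d 0) (vertexPiece (Y.src d))
  | flip (d : Y.D) (t : unitInterval) : Glue (edgePiece d t) (edgePiece (Y.inv d) (unitInterval.symm t))
  | arc (f : Y.F) (k : Fin (Y.len f)) (t : unitInterval) :
      Glue (facePiece f (arcPoint (Y.len f) k t)) (edgePiece (Y.side f k) t)

/-- The underlying topological space of the complex (with the CW topology). -/
def Space : Type _ := Quot Y.Glue

instance : TopologicalSpace Y.Space := inferInstanceAs (TopologicalSpace (Quot Y.Glue))

variable {Y} in
def vertexPt (v : Y.V) : Y.Space := Quot.mk _ (vertexPiece v)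
variable {Y} in
def edgePt (d : Y.D) (t : unitInterval) : Y.Space := Quot.mk _ (edgePiece d t)
variable {Y} in
def facePt (f : Y.F) (z : Metric.closedBall (0 : ℂ) 1) : Y.Space := Quot.mk _ (facePiece f z)

/-- The 0-skeleton. -/
def skel0 : Set Y.Space := {p | ∃ v, p = vertexPt v}

/-- The 1-skeleton. -/
def skel1 : Set Y.Space := Y.skel0 ∪ {p | ∃ d t, p = edgePt d t}

/-- Names of the open cells (`edge d` and `edge (inv d)` name the same one). -/
inductive Cell : Type _
  | vertex (v : Y.V)
  | edge (d : Y.D)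
  | face (f : Y.F)

variable {Y}

/-- The open cells of the complex, as subsets of its underlying space. -/
def openCell : Y.Cell → Set Y.Space
  | .vertex v => {vertexPt v}
  | .edge d => {p | ∃ t : unitInterval, 0 < t ∧ t < 1 ∧ p = edgePt d t}
  | .face f => {p | ∃ z : Metric.closedBall (0 : ℂ) 1, ‖(z : ℂ)‖ < 1 ∧ p = facePt f z}

/-- Coarse distance from `y` to the interior of an edge. -/
noncomputable def edgeDist (y : Y.V) (d : Y.D) : ℚ :=
  min (Y.dist y (Y.src d) : ℚ) (Y.dist y (Y.tgt d) : ℚ) + 1 / 2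

/-- Coarse distance from `y` to the points of an open cell. -/
noncomputable def cellDist (y : Y.V) : Y.Cell → ℚ
  | .vertex v => (Y.dist y v : ℚ)
  | .edge d => edgeDist y d
  | .face f => Finset.univ.sup' ⟨⟨0, Y.len_pos f⟩, Finset.mem_univ _⟩
      (fun k => edgeDist y (Y.side f k)) - 1 / 4

theorem edgePt_zero (d : Y.D) : edgePt d 0 = vertexPt (Y.src d) := Quot.sound (Glue.src d)

theorem edgePt_flip (d : Y.D) (t : unitInterval) :
    edgePt d t = edgePt (Y.inv d) (unitInterval.symm t) := Quot.sound (Glue.flip d t)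

theorem facePt_arc (f : Y.F) (k : Fin (Y.len f)) (t : unitInterval) :
    facePt f (arcPoint (Y.len f) k t) = edgePt (Y.side f k) t := Quot.sound (Glue.arc f k t)

theorem exists_arcPoint {n : ℕ} (hn : 0 < n) (z : Metric.closedBall (0 : ℂ) 1)
    (hz : ‖(z : ℂ)‖ = 1) : ∃ (k : Fin n) (t : unitInterval), z = arcPoint n k t := by
  obtain ⟨θ, hθ⟩ := Complex.norm_eq_one_iff (z : ℂ) |>.mp hz
  have hn' : (0 : ℝ) < n := by exact_mod_cast hn
  set x : ℝ := n * Int.fract (θ / (2 * Real.pi)) with hx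
  have hx0 : 0 ≤ x := mul_nonneg hn'.le (Int.fract_nonneg _)
  have hxn : x < n := by
    have := Int.fract_lt_one (θ / (2 * Real.pi)); nlinarith
  have hk : ⌊x⌋₊ < n := (Nat.floor_lt hx0).mpr hxn
  refine ⟨⟨⌊x⌋₊, hk⟩, ⟨x - ⌊x⌋₊, ?_, ?_⟩, ?_⟩
  · linarith [Nat.floor_le hx0]
  · linarith [Nat.lt_floor_add_one x]
  · apply Subtype.ext
    change (z : ℂ) = ((Circle.exp (2 * Real.pi * (((⌊x⌋₊ : ℕ) + (x - ⌊x⌋₊)) / n)) : Circle) : ℂ)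
    rw [Circle.coe_exp, ← hθ, Complex.exp_eq_exp_iff_exists_int]
    refine ⟨⌊θ / (2 * Real.pi)⌋, ?_⟩
    have h1 : ((⌊x⌋₊ : ℝ) + (x - ⌊x⌋₊)) / n = Int.fract (θ / (2 * Real.pi)) := by
      rw [hx]; field_simp; ring
    have h2 : θ = 2 * Real.pi * Int.fract (θ / (2 * Real.pi))
        + ⌊θ / (2 * Real.pi)⌋ * (2 * Real.pi) := by
      have hp := Real.pi_pos
      have := Int.fract_add_floor (θ / (2 * Real.pi))
      calc θ = 2 * Real.pi * (θ / (2 * Real.pi)) := by field_simp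
        _ = 2 * Real.pi * (Int.fract (θ / (2 * Real.pi)) + ⌊θ / (2 * Real.pi)⌋) := by rw [this]
        _ = _ := by ring
    rw [h1]
    have h3 : (θ : ℂ) * Complex.I = ((2 * Real.pi * Int.fract (θ / (2 * Real.pi))
        + ⌊θ / (2 * Real.pi)⌋ * (2 * Real.pi) : ℝ) : ℂ) * Complex.I := by rw [← h2]
    rw [h3]; push_cast; ring

/-- Every point lies in an open cell. -/
theorem exists_mem_openCell (p : Y.Space) : ∃ c : Y.Cell, p ∈ openCell c := by
  have hE : ∀ (d : Y.D) (t : unitInterval), ∃ c : Y.Cell, edgePt d t ∈ openCell c := by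
    intro d t
    rcases eq_or_ne t 0 with rfl | h0
    · exact ⟨.vertex (Y.src d), edgePt_zero d⟩
    rcases eq_or_ne t 1 with rfl | h1
    · refine ⟨.vertex (Y.src (Y.inv d)), ?_⟩
      rw [edgePt_flip, unitInterval.symm_one]
      exact edgePt_zero _
    · exact ⟨.edge d, t, unitInterval.pos_iff_ne_zero.mpr h0, unitInterval.lt_one_iff_ne_one.mpr h1, rfl⟩
  induction p using Quot.ind with
  | mk a =>
    rcases a with ⟨v, -⟩ | ⟨d, t⟩ | ⟨f, z⟩
    · exact ⟨.vertex v, rfl⟩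
    · exact hE d t
    · have hz : ‖(z : ℂ)‖ ≤ 1 := mem_closedBall_zero_iff.mp z.2
      rcases hz.lt_or_eq with h | h
      · exact ⟨.face f, z, h, rfl⟩
      · obtain ⟨k, t, rfl⟩ := exists_arcPoint (Y.len_pos f) z h
        obtain ⟨c, hc⟩ := hE (Y.side f k) t
        refine ⟨c, ?_⟩
        rw [← facePt_arc] at hc
        exact hc

/-- The coarse distance from the vertex `y` to a point `p`: it only depends on the open cell that
contains `p`. -/
noncomputable def coarseDist (y : Y.V) (p : Y.Space) : ℚ :=
  cellDist y (exists_mem_openCell p).choose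

theorem arcPoint_eq {n : ℕ} {k k' : Fin n} {t t' : unitInterval}
    (h : arcPoint n k t = arcPoint n k' t') :
    (k = k' ∧ t = t') ∨ (t = 1 ∧ t' = 0 ∧ k' = finRotate n k) ∨
      (t' = 1 ∧ t = 0 ∧ k = finRotate n k') := by
  have hn : 0 < n := k.pos
  have hn' : (0 : ℝ) < n := by exact_mod_cast hn
  have h1 := congrArg Subtype.val h
  simp only [arcPoint] at h1
  have h2 : Circle.exp (2 * Real.pi * (((k : ℕ) + (t : ℝ)) / n)) =
      Circle.exp (2 * Real.pi * (((k' : ℕ) + (t' : ℝ)) / n)) := Subtype.ext h1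
  obtain ⟨m, hm⟩ := Circle.exp_eq_exp.mp h2
  have h3 : ((k : ℕ) : ℝ) + t = (k' : ℕ) + t' + m * n := by
    have hp := Real.pi_pos
    field_simp at hm
    linarith
  have ht0 := t.2.1
  have ht1 := t.2.2
  have ht0' := t'.2.1
  have ht1' := t'.2.2
  have hd : ∃ j : ℤ, (t : ℝ) - t' = j ∧ (k : ℤ) + j = (k' : ℤ) + m * n := by
    refine ⟨(k' : ℤ) + m * n - k, ?_, by ring⟩
    push_cast
    linarith
  obtain ⟨j, hj, hkj⟩ := hd
  have hj1 : j ≤ 1 := by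
    have : (j : ℝ) ≤ 1 := by linarith
    exact_mod_cast this
  have hj2 : -1 ≤ j := by
    have : (-1 : ℝ) ≤ j := by linarith
    exact_mod_cast this
  have hk := k.2
  have hk' := k'.2
  have hm1 : m ≤ 1 := by
    by_contra hc
    nlinarith
  have hm2 : -1 ≤ m := by
    by_contra hc
    nlinarith
  have rot : ∀ (a b : Fin n) (q : ℤ), (a : ℤ) + 1 = b + q * n → -1 ≤ q → q ≤ 1 →
      b = finRotate n a := by
    intro a b q hq hq1 hq2
    obtain ⟨a, ha⟩ := a
    obtain ⟨b, hb⟩ := b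
    simp only at hq
    rcases Nat.lt_or_ge (a + 1) n with hlt | hge
    · rw [finRotate_mk_of_lt hlt]
      have : q = 0 := by
        interval_cases q <;> first | rfl | (exfalso; omega)
      subst this
      ext; simp only; omega
    · rw [finRotate_mk_of_ge ha hge]
      have : q = 1 := by
        interval_cases q <;> first | rfl | (exfalso; omega)
      subst this
      ext; simp only; omega
  have hcases : j = -1 ∨ j = 0 ∨ j = 1 := by omega
  rcases hcases with rfl | rfl | rfl
  · right; right
    push_cast at hj
    refine ⟨Subtype.ext (by rw [Set.Icc.coe_one]; linarith), Subtype.ext (by rw [Set.Icc.coe_zero]; linarith),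
      rot k' k (-m) (by linarith) (by omega) (by omega)⟩
  · left
    push_cast at hj
    refine ⟨?_, Subtype.ext (by linarith)⟩
    have : m = 0 := by interval_cases m <;> first | rfl | (exfalso; omega)
    subst this
    ext; omega
  · right; left
    push_cast at hj
    exact ⟨Subtype.ext (by rw [Set.Icc.coe_one]; linarith), Subtype.ext (by rw [Set.Icc.coe_zero]; linarith),
      rot k k' m (by linarith) hm2 hm1⟩

open Classical in
/-- The coarse distance is well defined: it is the distance of any open cell containing the point. -/
theorem coarseDist_eq (y : Y.V) {p : Y.Space} {c : Y.Cell} (hc : p ∈ openCell c) :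
    coarseDist y p = cellDist y c := by
  let ev : Y.D → unitInterval → ℚ := fun d t =>
    if t = 0 then (Y.dist y (Y.src d) : ℚ) else if t = 1 then (Y.dist y (Y.tgt d) : ℚ)
    else edgeDist y d
  have ev_flip : ∀ d t, ev d t = ev (Y.inv d) (unitInterval.symm t) := by
    intro d t
    simp only [ev, SerreGraph.tgt, Y.inv_inv, edgeDist]
    rcases eq_or_ne t 0 with rfl | h0
    · simp
    rcases eq_or_ne t 1 with rfl | h1
    · simp
    · have h0' : unitInterval.symm t ≠ 0 := fun h => h1 (by
        rw [← unitInterval.symm_symm t, h, unitInterval.symm_zero])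
      have h1' : unitInterval.symm t ≠ 1 := fun h => h0 (by
        rw [← unitInterval.symm_symm t, h, unitInterval.symm_one])
      simp [h0, h1, h0', h1', min_comm]
  have ev_rot : ∀ f k, ev (Y.side f k) 1 = ev (Y.side f (finRotate _ k)) 0 := by
    intro f k
    simp [ev, SerreGraph.tgt, Y.side_closed]
  have ev_arc : ∀ f (k k' : Fin (Y.len f)) t t', arcPoint (Y.len f) k t = arcPoint (Y.len f) k' t' →
      ev (Y.side f k) t = ev (Y.side f k') t' := by
    intro f k k' t t' h
    rcases arcPoint_eq h with ⟨rfl, rfl⟩ | ⟨rfl, rfl, rfl⟩ | ⟨rfl, rfl, rfl⟩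
    · rfl
    · exact ev_rot f k
    · exact (ev_rot f k').symm
  let pv : Y.Pieces → ℚ := fun
    | .inl ⟨v, _⟩ => (Y.dist y v : ℚ)
    | .inr (.inl ⟨d, t⟩) => ev d t
    | .inr (.inr ⟨f, z⟩) =>
      if h : ∃ (k : Fin (Y.len f)) (t : unitInterval), z = arcPoint (Y.len f) k t
      then ev (Y.side f h.choose) h.choose_spec.choose else cellDist y (.face f)
  have hpv : ∀ a b, Y.Glue a b → pv a = pv b := by
    intro a b hab
    cases hab with
    | src d => simp [pv, ev]
    | flip d t => exact ev_flip d t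
    | arc f k t =>
      have h : ∃ (k' : Fin (Y.len f)) (t' : unitInterval),
        arcPoint (Y.len f) k t = arcPoint (Y.len f) k' t' := ⟨k, t, rfl⟩
      simp only [pv]
      rw [dif_pos h]
      exact ev_arc f _ _ _ _ h.choose_spec.choose_spec.symm
  let L : Y.Space → ℚ := Quot.lift pv hpv
  have hL : ∀ (q : Y.Space) (c : Y.Cell), q ∈ openCell c → L q = cellDist y c := by
    intro q c hq
    cases c with
    | vertex v => obtain rfl : q = vertexPt v := hq; rfl
    | edge d =>
      obtain ⟨t, h0, h1, rfl⟩ := hq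
      change ev d t = edgeDist y d
      simp [ev, h0.ne', h1.ne]
    | face f =>
      obtain ⟨z, hz, rfl⟩ := hq
      change pv (facePiece f z) = _
      have h : ¬ ∃ (k : Fin (Y.len f)) (t : unitInterval), z = arcPoint (Y.len f) k t := by
        rintro ⟨k, t, rfl⟩
        rw [arcPoint, Circle.norm_coe] at hz
        exact lt_irrefl _ hz
      simp only [pv]
      rw [dif_neg h]
  rw [coarseDist, ← hL p c hc, hL p _ (exists_mem_openCell p).choose_spec]

/-- A 1-combing of the pair `(Y, Z)` at the base vertex `y`. -/
structure IsOneCombing (y : Y.V) (Z : Set Y.Space) (ψ : Z × unitInterval → Y.Space) : Prop where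
  continuous : Continuous ψ
  map_zero : ∀ p, ψ (p, 0) = vertexPt y
  map_one : ∀ p, ψ (p, 1) = (p : Y.Space)
  map_base : ∀ p : Z, (p : Y.Space) = vertexPt y → ∀ t, ψ (p, t) = vertexPt y
  map_skel0 : ∀ p : Z, (p : Y.Space) ∈ Y.skel0 → ∀ t, ψ (p, t) ∈ Y.skel1

/-- `f`-tameness of a map `ψ : Z × [0,1] → Y` with respect to the base vertex `y`. -/
def IsTame (y : Y.V) (f : ℚ → ℚ) {Z : Type*} (ψ : Z × unitInterval → Y.Space) : Prop :=
  ∀ (p : Z) (s t : unitInterval), s < t → coarseDist y (ψ (p, s)) ≤ f (coarseDist y (ψ (p, t)))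

end TwoComplex

/-! ## Generators, Cayley graph, almost convexity -/

/-- A symmetric generating set of `G`: an alphabet `A` with a formal inversion `a ↦ a⁻¹`, whose letters
represent nontrivial elements of `G` that generate `G`. (A subset `A ⊆ G ∖ {1}` closed under inversion
is the special case in which `rep` is the inclusion.) -/
structure SymGen (G : Type*) [Group G] (A : Type*) [InvolutiveInv A] where
  rep : A → G
  rep_inv : ∀ a, rep a⁻¹ = (rep a)⁻¹
  rep_ne_one : ∀ a, rep a ≠ 1
  generates : Subgroup.closure (Set.range rep) = ⊤

namespace SymGen

variable {G : Type*} [Group G] {A : Type*} [InvolutiveInv A] (S : SymGen G A)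

/-- The element of `G` represented by a word. -/
def eval (w : List A) : G := (w.map S.rep).prod

/-- The Cayley graph: the directed edge `(g, a)` goes from `g` to `g * a`, and its reverse is
`(g * a, a⁻¹)`. -/
def cayleyGraph : SerreGraph where
  V := G
  D := G × A
  inv e := (e.1 * S.rep e.2, e.2⁻¹)
  src e := e.1
  inv_inv e := by simp [S.rep_inv]
  inv_ne e h := S.rep_ne_one e.2 (by simpa using congrArg Prod.fst h)

/-- Almost convexity of `G` with respect to the generating set. -/
def AlmostConvex : Prop :=
  ∃ k : ℕ, ∀ (n : ℕ) (g h : G),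
    S.cayleyGraph.dist (1 : G) g = n → S.cayleyGraph.dist (1 : G) h = n →
    S.cayleyGraph.dist g h ≤ 2 →
    ∃ p : List (G × A), S.cayleyGraph.IsPath g p h ∧ p.length ≤ k ∧
      ∀ d ∈ p, S.cayleyGraph.EdgeInBall (1 : G) n d

end SymGen

/-! ## Presentations, Cayley complex, van Kampen diagrams -/

/-- Deletion of a subword `a a⁻¹`. -/
inductive FreeReduction {A : Type*} [InvolutiveInv A] : List A → List A → Prop
  | step (x y : List A) (a : A) : FreeReduction (x ++ a :: a⁻¹ :: y) (x ++ y)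

/-- A finite symmetric presentation `⟨A ∣ R⟩` of `G` over the symmetric generating set: `R` is a finite
set of nonempty words, closed under formal inversion, cyclic conjugation and passage to a nonempty
freely reduced form, and the relators together with the `a a⁻¹` define `G`. -/
structure FinPresentation {G : Type*} [Group G] {A : Type*} [InvolutiveInv A] (S : SymGen G A) where
  R : Set (List A)
  finite : R.Finite
  nil_notMem : [] ∉ R
  inv_mem : ∀ r ∈ R, (r.map (·⁻¹)).reverse ∈ R
  rotate_mem : ∀ r ∈ R, ∀ i, r.rotate i ∈ R
  reduced_mem : ∀ r ∈ R, ∀ r', Relation.ReflTransGen FreeReduction r r' →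
    (∀ r'', ¬ FreeReduction r' r'') → r' ≠ [] → r' ∈ R
  ker_eq : (FreeGroup.lift S.rep).ker = Subgroup.normalClosure
    (Set.range (fun a : A => FreeGroup.of a * FreeGroup.of a⁻¹) ∪
      (fun r : List A => (r.map FreeGroup.of).prod) '' R)

namespace FinPresentation

variable {G : Type*} [Group G] {A : Type*} [InvolutiveInv A] {S : SymGen G A}
  (P : FinPresentation S)

theorem eval_eq_one {r : List A} (hr : r ∈ P.R) : S.eval r = 1 := by
  have h : (r.map FreeGroup.of).prod ∈ (FreeGroup.lift S.rep).ker := by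
    rw [P.ker_eq]
    exact Subgroup.subset_normalClosure (Or.inr ⟨r, hr, rfl⟩)
  rw [MonoidHom.mem_ker, map_list_prod, List.map_map] at h
  have h2 : (FreeGroup.lift S.rep) ∘ FreeGroup.of = S.rep := by funext a; simp
  rwa [h2] at h

/-- The Cayley 2-complex: its 1-skeleton is the Cayley graph, and for every `g : G` and every relator
`r` a 2-cell is attached along the closed path that starts at `g` and is labelled `r`. (Relators that
are cyclic conjugate or inverse to each other give 2-cells with the same boundary circuit, hence of the
same coarse distance.) -/
def cayleyComplex : TwoComplex where
  toSerreGraph := S.cayleyGraph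
  F := G × P.R
  len f := (f.2 : List A).length
  len_pos f := List.length_pos_iff.mpr fun h => P.nil_notMem (h ▸ f.2.2)
  side f k := (f.1 * S.eval ((f.2 : List A).take k), (f.2 : List A).get k)
  side_closed := by
    rintro ⟨g, r, hr⟩ k
    have h1 := P.eval_eq_one hr
    obtain ⟨k, hk⟩ := k
    have hk' : k < r.length := hk
    have key : S.eval (r.take k) * S.rep r[k] = S.eval (r.take (k + 1)) := by
      rw [List.take_succ_eq_append_getElem hk', SymGen.eval, SymGen.eval, List.map_append,
        List.prod_append, List.map_singleton, List.prod_singleton]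
    change g * S.eval (r.take k) * S.rep r[k] =
      g * S.eval (r.take (finRotate r.length ⟨k, hk'⟩ : Fin r.length))
    rw [mul_assoc, key]
    rcases Nat.lt_or_ge (k + 1) r.length with h | h
    · rw [TwoComplex.finRotate_mk_of_lt h]
    · rw [TwoComplex.finRotate_mk_of_ge hk' h, List.take_of_length_le h, h1]
      simp [SymGen.eval]

/-- A van Kampen diagram for the word `w`: a finite planar contractible 2-complex with a base vertex and
directed edges labelled by letters, the counterclockwise boundary circuit from the base vertex being
labelled `w` and every 2-cell having its boundary labelled by a relator.

Planarity and contractibility are expressed by a combinatorial plane embedding (combinatorial map): all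
polygons are oriented counterclockwise, and an outer polygon, whose boundary circuit is the inverse of
the boundary circuit of the diagram, is added. Every directed edge is then a side of exactly one polygon
(`sides_bijective`) and around each vertex the polygons form a single cycle (`link`), so that the
polygons form a closed oriented surface; it is connected and has Euler characteristic `2` (`euler`, where
the outer polygon is not counted), so it is a sphere, and the diagram is the complement of an open disc
in it. If `w` is empty, the diagram is a single vertex. -/
structure VanKampenDiagram (w : List A) where
  Y : TwoComplex.{0, 0, 0}
  finite_V : Finite Y.V
  finite_D : Finite Y.D
  finite_F : Finite Y.F
  base : Y.V
  connected : ∀ v, ∃ p, Y.IsPath base p v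
  label : Y.D → A
  label_inv : ∀ d, label (Y.inv d) = (label d)⁻¹
  label_face : ∀ f, List.ofFn (fun k => label (Y.side f k)) ∈ P.R
  bd : Fin w.length → Y.D
  bd_isPath : Y.IsPath base (List.ofFn bd) base
  label_bd : ∀ i, label (bd i) = w.get i
  sides_bijective : Function.Bijective
    (Sum.elim (fun s : (Σ f : Y.F, Fin (Y.len f)) => Y.side s.1 s.2) (fun i => Y.inv (bd i)))
  link : ∀ d d', Y.src d = Y.src d' → Relation.EqvGen
    (fun e e' => (∃ f k, e = Y.inv (Y.side f k) ∧ e' = Y.side f (finRotate _ k)) ∨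
      (∃ i, e = Y.inv (bd i) ∧ e' = bd (finRotate _ i))) d d'
  euler : 2 * (Nat.card Y.V + Nat.card Y.F) = Nat.card Y.D + 2

namespace VanKampenDiagram

variable {P} {w : List A} (Δ : P.VanKampenDiagram w)

/-- The boundary `∂Δ` of the diagram, a subcomplex of its 1-skeleton. -/
def boundary : Set Δ.Y.Space :=
  {p | p = TwoComplex.vertexPt Δ.base ∨ ∃ i t, p = TwoComplex.edgePt (Δ.bd i) t}

/-- `π` is the vertex map of the (unique) label preserving cellular map from `Δ` to the Cayley complex
that takes the base vertex to `1`. -/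
def IsVertexProjection (π : Δ.Y.V → G) : Prop :=
  π Δ.base = 1 ∧ ∀ d, π (Δ.Y.tgt d) = π (Δ.Y.src d) * S.rep (Δ.label d)

variable {Δ}

theorem IsVertexProjection.src_side {π : Δ.Y.V → G} (h : Δ.IsVertexProjection π) (f : Δ.Y.F)
    (k : ℕ) (hk : k < Δ.Y.len f) :
    π (Δ.Y.src (Δ.Y.side f ⟨k, hk⟩)) = π (Δ.Y.src (Δ.Y.side f ⟨0, Δ.Y.len_pos f⟩)) *
      S.eval ((List.ofFn (fun k => Δ.label (Δ.Y.side f k))).take k) := by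
  induction k with
  | zero => simp [SymGen.eval]
  | succ k ih =>
    have hk' : k < Δ.Y.len f := by omega
    have h1 := Δ.Y.side_closed f ⟨k, hk'⟩
    rw [TwoComplex.finRotate_mk_of_lt hk] at h1
    have h3 := h.2 (Δ.Y.side f ⟨k, hk'⟩)
    rw [SerreGraph.tgt, h1, ih hk', mul_assoc] at h3
    rw [h3]
    congr 1
    simp [SymGen.eval, List.take_add_one, hk']

/-- The cellular map `Δ → X` to the Cayley complex, on points: vertices, directed edges and 2-cells go to
vertices, directed edges and 2-cells, preserving labels (and characteristic maps). -/
noncomputable def projection (π : Δ.Y.V → G) (h : Δ.IsVertexProjection π) :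
    Δ.Y.Space → P.cayleyComplex.Space :=
  Quot.lift
    (fun
      | .inl ⟨v, _⟩ => TwoComplex.vertexPt (Y := P.cayleyComplex) (π v)
      | .inr (.inl ⟨d, t⟩) => TwoComplex.edgePt (Y := P.cayleyComplex) (π (Δ.Y.src d), Δ.label d) t
      | .inr (.inr ⟨f, z⟩) => TwoComplex.facePt (Y := P.cayleyComplex)
          (π (Δ.Y.src (Δ.Y.side f ⟨0, Δ.Y.len_pos f⟩)), ⟨_, Δ.label_face f⟩) z)
    (by
      intro a b hab
      cases hab with
      | src d => exact TwoComplex.edgePt_zero (Y := P.cayleyComplex) _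
      | flip d t =>
        have h1 := h.2 d
        rw [SerreGraph.tgt] at h1
        dsimp only
        rw [h1, Δ.label_inv]
        exact TwoComplex.edgePt_flip (Y := P.cayleyComplex) _ t
      | arc f k t =>
        dsimp only
        have hl : (List.ofFn (fun k => Δ.label (Δ.Y.side f k))).length = Δ.Y.len f := by simp
        have h1 := TwoComplex.facePt_arc (Y := P.cayleyComplex)
          (π (Δ.Y.src (Δ.Y.side f ⟨0, Δ.Y.len_pos f⟩)), ⟨_, Δ.label_face f⟩)
          (Fin.cast hl.symm k) t
        have h2 : TwoComplex.arcPoint (P.cayleyComplex.len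
          (π (Δ.Y.src (Δ.Y.side f ⟨0, Δ.Y.len_pos f⟩)), ⟨_, Δ.label_face f⟩)) k t =
            TwoComplex.arcPoint (Δ.Y.len f) k t := congrArg (fun n => TwoComplex.arcPoint n k t) hl
        refine ((congrArg _ h2).symm.trans h1).trans ?_
        congr 1
        refine Prod.ext ?_ ?_
        · exact (h.src_side f k k.2).symm
        · simp [cayleyComplex])

end VanKampenDiagram

/-! ## Tame filling functions -/

/-- The set `ℕ[1/4]` of nonnegative multiples of `1/4`, in which coarse distances take their values. -/
def quarterNat : Set ℚ := {q | ∃ n : ℕ, q = n / 4}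

/-- `f` restricts to a nondecreasing function `ℕ[1/4] → ℕ[1/4]`. -/
def IsNondecreasing (f : ℚ → ℚ) : Prop :=
  Set.MapsTo f quarterNat quarterNat ∧ MonotoneOn f quarterNat

/-- `f` is an intrinsic tame filling function for `G` over the presentation. -/
def IsIntrinsicTameFilling (f : ℚ → ℚ) : Prop :=
  IsNondecreasing f ∧ ∀ w : List A, S.eval w = 1 →
    ∃ (Δ : P.VanKampenDiagram w) (ψ : Δ.boundary × unitInterval → Δ.Y.Space),
      TwoComplex.IsOneCombing Δ.base Δ.boundary ψ ∧ TwoComplex.IsTame Δ.base f ψ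

/-- `f` is an extrinsic tame filling function for `G` over the presentation. -/
def IsExtrinsicTameFilling (f : ℚ → ℚ) : Prop :=
  IsNondecreasing f ∧ ∀ w : List A, S.eval w = 1 →
    ∃ (Δ : P.VanKampenDiagram w) (ψ : Δ.boundary × unitInterval → Δ.Y.Space)
      (π : Δ.Y.V → G) (hπ : Δ.IsVertexProjection π),
      TwoComplex.IsOneCombing Δ.base Δ.boundary ψ ∧
        TwoComplex.IsTame (Y := P.cayleyComplex) (1 : G) f
          (fun x => VanKampenDiagram.projection π hπ (ψ x))

end FinPresentation

/-! ## Points of a combinatorial 2-complex -/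

/-! Tameness with respect to the identity means that the coarse distance from the base (the level)
never decreases along a combing path. The proof compares this with reductions of loops in the Cayley
graph.

Tame fillings give almost convexity. Let `g` and `ga` both have level `n`, and fill the loop made of
a geodesic to `g`, the edge `e` labelled `a`, and a geodesic back. Since the boundary is geodesic,
the ends of `e` also have level `n` in the diagram. A combing path over an interior point of `e`
ends at level `n + 1/2`, so once it has left the subcomplex of level at most `n` it meets no vertex:
it runs in open 2-cells, or in `e` itself. When it leaves, it is close to a corner of a 2-cell or to
an end of `e`. Sort the corners of each 2-cell by whether sides of that cell inside the ball connect
them to the start of `e`. If the ends of `e` were not joined in the ball by a path of length at most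
the longest relator, this sorting would give two disjoint open sets of exits, one used by points
near the start of `e` and the other by points near its end. The open edge is connected, a
contradiction (`joinedInBall_of_tame`). For a peak `g, ga, gab` with `ga` at level `n + 1`, the path
over the middle vertex stays in the 1-skeleton and leaves the ball at a vertex `v` along an edge
(`exists_exit_edge`); the same argument on the two edges joins both `g` and `gab` to `v`. A
`TameStrip` lets the argument run once for the diagram (intrinsic case) and for the Cayley complex
(extrinsic case). The intrinsic case also needs the map of the diagram to the Cayley graph; it
exists because labels around the cells of a planar disc multiply to 1, which
`SerreGraph.exists_potential` proves by a tree and cotree argument.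

Almost convexity gives tame fillings. With constant `k`, take as relators all nonempty words of
length at most `k + 2` that represent 1. Every loop shrinks to the empty one by replacing topmost
flat edges and peaks by paths of length at most `k` in the ball (`SymGen.loop_induction`). Read
backwards, this builds a diagram: a flat edge is a new edge with one 2-cell along the low path, and
a peak is a spur followed by such an edge. The combing grows along: follow the old combing to the
low path, at level at most `n`, then sweep across the new 2-cell at level `n + 1/4` to the new edge
at level `n + 1/2`. Throughout, distances from the base agree in the diagram and in the Cayley
graph, so one combing is tame in both senses. -/

namespace TwoComplex

open unitInterval Topology Set

/-- The point of the closed unit disc with radius `r` on the ray through `arcPoint n k t`. -/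
noncomputable def conePt (n k : ℕ) (t r : unitInterval) : Metric.closedBall (0 : ℂ) 1 :=
  ⟨(r : ℝ) * (arcPoint n k t : ℂ), by
    rw [mem_closedBall_zero_iff, norm_mul, arcPoint, Circle.norm_coe, mul_one, Complex.norm_real,
      Real.norm_of_nonneg r.2.1]
    exact r.2.2⟩

theorem norm_arcPoint (n k : ℕ) (t : unitInterval) : ‖(arcPoint n k t : ℂ)‖ = 1 := by
  rw [arcPoint, Circle.norm_coe]

theorem norm_conePt (n k : ℕ) (t r : unitInterval) : ‖(conePt n k t r : ℂ)‖ = r := by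
  rw [conePt, norm_mul, norm_arcPoint, mul_one, Complex.norm_real, Real.norm_of_nonneg r.2.1]

theorem conePt_one (n k : ℕ) (t : unitInterval) : conePt n k t 1 = arcPoint n k t := by
  ext; simp [conePt]

theorem conePt_inj {n k k' : ℕ} {t t' r r' : unitInterval} (h : conePt n k t r = conePt n k' t' r') :
    r = r' ∧ (r = 0 ∨ arcPoint n k t = arcPoint n k' t') := by
  have hr : r = r' := by
    have := congrArg (fun z : Metric.closedBall (0 : ℂ) 1 => ‖(z : ℂ)‖) h
    simp only [norm_conePt] at this
    exact Subtype.ext this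
  subst hr
  refine ⟨rfl, ?_⟩
  by_cases h0 : r = 0
  · exact Or.inl h0
  · right
    have h1 := congrArg (fun z : Metric.closedBall (0 : ℂ) 1 => (z : ℂ)) h
    simp only [conePt] at h1
    have : ((r : ℝ) : ℂ) ≠ 0 := by
      rw [Complex.ofReal_ne_zero]
      exact fun hh => h0 (Subtype.ext hh)
    exact Subtype.ext (mul_left_cancel₀ this h1)

theorem exists_conePt {n : ℕ} (hn : 0 < n) (z : Metric.closedBall (0 : ℂ) 1) :
    ∃ (k : Fin n) (t r : unitInterval), z = conePt n k t r := by
  have hz : ‖(z : ℂ)‖ ≤ 1 := mem_closedBall_zero_iff.mp z.2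
  by_cases h0 : (z : ℂ) = 0
  · refine ⟨⟨0, hn⟩, 0, 0, ?_⟩
    ext; simp [conePt, h0]
  · have hz0 : (0 : ℝ) < ‖(z : ℂ)‖ := norm_pos_iff.mpr h0
    have hz1 : ‖(z : ℂ) / (‖(z : ℂ)‖ : ℂ)‖ = 1 := by
      rw [norm_div, Complex.norm_real, norm_norm, div_self hz0.ne']
    obtain ⟨k, t, hkt⟩ := exists_arcPoint hn
      ⟨(z : ℂ) / (‖(z : ℂ)‖ : ℂ), by rw [mem_closedBall_zero_iff, hz1]⟩ hz1
    refine ⟨k, t, ⟨‖(z : ℂ)‖, hz0.le, hz⟩, ?_⟩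
    ext
    simp only [conePt, ← hkt]
    rw [mul_div_cancel₀]
    simpa using h0

theorem continuous_arcPoint (n k : ℕ) : Continuous (arcPoint n k) := by
  unfold arcPoint
  fun_prop

theorem continuous_conePt (n k : ℕ) : Continuous fun x : I × I => conePt n k x.1 x.2 := by
  unfold conePt
  have := continuous_arcPoint n k
  fun_prop

/-- A continuous surjection from a compact space onto a Hausdorff space is closed. Polar coordinates
thus detect the topology of the disc. -/
theorem isQuotientMap_conePt {n : ℕ} (hn : 0 < n) :
    IsQuotientMap (fun x : Fin n × I × I => conePt n x.1 x.2.1 x.2.2) := by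
  have hc : Continuous (fun x : Fin n × I × I => conePt n x.1 x.2.1 x.2.2) :=
    continuous_prod_of_discrete_left.mpr fun k => continuous_conePt n k
  refine hc.isClosedMap.isQuotientMap hc ?_
  intro z
  obtain ⟨k, t, r, h⟩ := exists_conePt hn z
  exact ⟨(k, t, r), h.symm⟩

variable {Y : TwoComplex}

theorem continuous_edgePt (d : Y.D) : Continuous (edgePt d : I → Y.Space) :=
  continuous_quot_mk.comp (continuous_inr.comp (continuous_inl.comp continuous_sigmaMk))

theorem continuous_facePt (f : Y.F) :
    Continuous (facePt f : Metric.closedBall (0 : ℂ) 1 → Y.Space) :=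
  continuous_quot_mk.comp (continuous_inr.comp (continuous_inr.comp continuous_sigmaMk))

theorem facePt_conePt_one (f : Y.F) (k : Fin (Y.len f)) (t : I) :
    facePt f (conePt (Y.len f) k t 1) = edgePt (Y.side f k) t := by
  rw [conePt_one, facePt_arc]

theorem edgePt_one (d : Y.D) : edgePt d 1 = vertexPt (Y.tgt d) := by
  rw [edgePt_flip, unitInterval.symm_one, edgePt_zero]; rfl

/-- The space is a quotient of a disjoint union, and polar coordinates are a further quotient map on
each disc, so openness can be tested on intervals and squares. -/
theorem isOpen_space {U : Set Y.Space} (he : ∀ d, IsOpen {t : I | edgePt d t ∈ U})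
    (hf : ∀ f (k : Fin (Y.len f)),
      IsOpen {x : I × I | facePt f (conePt (Y.len f) k x.1 x.2) ∈ U}) : IsOpen U := by
  change IsOpen (Quot.mk Y.Glue ⁻¹' U)
  rw [isOpen_sum_iff, isOpen_sum_iff]
  refine ⟨?_, ?_, ?_⟩
  · rw [isOpen_sigma_iff]
    exact fun v => isOpen_discrete _
  · rw [isOpen_sigma_iff]
    exact fun d => he d
  · rw [isOpen_sigma_iff]
    intro f
    rw [← (isQuotientMap_conePt (Y.len_pos f)).isOpen_preimage]
    have : ∀ U : Set (Fin (Y.len f) × I × I), (∀ k, IsOpen {x | (k, x) ∈ U}) → IsOpen U := by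
      intro U hU
      rw [isOpen_prod_iff]
      intro k x hkx
      exact ⟨{k}, {x | (k, x) ∈ U}, isOpen_discrete _, hU k, rfl, hkx, by
        rintro ⟨k', x'⟩ ⟨h1, h2⟩
        obtain rfl : k' = k := h1
        exact h2⟩
    exact this _ fun k => hf f k

/-- Maps out of the complex, described on vertices, directed edges and (radially) on 2-cells. -/
theorem exists_lift {T : Type*} (pv : Y.V → T) (pe : Y.D → I → T)
    (pf : (f : Y.F) → Fin (Y.len f) → I → I → T) (h0 : ∀ d, pe d 0 = pv (Y.src d))
    (hflip : ∀ d t, pe d t = pe (Y.inv d) (σ t)) (harc : ∀ f k t, pf f k t 1 = pe (Y.side f k) t)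
    (hcen : ∀ f k k' t t', pf f k t 0 = pf f k' t' 0)
    (hrot : ∀ f k r, pf f k 1 r = pf f (finRotate _ k) 0 r) :
    ∃ L : Y.Space → T, (∀ v, L (vertexPt v) = pv v) ∧ (∀ d t, L (edgePt d t) = pe d t) ∧
      ∀ f (k : Fin (Y.len f)) t r, L (facePt f (conePt (Y.len f) k t r)) = pf f k t r := by
  -- Polar coordinates are ambiguous only at the centre and on the rays through the corners, where
  -- `hcen` and `hrot` make the choice immaterial. No continuity is involved, so `T = Prop` may be
  -- used to build subsets.
  choose K Tm Rm hK using fun (f : Y.F) z => exists_conePt (Y.len_pos f) z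
  have hcirc : ∀ f (k k' : Fin (Y.len f)) t t' r,
      arcPoint (Y.len f) k t = arcPoint (Y.len f) k' t' → pf f k t r = pf f k' t' r := by
    intro f k k' t t' r h
    rcases arcPoint_eq h with ⟨rfl, rfl⟩ | ⟨rfl, rfl, rfl⟩ | ⟨rfl, rfl, rfl⟩
    · rfl
    · exact hrot f k r
    · exact (hrot f k' r).symm
  have key : ∀ f (k : Fin (Y.len f)) t r, pf f (K f (conePt (Y.len f) k t r)) (Tm f (conePt (Y.len f) k t r))
      (Rm f (conePt (Y.len f) k t r)) = pf f k t r := by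
    intro f k t r
    obtain ⟨h1, h2⟩ := conePt_inj (hK f (conePt (Y.len f) k t r))
    rw [← h1]
    rcases h2 with h2 | h2
    · subst h2; exact hcen _ _ _ _ _
    · exact (hcirc f _ _ _ _ r h2).symm
  refine ⟨Quot.lift (fun
      | .inl ⟨v, _⟩ => pv v
      | .inr (.inl ⟨d, t⟩) => pe d t
      | .inr (.inr ⟨f, z⟩) => pf f (K f z) (Tm f z) (Rm f z)) ?_, fun v => rfl, fun d t => rfl, key⟩
  intro a b hab
  cases hab with
  | src d => exact h0 d
  | flip d t => exact hflip d t
  | arc f k t =>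
    dsimp only
    have h := key f k t 1
    rw [conePt_one, harc] at h
    exact h

theorem edgePt_mem_openCell (d : Y.D) {t : I} (h0 : t ≠ 0) (h1 : t ≠ 1) :
    edgePt d t ∈ openCell (.edge d : Y.Cell) :=
  ⟨t, unitInterval.pos_iff_ne_zero.mpr h0, unitInterval.lt_one_iff_ne_one.mpr h1, rfl⟩

theorem coarseDist_vertexPt (y : Y.V) (v : Y.V) : coarseDist y (vertexPt v) = Y.dist y v :=
  coarseDist_eq y (c := .vertex v) rfl

theorem coarseDist_edgePt (y : Y.V) (d : Y.D) {t : I} (h0 : t ≠ 0) (h1 : t ≠ 1) :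
    coarseDist y (edgePt d t) = edgeDist y d :=
  coarseDist_eq y (edgePt_mem_openCell d h0 h1)

theorem coarseDist_edgePt_zero (y : Y.V) (d : Y.D) :
    coarseDist y (edgePt d 0) = Y.dist y (Y.src d) := by
  rw [edgePt_zero, coarseDist_vertexPt]

theorem coarseDist_edgePt_one (y : Y.V) (d : Y.D) :
    coarseDist y (edgePt d 1) = Y.dist y (Y.tgt d) := by
  rw [edgePt_one, coarseDist_vertexPt]

theorem coarseDist_facePt (y : Y.V) (f : Y.F) {z : Metric.closedBall (0 : ℂ) 1}
    (h : ‖(z : ℂ)‖ < 1) : coarseDist y (facePt f z) = cellDist y (.face f) :=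
  coarseDist_eq y ⟨z, h, rfl⟩

theorem coarseDist_facePt_conePt (y : Y.V) (f : Y.F) (k : Fin (Y.len f)) (t r : I) (hr : r ≠ 1) :
    coarseDist y (facePt f (conePt (Y.len f) k t r)) = cellDist y (.face f) :=
  coarseDist_facePt y f (by
    rw [norm_conePt]; exact unitInterval.lt_one_iff_ne_one.mpr hr)

theorem edgeDist_inv (y : Y.V) (d : Y.D) : edgeDist y (Y.inv d) = edgeDist y d := by
  simp [edgeDist, SerreGraph.tgt, Y.inv_inv, min_comm]

end TwoComplex

/-! ### Edge paths and distances in graphs -/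

namespace SerreGraph

variable {Γ : SerreGraph}

theorem tgt_inv (d : Γ.D) : Γ.tgt (Γ.inv d) = Γ.src d := by rw [tgt, Γ.inv_inv]

theorem isPath_append {u v : Γ.V} {p q : List Γ.D} :
    Γ.IsPath u (p ++ q) v ↔ ∃ m, Γ.IsPath u p m ∧ Γ.IsPath m q v := by
  induction p generalizing u with
  | nil => simp [IsPath]
  | cons d p ih =>
    simp only [List.cons_append, IsPath, ih]
    tauto

theorem IsPath.append {u m v : Γ.V} {p q : List Γ.D} (hp : Γ.IsPath u p m) (hq : Γ.IsPath m q v) :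
    Γ.IsPath u (p ++ q) v := isPath_append.mpr ⟨m, hp, hq⟩

theorem isPath_singleton (d : Γ.D) : Γ.IsPath (Γ.src d) [d] (Γ.tgt d) := ⟨rfl, rfl⟩

theorem IsPath.reverse {u v : Γ.V} {p : List Γ.D} (hp : Γ.IsPath u p v) :
    Γ.IsPath v (p.map Γ.inv).reverse u := by
  induction p generalizing u with
  | nil => exact hp.symm
  | cons d p ih =>
    obtain ⟨h1, h2⟩ := hp
    rw [List.map_cons, List.reverse_cons]
    refine (ih h2).append ⟨rfl, ?_⟩
    rw [tgt_inv]; exact h1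

theorem IsPath.dist_le {u v : Γ.V} {p : List Γ.D} (hp : Γ.IsPath u p v) :
    Γ.dist u v ≤ p.length := Nat.sInf_le ⟨p, hp, rfl⟩

theorem IsPath.exists_dist {u v : Γ.V} {p : List Γ.D} (hp : Γ.IsPath u p v) :
    ∃ q, Γ.IsPath u q v ∧ q.length = Γ.dist u v :=
  Nat.sInf_mem (s := {n | ∃ p, Γ.IsPath u p v ∧ p.length = n}) ⟨_, p, hp, rfl⟩

theorem dist_self (u : Γ.V) : Γ.dist u u = 0 :=
  Nat.le_zero.mp (IsPath.dist_le (p := []) rfl)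

theorem dist_tgt_le {y : Γ.V} (hc : ∀ v, ∃ p, Γ.IsPath y p v) (d : Γ.D) :
    Γ.dist y (Γ.tgt d) ≤ Γ.dist y (Γ.src d) + 1 := by
  obtain ⟨p, hp⟩ := hc (Γ.src d)
  obtain ⟨q, hq, hl⟩ := hp.exists_dist
  have := (hq.append (isPath_singleton d)).dist_le
  simpa [hl] using this

theorem dist_src_le {y : Γ.V} (hc : ∀ v, ∃ p, Γ.IsPath y p v) (d : Γ.D) :
    Γ.dist y (Γ.src d) ≤ Γ.dist y (Γ.tgt d) + 1 := by
  have := dist_tgt_le hc (Γ.inv d)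
  rwa [tgt_inv] at this

end SerreGraph


/-! ## Sublevel sets of the coarse distance -/

namespace TwoComplex

open unitInterval Topology Set

variable {Y : TwoComplex}

theorem edgeDist_le_iff (y : Y.V) (n : ℕ) (d : Y.D) :
    edgeDist y d ≤ n ↔ Y.dist y (Y.src d) + 1 ≤ n ∨ Y.dist y (Y.tgt d) + 1 ≤ n := by
  have h : edgeDist y d = ((min (Y.dist y (Y.src d)) (Y.dist y (Y.tgt d)) : ℕ) : ℚ) + 1 / 2 := by
    simp [edgeDist]
  rw [h]
  constructor
  · intro h1
    have h2 : ((min (Y.dist y (Y.src d)) (Y.dist y (Y.tgt d)) : ℕ) : ℚ) < n := by linarith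
    have h3 := Nat.cast_lt.mp h2
    omega
  · intro h1
    have h3 : min (Y.dist y (Y.src d)) (Y.dist y (Y.tgt d)) + 1 ≤ n := by omega
    have h4 : ((min (Y.dist y (Y.src d)) (Y.dist y (Y.tgt d)) : ℕ) : ℚ) + 1 ≤ n := by
      exact_mod_cast h3
    linarith

theorem dist_src_le_of_edgeDist_le {y : Y.V} (hc : ∀ v, ∃ p, Y.IsPath y p v) {n : ℕ} {d : Y.D}
    (h : edgeDist y d ≤ n) : Y.dist y (Y.src d) ≤ n := by
  have := SerreGraph.dist_src_le hc d
  rcases (edgeDist_le_iff y n d).mp h with h | h <;> omega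

theorem dist_tgt_le_of_edgeDist_le {y : Y.V} (hc : ∀ v, ∃ p, Y.IsPath y p v) {n : ℕ} {d : Y.D}
    (h : edgeDist y d ≤ n) : Y.dist y (Y.tgt d) ≤ n := by
  have := SerreGraph.dist_tgt_le hc d
  rcases (edgeDist_le_iff y n d).mp h with h | h <;> omega

/-- Edge levels lie in `ℕ + 1/2`, so a slack of 1/4 above an integer admits no new edge. This
absorbs the 1/4 in the level of a 2-cell. -/
theorem edgeDist_quarter (y : Y.V) (n : ℕ) (d : Y.D) (h : edgeDist y d ≤ n + 1 / 4) :
    edgeDist y d ≤ n := by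
  have h1 : edgeDist y d = ((min (Y.dist y (Y.src d)) (Y.dist y (Y.tgt d)) : ℕ) : ℚ) + 1 / 2 := by
    simp [edgeDist]
  rw [h1] at h ⊢
  have h2 : ((min (Y.dist y (Y.src d)) (Y.dist y (Y.tgt d)) : ℕ) : ℚ) < n := by linarith
  have h3 : ((min (Y.dist y (Y.src d)) (Y.dist y (Y.tgt d)) : ℕ) : ℚ) + 1 ≤ n := by
    exact_mod_cast Nat.cast_lt.mp h2
  linarith

theorem cellDist_face_le_iff (y : Y.V) (n : ℕ) (f : Y.F) :
    cellDist y (.face f) ≤ n ↔ ∀ k, edgeDist y (Y.side f k) ≤ n := by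
  have : cellDist y (.face f) ≤ n ↔ ∀ k, edgeDist y (Y.side f k) ≤ n + 1 / 4 := by
    simp only [cellDist]
    rw [sub_le_iff_le_add]
    exact (Finset.sup'_le_iff _ _).trans (by simp)
  rw [this]
  exact ⟨fun h k => edgeDist_quarter y n _ (h k), fun h k => (h k).trans (by norm_num)⟩

theorem lt_cellDist_face {y : Y.V} {n : ℕ} {f : Y.F} {k : Fin (Y.len f)}
    (h : (n : ℚ) < edgeDist y (Y.side f k)) : (n : ℚ) < cellDist y (.face f) := by
  by_contra hc
  exact absurd ((cellDist_face_le_iff y n f).mp (not_lt.mp hc) k) (not_le.mpr h)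

/-- For an integer `n` the points of level at most `n` form a subcomplex, hence a closed set. At
level `n + 1/2` this would fail, since an edge may belong without its far end. -/
theorem isOpen_lt_coarseDist (y : Y.V) (hc : ∀ v, ∃ p, Y.IsPath y p v) (n : ℕ) :
    IsOpen {x : Y.Space | (n : ℚ) < coarseDist y x} := by
  have he : ∀ d : Y.D, IsOpen {t : I | (n : ℚ) < coarseDist y (edgePt d t)} := by
    intro d
    by_cases hd : edgeDist y d ≤ n
    · convert isOpen_empty
      ext t
      simp only [mem_ofPred_eq, mem_empty_iff_false, iff_false, not_lt]
      by_cases h0 : t = 0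
      · rw [h0, coarseDist_edgePt_zero]
        exact_mod_cast dist_src_le_of_edgeDist_le hc hd
      by_cases h1 : t = 1
      · rw [h1, coarseDist_edgePt_one]
        exact_mod_cast dist_tgt_le_of_edgeDist_le hc hd
      rwa [coarseDist_edgePt y d h0 h1]
    · rw [← isClosed_compl_iff]
      refine Set.Finite.isClosed (Set.Finite.subset (Set.toFinite {0, 1}) ?_)
      intro t ht
      by_contra h
      simp only [mem_insert_iff, mem_singleton_iff, not_or] at h
      apply ht
      simp only [mem_ofPred_eq]
      rw [coarseDist_edgePt y d h.1 h.2]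
      exact not_le.mp hd
  refine isOpen_space he ?_
  intro f k
  by_cases hf : cellDist y (.face f) ≤ n
  · convert isOpen_empty
    ext ⟨t, r⟩
    simp only [mem_ofPred_eq, mem_empty_iff_false, iff_false, not_lt]
    by_cases hr : r = 1
    · subst hr
      have hk := (cellDist_face_le_iff y n f).mp hf k
      rw [facePt_conePt_one]
      by_cases h0 : t = 0
      · rw [h0, coarseDist_edgePt_zero]
        exact_mod_cast dist_src_le_of_edgeDist_le hc hk
      by_cases h1 : t = 1
      · rw [h1, coarseDist_edgePt_one]
        exact_mod_cast dist_tgt_le_of_edgeDist_le hc hk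
      rwa [coarseDist_edgePt y _ h0 h1]
    · rwa [coarseDist_facePt_conePt _ _ _ _ _ hr]
  · have : {x : I × I | facePt f (conePt (Y.len f) k x.1 x.2) ∈ {x : Y.Space | (n : ℚ) < coarseDist y x}}
        = {x : I × I | x.2 ≠ 1} ∪ Prod.fst ⁻¹' {t : I | (n : ℚ) < coarseDist y (edgePt (Y.side f k) t)} := by
      ext ⟨t, r⟩
      simp only [mem_ofPred_eq, mem_union, mem_preimage]
      by_cases hr : r = 1
      · subst hr
        rw [facePt_conePt_one]; simp
      · rw [coarseDist_facePt_conePt _ _ _ _ _ hr]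
        simp [hr, not_le.mp hf]
    rw [this]
    exact (isOpen_ne_fun continuous_snd continuous_const).union ((he _).preimage continuous_fst)

/-- The end of the edge `d` nearest to the point with parameter `t` is in the ball of radius `n`; for
the midpoint, the whole edge is. -/
def NearBall (y : Y.V) (n : ℕ) (d : Y.D) (t : I) : Prop :=
  ((t : ℝ) < 1 / 2 → Y.dist y (Y.src d) ≤ n) ∧ (1 / 2 < (t : ℝ) → Y.dist y (Y.tgt d) ≤ n) ∧
    ((t : ℝ) = 1 / 2 → edgeDist y d ≤ n)

theorem nearBall_of_edgeDist_le {y : Y.V} (hc : ∀ v, ∃ p, Y.IsPath y p v) {n : ℕ} {d : Y.D}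
    (h : edgeDist y d ≤ n) (t : I) : NearBall y n d t :=
  ⟨fun _ => dist_src_le_of_edgeDist_le hc h, fun _ => dist_tgt_le_of_edgeDist_le hc h, fun _ => h⟩

theorem nearBall_zero (y : Y.V) (n : ℕ) (d : Y.D) :
    NearBall y n d 0 ↔ Y.dist y (Y.src d) ≤ n := by
  simp [NearBall]

theorem nearBall_one (y : Y.V) (n : ℕ) (d : Y.D) :
    NearBall y n d 1 ↔ Y.dist y (Y.tgt d) ≤ n := by
  have h1 : (2 : ℝ)⁻¹ < 1 := by norm_num
  have h2 : ¬ (1 : ℝ) < 2⁻¹ := by norm_num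
  have h3 : ¬ (1 : ℝ) = 2⁻¹ := by norm_num
  simp [NearBall, h1, h2, h3]

theorem nearBall_inv (y : Y.V) (n : ℕ) (d : Y.D) (t : I) :
    NearBall y n (Y.inv d) (σ t) ↔ NearBall y n d t := by
  have h1 : (1 - (t : ℝ) < 1 / 2) ↔ (1 / 2 < (t : ℝ)) := by constructor <;> intro h <;> linarith
  have h2 : (1 / 2 < 1 - (t : ℝ)) ↔ ((t : ℝ) < 1 / 2) := by constructor <;> intro h <;> linarith
  have h3 : (1 - (t : ℝ) = 1 / 2) ↔ ((t : ℝ) = 1 / 2) := by constructor <;> intro h <;> linarith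
  unfold NearBall
  rw [unitInterval.coe_symm_eq, h1, h2, h3, edgeDist_inv, SerreGraph.tgt_inv, SerreGraph.tgt]
  tauto

theorem isOpen_nearBall {y : Y.V} (hc : ∀ v, ∃ p, Y.IsPath y p v) (n : ℕ) (d : Y.D) :
    IsOpen {t : I | NearBall y n d t} := by
  by_cases h : edgeDist y d ≤ n
  · convert isOpen_univ
    exact eq_univ_of_forall fun t => nearBall_of_edgeDist_le hc h t
  · have : {t : I | NearBall y n d t} = ({t : I | (t : ℝ) < 1 / 2} ∩ {_t | Y.dist y (Y.src d) ≤ n}) ∪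
        ({t : I | 1 / 2 < (t : ℝ)} ∩ {_t | Y.dist y (Y.tgt d) ≤ n}) := by
      ext t
      simp only [NearBall, mem_ofPred_eq, mem_union, mem_inter_iff]
      rcases lt_trichotomy (t : ℝ) (1 / 2) with ht | ht | ht
      · have h1 := ht.not_gt
        have h2 := ht.ne
        tauto
      · simp [ht, h]
      · have h1 := ht.not_gt
        have h2 := ht.ne'
        tauto
    rw [this]
    exact ((isOpen_lt continuous_subtype_val continuous_const).inter isOpen_const).union
      ((isOpen_lt continuous_const continuous_subtype_val).inter isOpen_const)

/-- An open neighbourhood of the sublevel set `coarseDist y ≤ n`: the points whose nearest vertex is in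
the ball of radius `n`. -/
theorem exists_nearSet {y : Y.V} (hc : ∀ v, ∃ p, Y.IsPath y p v) (n : ℕ) :
    ∃ O : Set Y.Space, IsOpen O ∧ (∀ v, vertexPt v ∈ O ↔ Y.dist y v ≤ n) ∧
      (∀ d t, edgePt d t ∈ O ↔ NearBall y n d t) ∧
      ∀ f (k : Fin (Y.len f)) t r, facePt f (conePt (Y.len f) k t r) ∈ O ↔
        (cellDist y (.face f) ≤ n ∨ (r ≠ 0 ∧ NearBall y n (Y.side f k) t)) := by
  obtain ⟨L, hv, he, hf⟩ := exists_lift (Y := Y) (T := Prop) (fun v => Y.dist y v ≤ n)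
    (fun d t => NearBall y n d t)
    (fun f k t r => cellDist y (.face f) ≤ n ∨ (r ≠ 0 ∧ NearBall y n (Y.side f k) t))
    (fun d => propext (nearBall_zero y n d)) (fun d t => propext (nearBall_inv y n d t).symm)
    (fun f k t => propext ⟨fun h => h.elim
      (fun h => nearBall_of_edgeDist_le hc ((cellDist_face_le_iff y n f).mp h k) t) fun h => h.2,
      fun h => Or.inr ⟨one_ne_zero, h⟩⟩)
    (fun f k k' t t' => by simp)
    (fun f k r => by
      rw [propext (nearBall_one y n _), propext (nearBall_zero y n _), SerreGraph.tgt,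
        Y.side_closed])
  refine ⟨{x | L x}, isOpen_space (fun d => ?_) (fun f k => ?_), fun v => (hv v).to_iff,
    fun d t => (he d t).to_iff, fun f k t r => (hf f k t r).to_iff⟩
  · simp only [mem_ofPred_eq, he]
    exact isOpen_nearBall hc n d
  · simp only [mem_ofPred_eq, hf]
    exact isOpen_const.union ((isOpen_ne_fun continuous_snd continuous_const).inter
      ((isOpen_nearBall hc n _).preimage continuous_fst))

/-- The points of the edge `d` near an end selected by `E`. -/
def EdgeSector (E : Y.D → Prop) (d : Y.D) (t : I) : Prop :=
  (0 < (t : ℝ) ∧ (t : ℝ) < 1 / 2 ∧ E d) ∨ (1 / 2 < (t : ℝ) ∧ (t : ℝ) < 1 ∧ E (Y.inv d))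

/-- The points of side `k` of `f` near a corner selected by `good`. -/
def CornerSector (y : Y.V) (n : ℕ) {f : Y.F} (good : Fin (Y.len f) → Prop) (k : Fin (Y.len f))
    (t : I) : Prop :=
  ((t : ℝ) < 1 / 2 ∧ good k) ∨ (1 / 2 < (t : ℝ) ∧ good (finRotate _ k)) ∨
    ((t : ℝ) = 1 / 2 ∧ edgeDist y (Y.side f k) ≤ n ∧ good k)

theorem isOpen_edgeSector (E : Y.D → Prop) (d : Y.D) : IsOpen {t : I | EdgeSector E d t} := by
  have h : Continuous fun t : I => (t : ℝ) := continuous_subtype_val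
  exact ((isOpen_lt continuous_const h).inter ((isOpen_lt h continuous_const).inter
    isOpen_const)).union ((isOpen_lt continuous_const h).inter ((isOpen_lt h continuous_const).inter
    isOpen_const))

theorem isOpen_cornerSector (y : Y.V) (n : ℕ) {f : Y.F} (good : Fin (Y.len f) → Prop)
    (k : Fin (Y.len f)) (hg : edgeDist y (Y.side f k) ≤ n → (good k ↔ good (finRotate _ k))) :
    IsOpen {t : I | CornerSector y n good k t} := by
  have h : Continuous fun t : I => (t : ℝ) := continuous_subtype_val
  by_cases hk : edgeDist y (Y.side f k) ≤ n
  · have : {t : I | CornerSector y n good k t} = {_t | good k} := by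
      ext t
      simp only [CornerSector, mem_ofPred_eq, ← hg hk, hk, true_and]
      rcases lt_trichotomy (t : ℝ) (1 / 2) with ht | ht | ht
      · have h1 := ht.not_gt
        have h2 := ht.ne
        tauto
      · simp [ht]
      · have h1 := ht.not_gt
        have h2 := ht.ne'
        tauto
    rw [this]
    exact isOpen_const
  · simp only [CornerSector, hk, false_and, and_false, or_false]
    exact ((isOpen_lt h continuous_const).inter isOpen_const).union
      ((isOpen_lt continuous_const h).inter isOpen_const)

/-- These are the sets into which exits from the ball are sorted: sectors of 2-cells at the corners
marked `good`, and halves of edges at the ends marked by `E`. `hg` lets the two sectors along a side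
in the ball merge across its midpoint ray, and `hE` ensures that every 2-cell next to a marked edge
is outside the ball, which openness at the rim requires. -/
theorem exists_sectorSet (y : Y.V) (n : ℕ) (good : ∀ f : Y.F, Fin (Y.len f) → Prop)
    (E : Y.D → Prop)
    (hg : ∀ f k, edgeDist y (Y.side f k) ≤ n → (good f k ↔ good f (finRotate _ k)))
    (hE : ∀ d, E d → (n : ℚ) < edgeDist y d) :
    ∃ Q : Set Y.Space, IsOpen Q ∧ (∀ v, vertexPt v ∉ Q) ∧
      (∀ d t, edgePt d t ∈ Q ↔ EdgeSector E d t) ∧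
      ∀ f (k : Fin (Y.len f)) t r, facePt f (conePt (Y.len f) k t r) ∈ Q ↔
        ((n : ℚ) < cellDist y (.face f) ∧ r ≠ 0 ∧
          ((r ≠ 1 ∧ CornerSector y n (good f) k t) ∨ EdgeSector E (Y.side f k) t)) := by
  have hE0 : ∀ d, ¬ EdgeSector E d 0 := by
    intro d; simp [EdgeSector]
  have hE1 : ∀ d, ¬ EdgeSector E d 1 := by
    intro d; simp [EdgeSector]; intro h; norm_num at h
  have hEd : ∀ d t, EdgeSector E d t → (n : ℚ) < edgeDist y d := by
    rintro d t (⟨-, -, h⟩ | ⟨-, -, h⟩)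
    · exact hE _ h
    · rw [← edgeDist_inv]; exact hE _ h
  have hn1 : (2 : ℝ)⁻¹ < 1 := by norm_num
  have hn2 : ¬ (1 : ℝ) < 2⁻¹ := by norm_num
  have hn3 : ¬ (1 : ℝ) = 2⁻¹ := by norm_num
  obtain ⟨L, hv, he, hf⟩ := exists_lift (Y := Y) (T := Prop) (fun v => False)
    (fun d t => EdgeSector E d t)
    (fun f k t r => (n : ℚ) < cellDist y (.face f) ∧ r ≠ 0 ∧
          ((r ≠ 1 ∧ CornerSector y n (good f) k t) ∨ EdgeSector E (Y.side f k) t))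
    (fun d => propext (iff_false_intro (hE0 d)))
    (fun d t => by
      have h1 : (1 - (t : ℝ) < 1 / 2) ↔ (1 / 2 < (t : ℝ)) := by constructor <;> intro h <;> linarith
      have h2 : (1 / 2 < 1 - (t : ℝ)) ↔ ((t : ℝ) < 1 / 2) := by constructor <;> intro h <;> linarith
      have h3 : (1 - (t : ℝ) < 1) ↔ (0 < (t : ℝ)) := by constructor <;> intro h <;> linarith
      have h4 : (0 < 1 - (t : ℝ)) ↔ ((t : ℝ) < 1) := by constructor <;> intro h <;> linarith
      apply propext
      unfold EdgeSector
      rw [unitInterval.coe_symm_eq, h1, h2, h3, h4, Y.inv_inv]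
      tauto)
    (fun f k t => propext ⟨fun h => h.2.2.elim (fun h => absurd rfl h.1) id,
      fun h => ⟨lt_cellDist_face (hEd _ _ h), one_ne_zero, Or.inr h⟩⟩)
    (fun f k k' t t' => by simp)
    (fun f k r => by
      simp only [hE0, hE1, or_false, CornerSector]
      simp [hn1, hn2, hn3])
  refine ⟨{x | L x}, isOpen_space (fun d => ?_) (fun f k => ?_), fun v => (hv v).to_iff.mp,
    fun d t => (he d t).to_iff, fun f k t r => (hf f k t r).to_iff⟩
  · simp only [mem_ofPred_eq, he]
    exact isOpen_edgeSector E d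
  · simp only [mem_ofPred_eq, hf]
    exact isOpen_const.inter ((isOpen_ne_fun continuous_snd continuous_const).inter
      (((isOpen_ne_fun continuous_snd continuous_const).inter
        ((isOpen_cornerSector y n (good f) k (hg f k)).preimage continuous_fst)).union
        ((isOpen_edgeSector E _).preimage continuous_fst)))

end TwoComplex


/-! ## Tame combings yield short paths in balls -/

namespace TwoComplex

open unitInterval Topology Set

variable {Y : TwoComplex}

/-- `a` and `b` are joined by a path of length at most `K` all of whose edges have coarse distance at
most `n` from `y`. -/
def JoinedInBall (y : Y.V) (n K : ℕ) (a b : Y.V) : Prop :=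
  ∃ p : List Y.D, Y.IsPath a p b ∧ p.length ≤ K ∧ ∀ d ∈ p, edgeDist y d ≤ n

theorem JoinedInBall.symm {y : Y.V} {n K : ℕ} {a b : Y.V} (h : JoinedInBall y n K a b) :
    JoinedInBall y n K b a := by
  obtain ⟨p, h1, h2, h3⟩ := h
  refine ⟨_, h1.reverse, by simpa using h2, ?_⟩
  intro d hd
  simp only [List.mem_reverse, List.mem_map] at hd
  obtain ⟨e, he, rfl⟩ := hd
  rw [edgeDist_inv]; exact h3 e he

theorem JoinedInBall.trans {y : Y.V} {n K K' : ℕ} {a b c : Y.V} (h : JoinedInBall y n K a b)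
    (h' : JoinedInBall y n K' b c) : JoinedInBall y n (K + K') a c := by
  obtain ⟨p, h1, h2, h3⟩ := h
  obtain ⟨p', h1', h2', h3'⟩ := h'
  refine ⟨p ++ p', h1.append h1', by simp only [List.length_append]; omega, ?_⟩
  intro d hd
  rcases List.mem_append.mp hd with hd | hd
  · exact h3 d hd
  · exact h3' d hd

/-- Two corners of a 2-cell are adjacent if the side between them is in the ball. -/
def CornerAdj (y : Y.V) (n : ℕ) (f : Y.F) (k k' : Fin (Y.len f)) : Prop :=
  edgeDist y (Y.side f k) ≤ n ∧ k' = finRotate _ k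

/-- A simple path in the graph of corners visits each corner at most once, so it has fewer than `len
f` steps. This is where the length of the relators bounds the constant of almost convexity. -/
theorem joinedInBall_of_eqvGen {y : Y.V} {n : ℕ} {f : Y.F} {k k' : Fin (Y.len f)}
    (h : Relation.EqvGen (CornerAdj y n f) k k') :
    JoinedInBall y n (Y.len f) (Y.src (Y.side f k)) (Y.src (Y.side f k')) := by
  have hreach : (SimpleGraph.fromRel (CornerAdj y n f)).Reachable k k' := by
    induction h with
    | rel a b hab =>
      by_cases hne : a = b
      · rw [hne]
      · exact SimpleGraph.Adj.reachable ((SimpleGraph.fromRel_adj _ _ _).mpr ⟨hne, Or.inl hab⟩)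
    | refl a => exact SimpleGraph.Reachable.refl a
    | symm a b _ ih => exact ih.symm
    | trans a b c _ _ ih1 ih2 => exact ih1.trans ih2
  obtain ⟨w, hw⟩ := hreach.exists_isPath
  have hlen := hw.length_lt
  rw [Fintype.card_fin] at hlen
  have key : ∀ {k k' : Fin (Y.len f)} (w : (SimpleGraph.fromRel (CornerAdj y n f)).Walk k k'),
      JoinedInBall y n w.length (Y.src (Y.side f k)) (Y.src (Y.side f k')) := by
    intro k k' w
    induction w with
    | nil => exact ⟨[], rfl, le_rfl, by simp⟩
    | @cons a b c hab w ih =>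
      have hstep : ∀ a b, CornerAdj y n f a b →
          JoinedInBall y n 1 (Y.src (Y.side f a)) (Y.src (Y.side f b)) := by
        rintro a b ⟨h1, rfl⟩
        refine ⟨[Y.side f a], ⟨rfl, Y.side_closed f a⟩, le_rfl, ?_⟩
        intro d hd
        rw [List.mem_singleton.mp hd]; exact h1
      have h1 : JoinedInBall y n 1 (Y.src (Y.side f a)) (Y.src (Y.side f b)) := by
        rcases ((SimpleGraph.fromRel_adj _ _ _).mp hab).2 with h | h
        · exact hstep a b h
        · exact (hstep b a h).symm
      rw [SimpleGraph.Walk.length_cons, add_comm]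
      exact h1.trans ih
  obtain ⟨p, h1, h2, h3⟩ := key w
  exact ⟨p, h1, h2.trans hlen.le, h3⟩

/-- The open star of a set of open edges. -/
theorem exists_edgeStar (D₀ : Y.D → Prop) (hD : ∀ d, D₀ (Y.inv d) ↔ D₀ d) :
    ∃ S : Set Y.Space, IsOpen S ∧ ∀ d t, edgePt d t ∈ S ↔ (D₀ d ∧ t ≠ 0 ∧ t ≠ 1) := by
  obtain ⟨L, hv, he, hf⟩ := exists_lift (Y := Y) (T := Prop) (fun v => False)
    (fun d t => D₀ d ∧ t ≠ 0 ∧ t ≠ 1)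
    (fun f k t r => r ≠ 1 ∨ (D₀ (Y.side f k) ∧ t ≠ 0 ∧ t ≠ 1))
    (fun d => by simp)
    (fun d t => by
      have h0 : σ t = 0 ↔ t = 1 := by rw [← unitInterval.symm_one, unitInterval.symm_inj]
      have h1 : σ t = 1 ↔ t = 0 := by rw [← unitInterval.symm_zero, unitInterval.symm_inj]
      rw [hD, Ne, Ne, Ne, Ne, h0, h1]
      exact propext (by tauto))
    (fun f k t => by simp)
    (fun f k k' t t' => by simp)
    (fun f k r => by simp)
  refine ⟨{x | L x}, isOpen_space (fun d => ?_) (fun f k => ?_), fun d t => (he d t).to_iff⟩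
  · simp only [mem_ofPred_eq, he]
    exact isOpen_const.inter ((isOpen_ne_fun continuous_id continuous_const).inter
      (isOpen_ne_fun continuous_id continuous_const))
  · simp only [mem_ofPred_eq, hf]
    exact (isOpen_ne_fun continuous_snd continuous_const).union (isOpen_const.inter
      ((isOpen_ne_fun continuous_fst continuous_const).inter
      (isOpen_ne_fun continuous_fst continuous_const)))

/-- The open stars of `{e, inv e}` and of all other edges separate the union of the open edges,
while the time interval is connected. -/
theorem same_edge_of_path {γ : I → Y.Space} (hγ : Continuous γ) {a : I}
    (h : ∀ t, a ≤ t → ∃ d s, s ≠ 0 ∧ s ≠ 1 ∧ γ t = edgePt d s) {e : Y.D} {s : I}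
    (hs0 : s ≠ 0) (hs1 : s ≠ 1) (hγ1 : γ 1 = edgePt e s) :
    ∃ s, s ≠ 0 ∧ s ≠ 1 ∧ γ a = edgePt e s := by
  have hinv : ∀ d, (Y.inv d = e ∨ Y.inv d = Y.inv e) ↔ (d = e ∨ d = Y.inv e) := by
    intro d
    constructor
    · rintro (h | h)
      · right; rw [← h, Y.inv_inv]
      · left; rw [← Y.inv_inv d, h, Y.inv_inv]
    · rintro (h | h)
      · right; rw [h]
      · left; rw [h, Y.inv_inv]
  obtain ⟨S, hSo, hS⟩ := exists_edgeStar (Y := Y) (fun d => d = e ∨ d = Y.inv e) hinv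
  obtain ⟨S', hSo', hS'⟩ := exists_edgeStar (Y := Y) (fun d => ¬ (d = e ∨ d = Y.inv e))
    (fun d => not_congr (hinv d))
  have hpre : IsPreconnected (Icc a 1 : Set I) := isPreconnected_Icc
  have ha : γ a ∈ S := by
    by_contra hcon
    have hcov : (Icc a 1 : Set I) ⊆ γ ⁻¹' S ∪ γ ⁻¹' S' := by
      intro t ht
      obtain ⟨d, s, h0, h1, h2⟩ := h t ht.1
      simp only [mem_union, mem_preimage, h2, hS, hS']
      tauto
    have haS' : γ a ∈ S' := (hcov ⟨le_rfl, le_one'⟩).resolve_left hcon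
    have h1S : γ 1 ∈ S := by rw [hγ1, hS]; exact ⟨Or.inl rfl, hs0, hs1⟩
    obtain ⟨t, ht, h2, h3⟩ := hpre _ _ (hSo.preimage hγ) (hSo'.preimage hγ) hcov
      ⟨1, ⟨le_one', le_rfl⟩, h1S⟩ ⟨a, ⟨le_rfl, le_one'⟩, haS'⟩
    obtain ⟨d, s, h0, h1, h4⟩ := h t ht.1
    simp only [mem_preimage, h4, hS, hS'] at h2 h3
    exact h3.1 h2.1
  obtain ⟨d, s', h0, h1, h2⟩ := h a le_rfl
  rw [h2, hS] at ha
  rcases ha.1 with rfl | rfl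
  · exact ⟨s', h0, h1, h2⟩
  · refine ⟨σ s', ?_, ?_, ?_⟩
    · intro h; exact h1 (by rw [← unitInterval.symm_symm s', h, unitInterval.symm_zero])
    · intro h; exact h0 (by rw [← unitInterval.symm_symm s', h, unitInterval.symm_one])
    · rw [h2, edgePt_flip, Y.inv_inv]

/-- The last time at which a path is in the sublevel set. -/
theorem exists_last_time {y : Y.V} (hc : ∀ v, ∃ p, Y.IsPath y p v) {n : ℕ} {γ : I → Y.Space}
    (hγ : Continuous γ) (h0 : γ 0 = vertexPt y) (h1 : (n : ℚ) < coarseDist y (γ 1))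
    {O : Set Y.Space} (hO : IsOpen O) (hsub : ∀ x, coarseDist y x ≤ n → x ∈ O)
    (hmono : ∀ s t, s ≤ t → coarseDist y (γ s) ≤ coarseDist y (γ t)) :
    ∃ t, (n : ℚ) < coarseDist y (γ t) ∧ ∀ t' ≤ t, γ t' ∈ O := by
  set C : Set I := {t | coarseDist y (γ t) ≤ n} with hC
  have hCc : IsClosed C := by
    rw [← isOpen_compl_iff]
    convert (isOpen_lt_coarseDist y hc n).preimage hγ using 1
    ext t; simp [hC]
  have hCne : C.Nonempty := ⟨0, by
    simp only [hC, mem_ofPred_eq, h0, coarseDist_vertexPt, SerreGraph.dist_self]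
    simp⟩
  have hT : sSup C ∈ C := hCc.isCompact.sSup_mem hCne
  have hT1 : sSup C < 1 := by
    refine lt_of_le_of_ne le_one' fun h => ?_
    rw [h] at hT
    exact absurd hT (not_le.mpr h1)
  have hnear : ∀ᶠ t in 𝓝 (sSup C), γ t ∈ O := (hO.preimage hγ).mem_nhds (hsub _ hT)
  -- Openness of `O` leaves a little time after the last moment in the ball during which the path is
  -- outside the ball but still near it.
  have : ∃ t, sSup C < t ∧ ∀ t' ∈ Icc (sSup C) t, γ t' ∈ O := by
    obtain ⟨u, hu, hu'⟩ := (mem_nhdsGE_iff_exists_Ico_subset' hT1).mp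
      (mem_nhdsWithin_of_mem_nhds hnear)
    obtain ⟨t, ht1, ht2⟩ := exists_between (mem_Ioi.mp hu)
    exact ⟨t, ht1, fun t' ht' => hu' ⟨ht'.1, ht'.2.trans_lt ht2⟩⟩
  obtain ⟨t, ht, ht'⟩ := this
  refine ⟨t, ?_, ?_⟩
  · by_contra hcon
    exact absurd (le_sSup (show t ∈ C from not_lt.mp hcon)) (not_le.mpr ht)
  · intro t' ht2
    rcases le_total (sSup C) t' with h | h
    · exact ht' t' ⟨h, ht2⟩
    · exact hsub _ ((hmono _ _ h).trans hT)

theorem mem_nearSet_of_coarseDist_le {y : Y.V} (hc : ∀ v, ∃ p, Y.IsPath y p v) {n : ℕ}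
    {O : Set Y.Space} (hOv : ∀ v, vertexPt v ∈ O ↔ Y.dist y v ≤ n)
    (hOe : ∀ d t, edgePt d t ∈ O ↔ NearBall y n d t)
    (hOf : ∀ f (k : Fin (Y.len f)) t r, facePt f (conePt (Y.len f) k t r) ∈ O ↔
        (cellDist y (.face f) ≤ n ∨ (r ≠ 0 ∧ NearBall y n (Y.side f k) t)))
    (x : Y.Space) (hx : coarseDist y x ≤ n) : x ∈ O := by
  obtain ⟨c, hcx⟩ := exists_mem_openCell x
  rw [coarseDist_eq y hcx] at hx
  cases c with
  | vertex v =>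
    obtain rfl : x = vertexPt v := hcx
    rw [hOv]
    exact_mod_cast (show (Y.dist y v : ℚ) ≤ n from hx)
  | edge d =>
    obtain ⟨t, -, -, rfl⟩ := hcx
    rw [hOe]
    exact nearBall_of_edgeDist_le hc hx t
  | face f =>
    obtain ⟨z, -, rfl⟩ := hcx
    obtain ⟨k, t, r, rfl⟩ := exists_conePt (Y.len_pos f) z
    rw [hOf]
    exact Or.inl hx

theorem edgeDist_of_le {y : Y.V} {n : ℕ} {e : Y.D} (hsrc : Y.dist y (Y.src e) = n)
    (htgt : n ≤ Y.dist y (Y.tgt e)) : edgeDist y e = n + 1 / 2 := by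
  have : (n : ℚ) ≤ Y.dist y (Y.tgt e) := by exact_mod_cast htgt
  rw [edgeDist, hsrc, min_eq_left this]

/-- A fibre over an interior point of an edge of level `n + 1/2` only meets, outside the ball of radius
`n`, open 2-cells and that edge. -/
theorem mem_face_or_edge {y : Y.V} {n : ℕ} {e : Y.D} (he : edgeDist y e = n + 1 / 2)
    {γ : I → Y.Space} (hγ : Continuous γ) {p : I} (hp0 : p ≠ 0) (hp1 : p ≠ 1)
    (h1 : γ 1 = edgePt e p) (hmono : ∀ s t, s ≤ t → coarseDist y (γ s) ≤ coarseDist y (γ t))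
    {t : I} (ht : (n : ℚ) < coarseDist y (γ t)) :
    (∃ s, s ≠ 0 ∧ s ≠ 1 ∧ γ t = edgePt e s) ∨
      ∃ f, ∃ z : Metric.closedBall (0 : ℂ) 1, ‖(z : ℂ)‖ < 1 ∧ γ t = facePt f z ∧ (n : ℚ) < cellDist y (.face f) := by
  have hle : ∀ s, coarseDist y (γ s) ≤ n + 1 / 2 := fun s => by
    have := hmono s 1 le_one'
    rwa [h1, coarseDist_edgePt y e hp0 hp1, he] at this
  have hnov : ∀ s v, t ≤ s → γ s ≠ vertexPt v := by
    intro s v hts hsv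
    have h2 := hle s
    have h3 := ht.trans_le (hmono t s hts)
    rw [hsv, coarseDist_vertexPt] at h2 h3
    have h4 : n + 1 ≤ Y.dist y v := by exact_mod_cast h3
    have h5 : (n : ℚ) + 1 ≤ Y.dist y v := by exact_mod_cast h4
    linarith
  obtain ⟨c, hcx⟩ := exists_mem_openCell (γ t)
  have hlev := coarseDist_eq y hcx
  cases c with
  | vertex v => exact absurd hcx (hnov t v le_rfl)
  | face f =>
    right
    obtain ⟨z, hz, hz'⟩ := hcx
    exact ⟨f, z, hz, hz', by rw [← hlev]; exact ht⟩
  | edge d =>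
    left
    refine same_edge_of_path hγ ?_ hp0 hp1 h1
    -- An open edge outside the ball has level at least `n + 1/2`, which is also the final level.
    -- The level is therefore constant from here on.
    have hge : (n : ℚ) + 1 / 2 ≤ coarseDist y (γ t) := by
      by_contra hcon
      push Not at hcon
      rw [hlev] at hcon ht
      have h7 : edgeDist y d = ((min (Y.dist y (Y.src d)) (Y.dist y (Y.tgt d)) : ℕ) : ℚ) + 1 / 2 := by
        simp [edgeDist]
      simp only [cellDist, h7] at hcon ht
      have h8 : min (Y.dist y (Y.src d)) (Y.dist y (Y.tgt d)) < n := by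
        exact_mod_cast (show ((min (Y.dist y (Y.src d)) (Y.dist y (Y.tgt d)) : ℕ) : ℚ) < n by linarith)
      have h9 : ((min (Y.dist y (Y.src d)) (Y.dist y (Y.tgt d)) : ℕ) : ℚ) + 1 ≤ n := by
        exact_mod_cast h8
      linarith
    intro s hts
    have hs2 : coarseDist y (γ s) = n + 1 / 2 := le_antisymm (hle s) (hge.trans (hmono t s hts))
    obtain ⟨c, hcs⟩ := exists_mem_openCell (γ s)
    have hls := coarseDist_eq y hcs
    cases c with
    | vertex v => exact absurd hcs (hnov s v hts)
    | edge d' =>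
      obtain ⟨s', h0, h1, h2⟩ := hcs
      exact ⟨d', s', h0.ne', h1.ne, h2⟩
    | face f =>
      -- Levels of 2-cells lie in `ℕ + 1/4`, so they never equal `n + 1/2`.
      exfalso
      rw [hs2] at hls
      simp only [cellDist] at hls
      obtain ⟨k, -, hk⟩ := Finset.exists_mem_eq_sup' ⟨⟨0, Y.len_pos f⟩, Finset.mem_univ _⟩
        (fun k => edgeDist y (Y.side f k))
      have h7 : edgeDist y (Y.side f k) = ((min (Y.dist y (Y.src (Y.side f k)))
        (Y.dist y (Y.tgt (Y.side f k))) : ℕ) : ℚ) + 1 / 2 := by simp [edgeDist]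
      have h10 := hls.trans (congrArg (· - (1 / 4 : ℚ)) hk)
      simp only [h7] at h10
      generalize min (Y.dist y (Y.src (Y.side f k))) (Y.dist y (Y.tgt (Y.side f k))) = m at h10
      have h8 : (4 * n + 1 : ℚ) = 4 * m := by linarith
      have h9 : 4 * n + 1 = 4 * m := by exact_mod_cast h8
      omega

end TwoComplex


/-! ### The connectedness argument for tame combings -/

namespace TwoComplex

open unitInterval Topology Set

variable {Y : TwoComplex}

/-- The key consequence of tameness with respect to the identity. `H` is the restriction of a tame
combing to an edge `e` of coarse distance `n + 1/2` that starts at level `n`; the fibre over the end of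
`e` is assumed to stay near the ball of radius `n` until it is in the first half of an edge that leaves
the ball at `v` (unless `v` is the end of `e`). Then `src e` and `v` are close in the ball. -/
theorem joinedInBall_of_tame {y : Y.V} (hc : ∀ v, ∃ p, Y.IsPath y p v) {n K : ℕ}
    (hK : ∀ f, Y.len f ≤ K) {e : Y.D} {v : Y.V} {H : I → I → Y.Space}
    (hH : Continuous fun x : I × I => H x.1 x.2) (hH0 : ∀ p, H p 0 = vertexPt y)
    (hH1 : ∀ p, H p 1 = edgePt e p)
    (tame : ∀ p s t, s ≤ t → coarseDist y (H p s) ≤ coarseDist y (H p t))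
    (hsrc : Y.dist y (Y.src e) = n) (htgt : n ≤ Y.dist y (Y.tgt e))
    (hv : Y.tgt e = v ∨ n < Y.dist y (Y.tgt e)) {ts : I}
    (hend : ∀ t ≤ ts, coarseDist y (H 1 t) ≤ n ∨ ∃ d s, H 1 t = edgePt d s ∧ NearBall y n d s)
    (hend' : (∃ d s, H 1 ts = edgePt d s ∧ 0 < (s : ℝ) ∧ (s : ℝ) < 1 / 2 ∧ Y.src d = v ∧
      (n : ℚ) < edgeDist y d) ∨ (ts = 1 ∧ Y.tgt e = v)) :
    JoinedInBall y n K (Y.src e) v := by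
  by_contra hcon
  have hne : Y.src e ≠ v := fun h => hcon (h ▸ ⟨[], rfl, by simp, by simp⟩)
  have he := edgeDist_of_le hsrc htgt
  have hen : (n : ℚ) < edgeDist y e := by rw [he]; linarith
  obtain ⟨O, hO, hOv, hOe, hOf⟩ := exists_nearSet hc n
  have hsub := mem_nearSet_of_coarseDist_le hc hOv hOe hOf
  -- A corner is good if sides of its 2-cell inside the ball connect it to a corner at `src e`.
  -- Under the assumption `hcon`, no corner at `v` is good.
  set good : ∀ f : Y.F, Fin (Y.len f) → Prop := fun f k =>
    ∃ k', Relation.EqvGen (CornerAdj y n f) k k' ∧ Y.src (Y.side f k') = Y.src e with hgood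
  have hgrot : ∀ f k, edgeDist y (Y.side f k) ≤ n → (good f k ↔ good f (finRotate _ k)) := by
    intro f k hk
    have hadj : Relation.EqvGen (CornerAdj y n f) k (finRotate _ k) := .rel _ _ ⟨hk, rfl⟩
    exact ⟨fun ⟨k', h1, h2⟩ => ⟨k', (hadj.symm _ _).trans _ _ _ h1, h2⟩,
      fun ⟨k', h1, h2⟩ => ⟨k', hadj.trans _ _ _ h1, h2⟩⟩
  have hgself : ∀ f k, Y.src (Y.side f k) = Y.src e → good f k :=
    fun f k h => ⟨k, .refl _, h⟩
  have hgv : ∀ f k, Y.src (Y.side f k) = v → ¬ good f k := by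
    rintro f k h ⟨k', h1, h2⟩
    obtain ⟨p, h3, h4, h5⟩ := (joinedInBall_of_eqvGen h1).symm
    rw [h, h2] at h3
    exact hcon ⟨p, h3, h4.trans (hK f), h5⟩
  obtain ⟨Qp, hQpo, hQpv, hQpe, hQpf⟩ := exists_sectorSet y n good
    (fun d => Y.src d = Y.src e ∧ (n : ℚ) < edgeDist y d) hgrot (fun d h => h.2)
  obtain ⟨Qm, hQmo, hQmv, hQme, hQmf⟩ := exists_sectorSet y n (fun f k => ¬ good f k)
    (fun d => Y.src d = v ∧ (n : ℚ) < edgeDist y d) (fun f k hk => not_congr (hgrot f k hk))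
    (fun d h => h.2)
  -- the edge sectors are contained in the corner sectors
  have hEp : ∀ f k t, EdgeSector (fun d => Y.src d = Y.src e ∧ (n : ℚ) < edgeDist y d)
      (Y.side f k) t → CornerSector y n (good f) k t := by
    rintro f k t (⟨-, h2, h3, -⟩ | ⟨h1, -, h3, -⟩)
    · exact Or.inl ⟨h2, hgself f k h3⟩
    · exact Or.inr (Or.inl ⟨h1, hgself f _ (by rw [← h3, Y.side_closed])⟩)
  have hEm : ∀ f k t, EdgeSector (fun d => Y.src d = v ∧ (n : ℚ) < edgeDist y d)
      (Y.side f k) t → CornerSector y n (fun k => ¬ good f k) k t := by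
    rintro f k t (⟨-, h2, h3, -⟩ | ⟨h1, -, h3, -⟩)
    · exact Or.inl ⟨h2, hgv f k h3⟩
    · exact Or.inr (Or.inl ⟨h1, hgv f _ (by rw [← h3, Y.side_closed])⟩)
  -- In a 2-cell the two sets are sectors at good and at bad corners. On an edge a common point
  -- would give `src e = v`.
  have hdisj : ∀ x, x ∈ Qp → x ∉ Qm := by
    intro x
    induction x using Quot.ind with
    | mk a =>
      intro hp hm
      rcases a with ⟨u, ⟨⟩⟩ | ⟨d, t⟩ | ⟨f, z⟩
      · exact hQpv u hp
      · have hp' := (hQpe d t).mp hp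
        have hm' := (hQme d t).mp hm
        rcases hp' with ⟨h1, h2, h3, -⟩ | ⟨h1, h2, h3, -⟩ <;>
          rcases hm' with ⟨h1', h2', h3', -⟩ | ⟨h1', h2', h3', -⟩
        · exact hne (h3.symm.trans h3')
        · linarith
        · linarith
        · exact hne (h3.symm.trans h3')
      · obtain ⟨k, t, r, rfl⟩ := exists_conePt (Y.len_pos f) z
        obtain ⟨-, -, hp'⟩ := (hQpf f k t r).mp hp
        obtain ⟨-, -, hm'⟩ := (hQmf f k t r).mp hm
        have hp2 : CornerSector y n (good f) k t := hp'.elim (·.2) (hEp f k t)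
        have hm2 : CornerSector y n (fun k => ¬ good f k) k t := hm'.elim (·.2) (hEm f k t)
        rcases hp2 with ⟨h1, h2⟩ | ⟨h1, h2⟩ | ⟨h1, -, h2⟩ <;>
          rcases hm2 with ⟨h1', h2'⟩ | ⟨h1', h2'⟩ | ⟨h1', -, h2'⟩ <;>
          first | exact h2' h2 | linarith
  -- A point near the ball but outside it, on a fibre over an interior point of `e`, is either on
  -- `e` or in an open 2-cell. In the second case its ray meets the rim near a vertex of the ball,
  -- or at the midpoint of a side in the ball, which puts it in a good or a bad sector. On the far
  -- half of `e`, being near the ball forces `tgt e` into the ball, so `hv` gives `tgt e = v`.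
  have hcover : ∀ (p t : I), p ≠ 0 → p ≠ 1 → (n : ℚ) < coarseDist y (H p t) → H p t ∈ O →
      H p t ∈ Qp ∪ Qm := by
    intro p t hp0 hp1 hlt hmem
    rcases mem_face_or_edge he (γ := H p) (hH.comp (Continuous.prodMk_right p)) hp0 hp1 (hH1 p)
      (tame p) hlt with ⟨s, hs0, hs1, hs⟩ | ⟨f, z, hz, hz', hf⟩
    · have hs0' : (0 : ℝ) < s := unitInterval.pos_iff_ne_zero.mpr hs0
      have hs1' : (s : ℝ) < 1 := unitInterval.lt_one_iff_ne_one.mpr hs1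
      rw [hs, hOe] at hmem
      rw [hs]
      rcases lt_trichotomy (s : ℝ) (1 / 2) with h | h | h
      · exact Or.inl ((hQpe _ _).mpr (Or.inl ⟨hs0', h, rfl, hen⟩))
      · exact absurd (hmem.2.2 h) (not_le.mpr hen)
      · refine Or.inr ((hQme _ _).mpr (Or.inr ⟨h, hs1', ?_, by rwa [edgeDist_inv]⟩))
        exact hv.resolve_right (not_lt.mpr (hmem.2.1 h))
    · obtain ⟨k, t', r, rfl⟩ := exists_conePt (Y.len_pos f) z
      rw [norm_conePt] at hz
      have hr1 : r ≠ 1 := by rintro rfl; simp at hz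
      rw [hz', hOf] at hmem
      obtain ⟨hr0, hn⟩ := hmem.resolve_left (not_le.mpr hf)
      rw [hz']
      by_cases hg : good f k
      · rcases lt_trichotomy (t' : ℝ) (1 / 2) with h | h | h
        · exact Or.inl ((hQpf _ _ _ _).mpr ⟨hf, hr0, Or.inl ⟨hr1, Or.inl ⟨h, hg⟩⟩⟩)
        · exact Or.inl ((hQpf _ _ _ _).mpr ⟨hf, hr0, Or.inl ⟨hr1, Or.inr (Or.inr ⟨h, hn.2.2 h, hg⟩)⟩⟩)
        · by_cases hg' : good f (finRotate _ k)
          · exact Or.inl ((hQpf _ _ _ _).mpr ⟨hf, hr0, Or.inl ⟨hr1, Or.inr (Or.inl ⟨h, hg'⟩)⟩⟩)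
          · exact Or.inr ((hQmf _ _ _ _).mpr ⟨hf, hr0, Or.inl ⟨hr1, Or.inr (Or.inl ⟨h, hg'⟩)⟩⟩)
      · rcases lt_trichotomy (t' : ℝ) (1 / 2) with h | h | h
        · exact Or.inr ((hQmf _ _ _ _).mpr ⟨hf, hr0, Or.inl ⟨hr1, Or.inl ⟨h, hg⟩⟩⟩)
        · exact Or.inr ((hQmf _ _ _ _).mpr ⟨hf, hr0, Or.inl ⟨hr1, Or.inr (Or.inr ⟨h, hn.2.2 h, hg⟩)⟩⟩)
        · by_cases hg' : good f (finRotate _ k)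
          · exact Or.inl ((hQpf _ _ _ _).mpr ⟨hf, hr0, Or.inl ⟨hr1, Or.inr (Or.inl ⟨h, hg'⟩)⟩⟩)
          · exact Or.inr ((hQmf _ _ _ _).mpr ⟨hf, hr0, Or.inl ⟨hr1, Or.inr (Or.inl ⟨h, hg'⟩)⟩⟩)
  -- points of the sectors are outside the ball
  have hQlev : ∀ x, x ∈ Qp ∪ Qm → (n : ℚ) < coarseDist y x := by
    have hedge : ∀ (E : Y.D → Prop) d t, (∀ d, E d → (n : ℚ) < edgeDist y d) → EdgeSector E d t →
        (n : ℚ) < coarseDist y (edgePt d t) := by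
      intro E d t hE h
      have ht : t ≠ 0 ∧ t ≠ 1 ∧ (n : ℚ) < edgeDist y d := by
        rcases h with ⟨h1, h2, h3⟩ | ⟨h1, h2, h3⟩
        · exact ⟨by rintro rfl; simp at h1, by rintro rfl; norm_num at h2, hE _ h3⟩
        · exact ⟨by rintro rfl; norm_num at h1, by rintro rfl; simp at h2, by
            rw [← edgeDist_inv]; exact hE _ h3⟩
      rw [coarseDist_edgePt y d ht.1 ht.2.1]
      exact ht.2.2
    intro x
    induction x using Quot.ind with
    | mk a =>
      intro hx
      rcases a with ⟨u, ⟨⟩⟩ | ⟨d, t⟩ | ⟨f, z⟩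
      · exact (hx.elim (hQpv u) (hQmv u)).elim
      · rcases hx with hx | hx
        · exact hedge _ d t (fun d h => h.2) ((hQpe d t).mp hx)
        · exact hedge _ d t (fun d h => h.2) ((hQme d t).mp hx)
      · obtain ⟨k, t, r, rfl⟩ := exists_conePt (Y.len_pos f) z
        change (n : ℚ) < coarseDist y (facePt f _)
        by_cases hr : r = 1
        · subst hr
          rw [facePt_conePt_one]
          rcases hx with hx | hx
          · obtain ⟨-, -, h⟩ := (hQpf f k t 1).mp hx
            exact hedge _ _ t (fun d h => h.2) (h.resolve_left fun h => h.1 rfl)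
          · obtain ⟨-, -, h⟩ := (hQmf f k t 1).mp hx
            exact hedge _ _ t (fun d h => h.2) (h.resolve_left fun h => h.1 rfl)
        · rw [coarseDist_facePt_conePt _ _ _ _ _ hr]
          rcases hx with hx | hx
          · exact ((hQpf f k t r).mp hx).1
          · exact ((hQmf f k t r).mp hx).1
  -- By compactness of the time interval up to `t`, staying in `O` until time `t` is an open
  -- condition on the fibre.
  have htube : ∀ p t, (∀ t' ≤ t, H p t' ∈ O) → ∀ᶠ q in 𝓝 p, ∀ t' ≤ t, H q t' ∈ O := by
    intro p t h
    have := (isClosed_Iic (a := t)).isCompact.eventually_forall_of_forall_eventually (x₀ := p)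
      (P := fun q t' => H q t' ∈ O) (fun t' ht' => (hO.preimage hH).mem_nhds (h t' ht'))
    exact this
  -- Fibres that reach `Q` before ever having left the neighbourhood `O` of the ball.
  set A : Set Y.Space → Set I := fun Q => {p | ∃ t, (∀ t' ≤ t, H p t' ∈ O) ∧ H p t ∈ Q} with hA
  have hAo : ∀ Q, IsOpen Q → IsOpen (A Q) := by
    intro Q hQ
    rw [isOpen_iff_mem_nhds]
    rintro p ⟨t, h1, h2⟩
    have h3 : ∀ᶠ q in 𝓝 p, H q t ∈ Q :=
      (hQ.preimage (hH.comp (Continuous.prodMk_left t))).mem_nhds h2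
    filter_upwards [htube p t h1, h3] with q h4 h5
    exact ⟨t, h4, h5⟩
  have hpre : IsPreconnected (Ioo 0 1 : Set I) := isPreconnected_Ioo
  have hcov : (Ioo 0 1 : Set I) ⊆ A Qp ∪ A Qm := by
    intro p hp
    have hp0 : p ≠ 0 := hp.1.ne'
    have hp1 : p ≠ 1 := hp.2.ne
    obtain ⟨t, ht, ht'⟩ := exists_last_time hc (γ := H p) (hH.comp (Continuous.prodMk_right p))
      (hH0 p) (by rw [hH1, coarseDist_edgePt y e hp0 hp1]; exact hen) hO hsub (tame p)
    rcases hcover p t hp0 hp1 ht (ht' t le_rfl) with h | h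
    · exact Or.inl ⟨t, ht', h⟩
    · exact Or.inr ⟨t, ht', h⟩
  -- both sets are nonempty
  have hsrcO : ∀ t, H 0 t ∈ O := by
    intro t
    apply hsub
    refine (tame 0 t 1 le_one').trans ?_
    rw [hH1, coarseDist_edgePt_zero, hsrc]
  -- The whole fibre over `src e` lies in the ball, so nearby fibres stay in `O` until time 1, when
  -- they are on the first half of `e`.
  have hstart : ((Ioo 0 1 : Set I) ∩ A Qp).Nonempty := by
    have h1 := htube 0 1 (fun t' _ => hsrcO t')
    have h2 : ∀ᶠ q : I in 𝓝 0, (q : ℝ) < 1 / 2 :=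
      (isOpen_lt continuous_subtype_val continuous_const).mem_nhds (by simp)
    have h4 : ∀ᶠ q : I in 𝓝[>] 0, q ∈ Ioi 0 := self_mem_nhdsWithin
    have : (𝓝[>] (0 : I)).NeBot := nhdsGT_neBot_of_exists_gt ⟨1, zero_lt_one⟩
    obtain ⟨q, ⟨h5, h6⟩, h7⟩ := (((h1.and h2).filter_mono nhdsWithin_le_nhds).and h4).exists
    refine ⟨q, ⟨h7, ?_⟩, 1, h5, ?_⟩
    · refine unitInterval.lt_one_iff_ne_one.mpr ?_
      rintro rfl; norm_num at h6
    · rw [hH1, hQpe]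
      exact Or.inl ⟨h7, h6, rfl, hen⟩
  have hO1 : ∀ t ≤ ts, H 1 t ∈ O := by
    intro t ht
    rcases hend t ht with h | ⟨d, s, h1, h2⟩
    · exact hsub _ h
    · rw [h1, hOe]; exact h2
  -- Nearby fibres follow the fibre over the end of `e`: at time `ts` they are in the open set `Qm`
  -- at the exit through `v`, or, if `tgt e = v` and `ts = 1`, they have arrived on the second half
  -- of `e`.
  have hfinish : ((Ioo 0 1 : Set I) ∩ A Qm).Nonempty := by
    have h1 := htube 1 ts hO1
    have h2 : ∀ᶠ q : I in 𝓝 1, 1 / 2 < (q : ℝ) :=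
      (isOpen_lt continuous_const continuous_subtype_val).mem_nhds (by
        simp only [mem_ofPred_eq, Icc.coe_one]; norm_num)
    have h3 : ∀ᶠ q : I in 𝓝[<] 1, H q ts ∈ Qm := by
      rcases hend' with ⟨d, s, h3, h4, h5, h6, h7⟩ | ⟨rfl, h3⟩
      · have : H 1 ts ∈ Qm := by
          rw [h3, hQme]; exact Or.inl ⟨h4, h5, h6, h7⟩
        exact nhdsWithin_le_nhds
          ((hQmo.preimage (hH.comp (Continuous.prodMk_left ts))).mem_nhds this)
      · filter_upwards [nhdsWithin_le_nhds h2, self_mem_nhdsWithin] with q hq hq'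
        rw [hH1, hQme]
        exact Or.inr ⟨hq, hq', h3, by rwa [edgeDist_inv]⟩
    have h4 : ∀ᶠ q : I in 𝓝[<] 1, q ∈ Iio 1 := self_mem_nhdsWithin
    have : (𝓝[<] (1 : I)).NeBot := nhdsLT_neBot_of_exists_lt ⟨0, zero_lt_one⟩
    obtain ⟨q, ⟨⟨h5, h6⟩, h7⟩, h8⟩ :=
      ((((h1.and h2).filter_mono nhdsWithin_le_nhds).and h3).and h4).exists
    refine ⟨q, ⟨?_, h8⟩, ts, h5, h7⟩
    refine unitInterval.pos_iff_ne_zero.mpr ?_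
    rintro rfl
    norm_num at h6
  obtain ⟨p, hp, ⟨t, h1, h2⟩, ⟨t', h1', h2'⟩⟩ :=
    hpre _ _ (hAo _ hQpo) (hAo _ hQmo) hcov hstart hfinish
  have hp0 : p ≠ 0 := hp.1.ne'
  have hp1 : p ≠ 1 := hp.2.ne
  have hcont : Continuous (H p) := hH.comp (Continuous.prodMk_right p)
  -- the part of the fibre between the two times would be disconnected
  have hfin : ∀ (a b : I), a ≤ b → H p a ∈ Qp ∪ Qm → (∀ t ≤ b, H p t ∈ O) →
      Icc a b ⊆ H p ⁻¹' Qp ∪ H p ⁻¹' Qm := by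
    intro a b _ ha hb t ht
    exact hcover p t hp0 hp1 ((hQlev _ ha).trans_le (tame p a t ht.1)) (hb t ht.2)
  have hpre2 : ∀ a b : I, IsPreconnected (Icc a b) := fun a b => isPreconnected_Icc
  rcases le_total t t' with h | h
  · obtain ⟨s, -, h3, h4⟩ := hpre2 t t' _ _ (hQpo.preimage hcont) (hQmo.preimage hcont)
      (hfin t t' h (Or.inl h2) h1') ⟨t, ⟨le_rfl, h⟩, h2⟩ ⟨t', ⟨h, le_rfl⟩, h2'⟩
    exact hdisj _ h3 h4
  · obtain ⟨s, -, h3, h4⟩ := hpre2 t' t _ _ (hQpo.preimage hcont) (hQmo.preimage hcont)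
      (hfin t' t h (Or.inr h2') h1) ⟨t, ⟨h, le_rfl⟩, h2⟩ ⟨t', ⟨le_rfl, h⟩, h2'⟩
    exact hdisj _ h3 h4

/-- A level-increasing path in the 1-skeleton from `y` to a vertex of level `n + 1` leaves the ball of
radius `n` through the first half of an edge. -/
theorem exists_exit_edge {y : Y.V} (hc : ∀ v, ∃ p, Y.IsPath y p v) {n : ℕ} {γ : I → Y.Space}
    (hγ : Continuous γ) (h0 : γ 0 = vertexPt y) {m : Y.V} (h1 : γ 1 = vertexPt m)
    (hm : Y.dist y m = n + 1) (hskel : ∀ t, γ t ∈ Y.skel1)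
    (hmono : ∀ s t, s ≤ t → coarseDist y (γ s) ≤ coarseDist y (γ t)) :
    ∃ (v : Y.V) (ts : I),
      (∀ t ≤ ts, coarseDist y (γ t) ≤ n ∨ ∃ d s, γ t = edgePt d s ∧ NearBall y n d s) ∧
      ∃ d s, γ ts = edgePt d s ∧ 0 < (s : ℝ) ∧ (s : ℝ) < 1 / 2 ∧ Y.src d = v ∧
        (n : ℚ) < edgeDist y d := by
  obtain ⟨O, hO, hOv, hOe, hOf⟩ := exists_nearSet hc n
  have hsub := mem_nearSet_of_coarseDist_le hc hOv hOe hOf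
  obtain ⟨ts, h2, h3⟩ := exists_last_time hc hγ h0
    (by rw [h1, coarseDist_vertexPt, hm]; push_cast; linarith) hO hsub hmono
  have hout : ∀ t ≤ ts, (n : ℚ) < coarseDist y (γ t) →
      ∃ d s, γ t = edgePt d s ∧ NearBall y n d s := by
    intro t ht hlt
    rcases hskel t with ⟨v, hv⟩ | ⟨d, s, hd⟩
    · exfalso
      have := h3 t ht
      rw [hv, hOv] at this
      rw [hv, coarseDist_vertexPt] at hlt
      have h4 : n < Y.dist y v := by exact_mod_cast hlt
      omega
    · have := h3 t ht
      rw [hd, hOe] at this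
      exact ⟨d, s, hd, this⟩
  obtain ⟨d, s, h4, h5⟩ := hout ts le_rfl h2
  have hlt : (n : ℚ) < edgeDist y d := by
    by_contra hcon
    push Not at hcon
    rw [h4] at h2
    by_cases hs0 : s = 0
    · subst hs0
      rw [coarseDist_edgePt_zero] at h2
      have h4 : n < Y.dist y (Y.src d) := by exact_mod_cast h2
      exact absurd (dist_src_le_of_edgeDist_le hc hcon) (by omega)
    by_cases hs1 : s = 1
    · subst hs1
      rw [coarseDist_edgePt_one] at h2
      have h4 : n < Y.dist y (Y.tgt d) := by exact_mod_cast h2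
      exact absurd (dist_tgt_le_of_edgeDist_le hc hcon) (by omega)
    rw [coarseDist_edgePt y d hs0 hs1] at h2
    linarith
  have hs0 : s ≠ 0 := by
    rintro rfl
    rw [h4, coarseDist_edgePt_zero] at h2
    have h6 : n < Y.dist y (Y.src d) := by exact_mod_cast h2
    exact absurd ((nearBall_zero y n d).mp h5) (by omega)
  have hs1 : s ≠ 1 := by
    rintro rfl
    rw [h4, coarseDist_edgePt_one] at h2
    have h6 : n < Y.dist y (Y.tgt d) := by exact_mod_cast h2
    exact absurd ((nearBall_one y n d).mp h5) (by omega)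
  have hs0' : (0 : ℝ) < s := unitInterval.pos_iff_ne_zero.mpr hs0
  have hs1' : (s : ℝ) < 1 := unitInterval.lt_one_iff_ne_one.mpr hs1
  have hpre : ∀ t ≤ ts, coarseDist y (γ t) ≤ n ∨ ∃ d s, γ t = edgePt d s ∧ NearBall y n d s :=
    fun t ht => (le_or_gt (coarseDist y (γ t)) n).imp id (hout t ht)
  -- The midpoint is near the ball only if the whole edge is in it, which `hlt` excludes. In the
  -- second half, the edge is read backwards.
  rcases lt_trichotomy (s : ℝ) (1 / 2) with h | h | h
  · exact ⟨Y.src d, ts, hpre, d, s, h4, hs0', h, rfl, hlt⟩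
  · exact absurd (h5.2.2 h) (not_le.mpr hlt)
  · refine ⟨Y.src (Y.inv d), ts, hpre, Y.inv d, σ s, ?_, ?_, ?_, rfl, ?_⟩
    · rw [h4, edgePt_flip]
    · rw [unitInterval.coe_symm_eq]; linarith
    · rw [unitInterval.coe_symm_eq]; linarith
    · rwa [edgeDist_inv]

end TwoComplex


/-! ## Simple connectivity of diagrams: existence of the vertex projection -/

namespace SerreGraph

variable {Γ : SerreGraph}

theorem tgt_eq_src_of_isPath {n : ℕ} {u : Γ.V} {b : Fin n → Γ.D} (h : Γ.IsPath u (List.ofFn b) u)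
    (i : Fin n) : Γ.tgt (b i) = Γ.src (b (finRotate n i)) := by
  have key : ∀ (l : List Γ.D) (u v : Γ.V), Γ.IsPath u l v →
      (∀ i (hi : i + 1 < l.length), Γ.tgt l[i] = Γ.src l[i + 1]) ∧
      (∀ hl : 0 < l.length, Γ.src l[0] = u) ∧
      (∀ i (hi : i < l.length), i + 1 = l.length → Γ.tgt l[i] = v) := by
    intro l
    induction l with
    | nil => intro u v _; simp
    | cons d p ih =>
      rintro u v ⟨h1, h2⟩
      obtain ⟨h3, h4, h5⟩ := ih _ _ h2
      refine ⟨?_, fun _ => h1, ?_⟩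
      · rintro (_ | i) hi
        · exact (h4 (by simpa using hi)).symm
        · exact h3 i (by simpa using hi)
      · rintro (_ | i) hi hl
        · have : p = [] := by simpa using hl
          subst this; exact h2
        · exact h5 i (by simpa using hi) (by simpa using hl)
  obtain ⟨h1, h2, h3⟩ := key _ _ _ h
  obtain ⟨i, hi⟩ := i
  rcases Nat.lt_or_ge (i + 1) n with hlt | hge
  · rw [TwoComplex.finRotate_mk_of_lt hlt]
    have := h1 i (by simpa using hlt)
    simp only [List.getElem_ofFn] at this
    exact this
  · rw [TwoComplex.finRotate_mk_of_ge hi hge]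
    have h4 := h3 i (by simpa using hi) (by simp; omega)
    have h5 := h2 (by simp; omega)
    simp only [List.getElem_ofFn] at h4 h5
    rw [h4, h5]

theorem isPath_ofFn {n : ℕ} (hn : 0 < n) {b : Fin n → Γ.D}
    (h : ∀ i, Γ.tgt (b i) = Γ.src (b (finRotate n i))) :
    Γ.IsPath (Γ.src (b ⟨0, hn⟩)) (List.ofFn b) (Γ.src (b ⟨0, hn⟩)) := by
  have key : ∀ (m : ℕ) (b : Fin (m + 1) → Γ.D),
      (∀ i (hi : i + 1 < m + 1), Γ.tgt (b ⟨i, by omega⟩) = Γ.src (b ⟨i + 1, hi⟩)) →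
      Γ.IsPath (Γ.src (b 0)) (List.ofFn b) (Γ.tgt (b (Fin.last m))) := by
    intro m
    induction m with
    | zero => intro b _; simpa using isPath_singleton (b 0)
    | succ m ih =>
      intro b hb
      rw [List.ofFn_succ]
      refine ⟨rfl, ?_⟩
      have := ih (fun i => b i.succ) (fun i hi => hb (i + 1) (by omega))
      rw [show Γ.tgt (b 0) = _ from hb 0 (by omega)]
      exact this
  obtain ⟨m, rfl⟩ : ∃ m, n = m + 1 := ⟨n - 1, by omega⟩
  have h1 := key m b fun i hi => by rw [h, TwoComplex.finRotate_mk_of_lt hi]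
  have h2 := h (Fin.last m)
  rw [show Fin.last m = ⟨m, by omega⟩ from rfl, TwoComplex.finRotate_mk_of_ge _ le_rfl] at h2
  have h3 : Γ.tgt (b (Fin.last m)) = Γ.src (b ⟨0, hn⟩) := h2
  rw [h3] at h1
  exact h1

/-- The product of the labels of a closed path is trivial up to a change of potential. -/
theorem prod_map_potential {G : Type*} [Group G] (ℓ : Γ.D → G) (π : Γ.V → G) {u v : Γ.V}
    {l : List Γ.D} (h : Γ.IsPath u l v) :
    (l.map fun d => π (Γ.src d) * ℓ d * (π (Γ.tgt d))⁻¹).prod = π u * (l.map ℓ).prod * (π v)⁻¹ := by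
  induction l generalizing u with
  | nil => obtain rfl : u = v := h; simp
  | cons d l ih =>
    obtain ⟨rfl, h2⟩ := h
    simp only [List.map_cons, List.prod_cons]
    rw [ih h2]
    group

theorem list_prod_eq_of_forall_ne {G α : Type*} [Group G] {l : List α} (hl : l.Nodup) (g : α → G)
    {a : α} (ha : a ∈ l) (h : ∀ b ∈ l, b ≠ a → g b = 1) : (l.map g).prod = g a := by
  obtain ⟨s, t, rfl⟩ := List.append_of_mem ha
  have hs : (s.map g).prod = 1 := by
    apply List.prod_eq_one
    intro x hx
    obtain ⟨b, hb, rfl⟩ := List.mem_map.mp hx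
    refine h b (by simp [hb]) ?_
    rintro rfl
    exact (List.nodup_append.mp hl).2.2 b hb b (by simp) rfl
  have ht : (t.map g).prod = 1 := by
    apply List.prod_eq_one
    intro x hx
    obtain ⟨b, hb, rfl⟩ := List.mem_map.mp hx
    refine h b (by simp [hb]) ?_
    rintro rfl
    exact (List.nodup_cons.mp (List.nodup_append.mp hl).2.1).1 hb
  simp [hs, ht]

open Classical in
/-- On a combinatorial sphere, given by the "next side" permutation of its directed edges, a labelling
of directed edges by group elements that is trivial around every face but one is a coboundary. -/
theorem exists_potential {G : Type*} [Group G] [Finite Γ.V] [Finite Γ.D] {Φ : Type*} [Finite Φ]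
    {base : Γ.V} (hconn : ∀ v, ∃ p, Γ.IsPath base p v) (face : Γ.D → Φ)
    (hface : Function.Surjective face) (nx : Equiv.Perm Γ.D) (hnx : ∀ d, face (nx d) = face d)
    (hsrc : ∀ d, Γ.src (nx d) = Γ.tgt d)
    (link : ∀ d d', Γ.src d = Γ.src d' →
      Relation.EqvGen (fun e e' => e' = nx (Γ.inv e)) d d')
    (root : Φ) (euler : 2 * (Nat.card Γ.V + Nat.card Φ) = Nat.card Γ.D + 4)
    (ℓ : Γ.D → G) (hℓ : ∀ d, ℓ (Γ.inv d) = (ℓ d)⁻¹)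
    (hprod : ∀ φ, φ ≠ root → ∃ (L : List Γ.D) (v : Γ.V), L.Nodup ∧ (∀ d, d ∈ L ↔ face d = φ) ∧
      Γ.IsPath v L v ∧ (L.map ℓ).prod = 1) :
    ∃ π : Γ.V → G, π base = 1 ∧ ∀ d, π (Γ.tgt d) = π (Γ.src d) * ℓ d := by
  -- A geodesic spanning tree `T` defines `π`, so that the corrected labels `ℓ'` are trivial on it.
  -- The edges off the tree connect all faces, which yields a dual tree rooted at `root`; by Euler's
  -- formula the two trees exhaust the edges. The face relations then make `ℓ'` trivial on the dual
  -- tree, starting from its leaves.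
  have _ := Fintype.ofFinite Γ.D
  have _ := Fintype.ofFinite Γ.V
  -- the spanning tree
  have hpar : ∀ v, v ≠ base → ∃ d, Γ.tgt d = v ∧ Γ.dist base (Γ.src d) + 1 = Γ.dist base v := by
    intro v hv
    obtain ⟨p, hp⟩ := hconn v
    obtain ⟨q, hq, hl⟩ := hp.exists_dist
    rcases List.eq_nil_or_concat q with rfl | ⟨q', d, rfl⟩
    · exact absurd hq.symm hv
    · rw [List.concat_eq_append] at hq hl
      obtain ⟨m, h1, h2, h3⟩ := isPath_append.mp hq
      refine ⟨d, h3, ?_⟩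
      have h4 := h1.dist_le
      have h5 := dist_tgt_le hconn d
      simp only [List.length_append, List.length_singleton] at hl
      rw [show Γ.tgt d = v from h3] at h5
      rw [h2] at h5 ⊢
      omega
  have _ : Nonempty Γ.D := ⟨(hface root).choose⟩
  choose! p hp using hpar
  obtain ⟨π, hπ0, hπ⟩ : ∃ π : Γ.V → G, π base = 1 ∧
      ∀ v, v ≠ base → π v = π (Γ.src (p v)) * ℓ (p v) := by
    let F : ℕ → Γ.V → G := fun n => Nat.rec (fun _ => 1)
      (fun _ F v => F (Γ.src (p v)) * ℓ (p v)) n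
    refine ⟨fun v => F (Γ.dist base v) v, ?_, ?_⟩
    · simp only [dist_self]; rfl
    · intro v hv
      change F (Γ.dist base v) v = _
      rw [← (hp v hv).2]
  set T : Set Γ.D := {d | ∃ v, v ≠ base ∧ (d = p v ∨ d = Γ.inv (p v))} with hT
  have hTinv : ∀ d, Γ.inv d ∈ T ↔ d ∈ T := by
    have : ∀ d, d ∈ T → Γ.inv d ∈ T := by
      rintro d ⟨v, hv, rfl | rfl⟩
      · exact ⟨v, hv, Or.inr rfl⟩
      · exact ⟨v, hv, Or.inl (Γ.inv_inv _)⟩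
    exact fun d => ⟨fun h => by have := this _ h; rwa [Γ.inv_inv] at this, this d⟩
  -- the faces reached from the root across edges that are not in the tree
  obtain ⟨reach, hreach0, hreach⟩ : ∃ reach : ℕ → Φ → Prop, (∀ φ, reach 0 φ ↔ φ = root) ∧
      ∀ n φ, reach (n + 1) φ ↔ (reach n φ ∨ ∃ d, d ∉ T ∧ face d = φ ∧ reach n (face (Γ.inv d))) :=
    ⟨fun n => Nat.rec (motive := fun _ => Φ → Prop) (fun φ => φ = root)
      (fun _ R φ => R φ ∨ ∃ d, d ∉ T ∧ face d = φ ∧ R (face (Γ.inv d))) n,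
      fun _ => Iff.rfl, fun _ _ => Iff.rfl⟩
  have hstep : ∀ d, d ∉ T → (∃ n, reach n (face (Γ.inv d))) → ∃ n, reach n (face d) :=
    fun d hd ⟨n, hn⟩ => ⟨n + 1, (hreach _ _).mpr (Or.inr ⟨d, hd, rfl, hn⟩)⟩
  -- This is the Jordan curve part. The jump `c` of the indicator of the reached faces is a
  -- circulation supported on the tree. A tree carries none but zero, so the set of reached faces
  -- has no boundary and is everything by connectedness.
  have hall : ∀ φ, ∃ n, reach n φ := by
    set f : Γ.D → Prop := fun d => ∃ n, reach n (face d) with hf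
    obtain ⟨χ, hχ1, hχ0⟩ : ∃ χ : Γ.D → ℤ, (∀ d, f d → χ d = 1) ∧ ∀ d, ¬ f d → χ d = 0 :=
      ⟨fun d => if f d then 1 else 0, fun d h => if_pos h, fun d h => if_neg h⟩
    have hχ : ∀ d e, (f d ↔ f e) → χ d = χ e := by
      intro d e h
      by_cases hd : f d
      · rw [hχ1 d hd, hχ1 e (h.mp hd)]
      · rw [hχ0 d hd, hχ0 e (fun he => hd (h.mpr he))]
    let c : Γ.D → ℤ := fun d => χ d - χ (Γ.inv d)
    have hcinv : ∀ d, c (Γ.inv d) = - c d := by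
      intro d
      simp only [c, Γ.inv_inv]
      rw [neg_sub]
    have hcT : ∀ d, d ∉ T → c d = 0 := by
      intro d hd
      have : f d ↔ f (Γ.inv d) := by
        refine ⟨fun h => hstep (Γ.inv d) (by rwa [hTinv]) (by rwa [Γ.inv_inv]), hstep d hd⟩
      simp only [c, hχ _ _ this, sub_self]
    let iv : Equiv.Perm Γ.D := ⟨Γ.inv, Γ.inv, Γ.inv_inv, Γ.inv_inv⟩
    -- The permutation `d ↦ nx (inv d)` turns the edges around their initial vertex, and `nx`
    -- preserves faces, so the two indicator sums at `v` agree.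
    have hdiv : ∀ v, ∑ d ∈ Finset.univ.filter (fun d => Γ.src d = v), c d = 0 := by
      intro v
      rw [Finset.sum_sub_distrib, sub_eq_zero]
      symm
      refine Finset.sum_equiv (iv.trans nx) ?_ ?_
      · intro d
        simp only [Finset.mem_filter, Finset.mem_univ, true_and, Equiv.trans_apply]
        rw [hsrc]
        change _ ↔ Γ.tgt (Γ.inv d) = v
        rw [tgt_inv]
      · intro d _
        refine hχ _ _ ?_
        simp only [Equiv.trans_apply, hf, hnx]
        rfl
    have hc0 : ∀ d, c d = 0 := by
      by_contra hcon
      push Not at hcon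
      obtain ⟨d, hd⟩ := hcon
      -- Take a vertex farthest from the base whose parent edge carries flow. Its edges to children
      -- carry none, so flow conservation fails there.
      have hex : (Finset.univ.filter fun v => v ≠ base ∧ c (p v) ≠ 0).Nonempty := by
        have hdT : d ∈ T := by by_contra h; exact hd (hcT d h)
        obtain ⟨v, hv, rfl | rfl⟩ := hdT
        · exact ⟨v, by simp [hv, hd]⟩
        · rw [hcinv] at hd
          exact ⟨v, by simpa [hv] using hd⟩
      obtain ⟨v, hv, hmax⟩ := Finset.exists_max_image _ (fun v => Γ.dist base v) hex
      simp only [Finset.mem_filter, Finset.mem_univ, true_and] at hv hmax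
      have h1 := hdiv v
      rw [Finset.sum_eq_single (Γ.inv (p v))] at h1
      · rw [hcinv] at h1
        exact hv.2 (neg_eq_zero.mp h1)
      · intro e he hne
        by_contra hce
        simp only [Finset.mem_filter, Finset.mem_univ, true_and] at he
        have heT : e ∈ T := by by_contra h; exact hce (hcT e h)
        obtain ⟨v', hv', rfl | rfl⟩ := heT
        · have h2 := hmax v' ⟨hv', hce⟩
          have h3 := (hp v' hv').2
          rw [he] at h3
          omega
        · have h2 := (hp v' hv').1
          rw [SerreGraph.tgt, he] at h2
          exact hne (by rw [h2])
      · intro h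
        refine absurd ?_ h
        rw [Finset.mem_filter]
        exact ⟨Finset.mem_univ _, (hp v hv.1).1⟩
    have hfi : ∀ d, f d ↔ f (Γ.inv d) := by
      intro d
      have := hc0 d
      simp only [c] at this
      by_cases h1 : f d <;> by_cases h2 : f (Γ.inv d)
      · exact ⟨fun _ => h2, fun _ => h1⟩
      · rw [hχ1 _ h1, hχ0 _ h2] at this; norm_num at this
      · rw [hχ0 _ h1, hχ1 _ h2] at this; norm_num at this
      · exact ⟨fun h => absurd h h1, fun h => absurd h h2⟩
    have hfl : ∀ d d', Γ.src d = Γ.src d' → (f d ↔ f d') := by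
      intro d d' h
      have h2 := link d d' h
      clear h
      induction h2 with
      | rel e e' he =>
        rw [hfi e, he]
        simp only [hf, hnx]
      | refl => rfl
      | symm _ _ _ ih => exact ih.symm
      | trans _ _ _ _ _ ih1 ih2 => exact ih1.trans ih2
    have hpath : ∀ (q : List Γ.D) (u v : Γ.V), Γ.IsPath u q v → (∀ d, Γ.src d = u → f d) →
        ∀ d, Γ.src d = v → f d := by
      intro q
      induction q with
      | nil => rintro u v rfl h; exact h
      | cons e q ih =>
        rintro u v ⟨h1, h2⟩ h
        refine ih _ _ h2 fun d hd => ?_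
        exact (hfl (Γ.inv e) d hd.symm).mp ((hfi e).mp (h e h1))
    obtain ⟨d₀, hd₀⟩ := hface root
    have hd₀f : f d₀ := ⟨0, (hreach0 _).mpr hd₀⟩
    intro φ
    obtain ⟨d, rfl⟩ := hface φ
    obtain ⟨q₀, hq₀⟩ := hconn (Γ.src d₀)
    obtain ⟨q, hq⟩ := hconn (Γ.src d)
    exact hpath _ _ _ (hq₀.reverse.append hq) (fun e he => (hfl d₀ e he.symm).mp hd₀f) d rfl
  let rank : Φ → ℕ := fun φ => Nat.find (hall φ)
  have hq : ∀ φ, φ ≠ root → ∃ d, d ∉ T ∧ face d = φ ∧ rank (face (Γ.inv d)) < rank φ := by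
    intro φ hφ
    have h1 : reach (rank φ) φ := Nat.find_spec (hall φ)
    rcases hr : rank φ with _ | n
    · rw [hr, hreach0] at h1; exact absurd h1 hφ
    · rw [hr, hreach] at h1
      rcases h1 with h1 | ⟨d, h2, h3, h4⟩
      · exact absurd h1 (Nat.find_min (hall φ) (show n < rank φ by omega))
      · exact ⟨d, h2, h3, Nat.lt_succ_of_le (Nat.find_min' _ h4)⟩
  choose! q hq using hq
  -- every edge is in the tree or in the cotree
  let s : {v // v ≠ base} ⊕ {φ // φ ≠ root} → Γ.D := Sum.elim (fun v => p v) (fun φ => q φ)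
  have hsT : ∀ v : {v // v ≠ base}, p v ∈ T := fun v => ⟨v, v.2, Or.inl rfl⟩
  have hs1 : ∀ x y, s x = s y → x = y := by
    rintro (v | φ) (v' | φ') h
    · exact congrArg Sum.inl (Subtype.ext (by
        rw [← (hp v v.2).1, ← (hp v' v'.2).1]; exact congrArg _ h))
    · exact absurd (show q φ' ∈ T from (show p v = q φ' from h) ▸ hsT v) (hq φ' φ'.2).1
    · exact absurd (show q φ ∈ T from (show q φ = p v' from h) ▸ hsT v') (hq φ φ.2).1
    · exact congrArg Sum.inr (Subtype.ext (by
        rw [← (hq φ φ.2).2.1, ← (hq φ' φ'.2).2.1]; exact congrArg _ h))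
  have hs2 : ∀ x y, s x ≠ Γ.inv (s y) := by
    rintro (v | φ) (v' | φ') h
    · have h1 : (v : Γ.V) = Γ.src (p v') := by
        rw [← (hp v v.2).1]; exact (congrArg Γ.tgt h).trans (tgt_inv _)
      have h2 : Γ.src (p v) = v' := by
        have : Γ.src (p v) = Γ.tgt (p v') := congrArg Γ.src h
        rw [this, (hp v' v'.2).1]
      have h3 := (hp v v.2).2
      have h4 := (hp v' v'.2).2
      rw [← h1] at h4
      rw [h2] at h3
      omega
    · exact (hq φ' φ'.2).1 ((hTinv _).mp ((show p v = Γ.inv (q φ') from h) ▸ hsT v))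
    · exact (hq φ φ.2).1 ((show q φ = Γ.inv (p v') from h) ▸ (hTinv _).mpr (hsT v'))
    · have h1 : (φ : Φ) = face (Γ.inv (q φ')) := by
        rw [← (hq φ φ.2).2.1]; exact congrArg face h
      have h2 : face (Γ.inv (q φ)) = φ' := by
        rw [← (hq φ' φ'.2).2.1, show q φ = Γ.inv (q φ') from h, Γ.inv_inv]
      have h3 := (hq φ φ.2).2.2
      have h4 := (hq φ' φ'.2).2.2
      rw [← h1] at h4
      rw [h2] at h3
      omega
  let m : ({v // v ≠ base} ⊕ {φ // φ ≠ root}) × Bool → Γ.D :=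
    fun x => if x.2 then s x.1 else Γ.inv (s x.1)
  -- The map is injective, and Euler's formula gives `2((|V| - 1) + (|Φ| - 1)) = |D|`, so tree
  -- edges, dual tree edges and their inverses are all the edges.
  have hm : Function.Surjective m := by
    have hinj : Function.Injective m := by
      rintro ⟨x, a⟩ ⟨y, b⟩ h
      have hii : ∀ d e, Γ.inv d = Γ.inv e → d = e := fun d e h => by
        rw [← Γ.inv_inv d, h, Γ.inv_inv]
      cases a <;> cases b <;> simp only [m, if_true, if_false, Bool.false_eq_true] at h
      · rw [hs1 x y (hii _ _ h)]
      · exact absurd h.symm (hs2 _ _)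
      · exact absurd h (hs2 _ _)
      · rw [hs1 x y h]
    refine (hinj.bijective_of_nat_card_le ?_).surjective
    have _ := Fintype.ofFinite Φ
    rw [Nat.card_prod, Nat.card_sum]
    simp only [Nat.card_eq_fintype_card, Fintype.card_subtype_compl, Fintype.card_unique,
      Fintype.card_bool, ne_eq] at euler ⊢
    have h1 : 0 < Fintype.card Γ.V := Fintype.card_pos_iff.mpr ⟨base⟩
    have h2 : 0 < Fintype.card Φ := Fintype.card_pos_iff.mpr ⟨root⟩
    omega
  set ℓ' : Γ.D → G := fun d => π (Γ.src d) * ℓ d * (π (Γ.tgt d))⁻¹ with hℓ'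
  have hℓ'inv : ∀ d, ℓ' d = 1 → ℓ' (Γ.inv d) = 1 := by
    intro d h
    have : ℓ' (Γ.inv d) = (ℓ' d)⁻¹ := by
      simp only [hℓ', hℓ, tgt_inv]
      rw [SerreGraph.tgt]
      group
    rw [this, h, inv_one]
  have hpv : ∀ v, v ≠ base → ℓ' (p v) = 1 := by
    intro v hv
    simp only [hℓ', (hp v hv).1]
    rw [hπ v hv, mul_inv_cancel]
  obtain ⟨N, hN⟩ : ∃ N, ∀ φ, rank φ ≤ N := by
    obtain ⟨N, hN⟩ := (Set.finite_range rank).bddAbove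
    exact ⟨N, fun φ => hN ⟨φ, rfl⟩⟩
  -- The induction goes down in rank. All sides of `φ` other than `q φ` are tree edges or inverses
  -- of the parent edges of faces of greater rank, so the relation around `φ` reduces to the label
  -- of `q φ`.
  have hqφ : ∀ k φ, N - rank φ = k → φ ≠ root → ℓ' (q φ) = 1 := by
    intro k
    induction k using Nat.strong_induction_on with
    | _ k ih =>
      intro φ hk hφ
      obtain ⟨L, v, hL1, hL2, hL3, hL4⟩ := hprod φ hφ
      have h1 := prod_map_potential ℓ π hL3
      rw [hL4, mul_one, mul_inv_cancel] at h1
      rw [← h1]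
      symm
      refine list_prod_eq_of_forall_ne hL1 ℓ' ((hL2 _).mpr (hq φ hφ).2.1) ?_
      intro d hd hne
      rw [hL2] at hd
      obtain ⟨⟨v | φ', b⟩, rfl⟩ := hm d
      · cases b
        · exact hℓ'inv _ (hpv v v.2)
        · exact hpv v v.2
      · cases b
        · simp only [m, if_false, Bool.false_eq_true] at hd ⊢
          have h2 := (hq φ' φ'.2).2.2
          have h3 : rank φ < rank φ' := by
            rw [← hd]; exact h2
          exact hℓ'inv _ (ih (N - rank φ') (by have := hN φ'; omega) φ' rfl φ'.2)
        · exfalso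
          apply hne
          have : (φ' : Φ) = φ := by rw [← hd, ← (hq φ' φ'.2).2.1]; rfl
          rw [← this]; rfl
  refine ⟨π, hπ0, fun d => ?_⟩
  have hd1 : ℓ' d = 1 := by
    obtain ⟨⟨v | φ', b⟩, rfl⟩ := hm d
    · cases b
      · exact hℓ'inv _ (hpv v v.2)
      · exact hpv v v.2
    · cases b
      · exact hℓ'inv _ (hqφ _ φ' rfl φ'.2)
      · exact hqφ _ φ' rfl φ'.2
  exact (mul_inv_eq_one.mp hd1).symm

end SerreGraph

namespace TwoComplex

theorem isPath_ofFn_side (Y : TwoComplex) (f : Y.F) :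
    Y.IsPath (Y.src (Y.side f ⟨0, Y.len_pos f⟩)) (List.ofFn (Y.side f))
      (Y.src (Y.side f ⟨0, Y.len_pos f⟩)) :=
  SerreGraph.isPath_ofFn (Y.len_pos f) (Y.side_closed f)

end TwoComplex

namespace FinPresentation.VanKampenDiagram

variable {G : Type*} [Group G] {A : Type*} [InvolutiveInv A] {S : SymGen G A}
  {P : FinPresentation S} {w : List A}

/-- Relators evaluate to 1, so the labels are trivial around every polygon except possibly the outer
one, which serves as root. `hw` makes the outer polygon have a side. -/
theorem exists_vertexProjection (Δ : P.VanKampenDiagram w) (hw : w ≠ []) :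
    ∃ π, Δ.IsVertexProjection π := by
  have := Δ.finite_V
  have := Δ.finite_D
  have := Δ.finite_F
  let E := Equiv.ofBijective _ Δ.sides_bijective
  -- The outer sides are inverses of boundary edges, so the next side of the outer polygon is found
  -- by rotating the boundary index backwards.
  let nx : Equiv.Perm Δ.Y.D := E.symm.trans
    ((Equiv.sumCongr (Equiv.sigmaCongrRight fun f => finRotate (Δ.Y.len f))
      (finRotate w.length).symm).trans E)
  let fc : (Σ f : Δ.Y.F, Fin (Δ.Y.len f)) ⊕ Fin w.length → Option Δ.Y.F :=
    Sum.elim (fun s => some s.1) (fun _ => none)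
  have hEl : ∀ f k, E (.inl ⟨f, k⟩) = Δ.Y.side f k := fun f k => rfl
  have hEr : ∀ i, E (.inr i) = Δ.Y.inv (Δ.bd i) := fun i => rfl
  have hnxl : ∀ f k, nx (Δ.Y.side f k) = Δ.Y.side f (finRotate _ k) := by
    intro f k
    rw [← hEl, ← hEl]
    simp [nx]
  have hnxr : ∀ i, nx (Δ.Y.inv (Δ.bd (finRotate _ i))) = Δ.Y.inv (Δ.bd i) := by
    intro i
    rw [← hEr, ← hEr]
    simp [nx, -finRotate_apply]
  refine SerreGraph.exists_potential (Γ := Δ.Y.toSerreGraph) (base := Δ.base) Δ.connected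
    (fun d => fc (E.symm d)) ?_ nx ?_ ?_ ?_ none ?_ (fun d => S.rep (Δ.label d)) ?_ ?_
  · rintro (_ | f)
    · exact ⟨E (.inr ⟨0, List.length_pos_iff.mpr hw⟩), by simp [fc]⟩
    · exact ⟨E (.inl ⟨f, ⟨0, Δ.Y.len_pos f⟩⟩), by simp [fc]⟩
  · intro d
    obtain ⟨⟨f, k⟩ | i, rfl⟩ := E.surjective d <;> simp [nx, fc]
  · intro d
    obtain ⟨⟨f, k⟩ | i, rfl⟩ := E.surjective d
    · rw [hEl, hnxl, SerreGraph.tgt, Δ.Y.side_closed]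
    · obtain ⟨j, rfl⟩ := (finRotate w.length).surjective i
      rw [hEr, hnxr, SerreGraph.tgt_inv]
      exact SerreGraph.tgt_eq_src_of_isPath Δ.bd_isPath j
  · intro d d' h
    have h2 := Δ.link d d' h
    clear h
    induction h2 with
    | rel e e' he =>
      rcases he with ⟨f, k, rfl, rfl⟩ | ⟨i, rfl, rfl⟩
      · refine .rel _ _ ?_
        rw [Δ.Y.inv_inv, hnxl]
      · refine .symm _ _ (.rel _ _ ?_)
        rw [hnxr]
    | refl => exact .refl _
    | symm _ _ _ ih => exact ih.symm
    | trans _ _ _ _ _ ih1 ih2 => exact ih1.trans _ _ _ ih2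
  · have := Δ.euler
    rw [Finite.card_option]
    change 2 * (Nat.card Δ.Y.V + (Nat.card Δ.Y.F + 1)) = Nat.card Δ.Y.D + 4
    omega
  · intro d
    simp [Δ.label_inv, S.rep_inv]
  · rintro (_ | f) hφ
    · exact absurd rfl hφ
    · refine ⟨List.ofFn (Δ.Y.side f), Δ.Y.src (Δ.Y.side f ⟨0, Δ.Y.len_pos f⟩), ?_, ?_, ?_, ?_⟩
      · rw [List.nodup_ofFn]
        intro k k' h
        rw [← hEl, ← hEl] at h
        simpa using E.injective h
      · intro d
        rw [List.mem_ofFn']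
        constructor
        · rintro ⟨k, rfl⟩
          rw [← hEl]; simp [fc]
        · intro h
          obtain ⟨⟨f', k⟩ | i, rfl⟩ := E.surjective d
          · simp only [fc, Equiv.symm_apply_apply, Sum.elim_inl, Option.some.injEq] at h
            subst h
            exact ⟨k, rfl⟩
          · simp [fc] at h
      · exact Δ.Y.isPath_ofFn_side f
      · have := P.eval_eq_one (Δ.label_face f)
        rw [SymGen.eval, List.map_ofFn] at this
        rw [List.map_ofFn]
        exact this

end FinPresentation.VanKampenDiagram


/-! ## Tame fillings imply almost convexity -/

namespace SymGen

variable {G : Type*} [Group G] {A : Type*} [InvolutiveInv A] (S : SymGen G A)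

theorem eval_nil : S.eval [] = 1 := by simp [eval]

theorem eval_cons (a : A) (w : List A) : S.eval (a :: w) = S.rep a * S.eval w := by simp [eval]

theorem eval_append (u v : List A) : S.eval (u ++ v) = S.eval u * S.eval v := by simp [eval]

theorem eval_singleton (a : A) : S.eval [a] = S.rep a := by simp [eval]

theorem eval_inverse (w : List A) : S.eval (w.map (·⁻¹)).reverse = (S.eval w)⁻¹ := by
  induction w with
  | nil => simp [eval]
  | cons a w ih => simp [eval_append, eval_cons, ih, eval_nil, S.rep_inv]

theorem exists_word (g : G) : ∃ w, S.eval w = g := by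
  have hg : g ∈ Subgroup.closure (Set.range S.rep) := by rw [S.generates]; trivial
  induction hg using Subgroup.closure_induction with
  | mem x hx => obtain ⟨a, rfl⟩ := hx; exact ⟨[a], S.eval_singleton a⟩
  | one => exact ⟨[], S.eval_nil⟩
  | mul x y _ _ hx hy =>
    obtain ⟨u, rfl⟩ := hx
    obtain ⟨v, rfl⟩ := hy
    exact ⟨u ++ v, S.eval_append u v⟩
  | inv x _ hx =>
    obtain ⟨u, rfl⟩ := hx
    exact ⟨_, S.eval_inverse u⟩

/-- The path in the Cayley graph that starts at `g` and is labelled `w`. -/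
def wordPath : G → List A → List (G × A)
  | _, [] => []
  | g, a :: w => (g, a) :: wordPath (g * S.rep a) w

theorem length_wordPath (g : G) (w : List A) : (S.wordPath g w).length = w.length := by
  induction w generalizing g with
  | nil => rfl
  | cons a w ih => simp [wordPath, ih]

theorem isPath_wordPath (g : G) (w : List A) :
    S.cayleyGraph.IsPath g (S.wordPath g w) (g * S.eval w) := by
  induction w generalizing g with
  | nil =>
    change g = g * S.eval []
    rw [S.eval_nil, mul_one]
  | cons a w ih =>
    refine ⟨rfl, ?_⟩
    rw [S.eval_cons, ← mul_assoc]
    exact ih _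

theorem exists_word_of_isPath {g h : G} {p : List (G × A)} (hp : S.cayleyGraph.IsPath g p h) :
    p = S.wordPath g (p.map Prod.snd) ∧ h = g * S.eval (p.map Prod.snd) := by
  induction p generalizing g with
  | nil =>
    obtain rfl : g = h := hp
    simp [wordPath, eval_nil]
  | cons d p ih =>
    obtain ⟨g', a⟩ := d
    obtain ⟨h1, h2⟩ := hp
    obtain rfl : g' = g := h1
    obtain ⟨h3, h4⟩ := ih h2
    have ht : S.cayleyGraph.tgt (g', a) = g' * S.rep a := rfl
    rw [ht] at h3 h4
    refine ⟨?_, ?_⟩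
    · simp only [List.map_cons, wordPath]
      rw [← h3]
    · simp only [List.map_cons, S.eval_cons]
      rw [← mul_assoc]; exact h4

theorem cayley_connected (v : G) : ∃ p, S.cayleyGraph.IsPath (1 : G) p v := by
  obtain ⟨w, rfl⟩ := S.exists_word v
  refine ⟨S.wordPath 1 w, ?_⟩
  have := S.isPath_wordPath 1 w
  rwa [one_mul] at this

theorem cayley_isPath (g h : G) : ∃ p, S.cayleyGraph.IsPath g p h := by
  obtain ⟨w, hw⟩ := S.exists_word (g⁻¹ * h)
  refine ⟨S.wordPath g w, ?_⟩
  have := S.isPath_wordPath g w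
  rwa [hw, mul_inv_cancel_left] at this

/-- A geodesic word from `g` to `h`. -/
theorem exists_geodesic (g h : G) :
    ∃ w : List A, g * S.eval w = h ∧ w.length = S.cayleyGraph.dist g h := by
  obtain ⟨p, hp⟩ := S.cayley_isPath g h
  obtain ⟨q, hq, hl⟩ := hp.exists_dist
  exact ⟨q.map Prod.snd, (S.exists_word_of_isPath hq).2.symm, (List.length_map _).trans hl⟩

theorem dist_le_length (g : G) (w : List A) :
    S.cayleyGraph.dist g (g * S.eval w) ≤ w.length :=
  (S.isPath_wordPath g w).dist_le.trans_eq (S.length_wordPath g w)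

theorem dist_comm (g h : G) : S.cayleyGraph.dist g h = S.cayleyGraph.dist h g := by
  have : ∀ g h : G, S.cayleyGraph.dist g h ≤ S.cayleyGraph.dist h g := by
    intro g h
    obtain ⟨w, rfl, h2⟩ := S.exists_geodesic h g
    have := S.dist_le_length (h * S.eval w) (w.map (·⁻¹)).reverse
    rw [S.eval_inverse, mul_inv_cancel_right] at this
    simpa [h2] using this
  exact le_antisymm (this g h) (this h g)

theorem edgeInBall_of_le {n : ℕ} {d : G × A}
    (h : S.cayleyGraph.dist (1 : G) (S.cayleyGraph.src d) + 1 ≤ n ∨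
      S.cayleyGraph.dist (1 : G) (S.cayleyGraph.tgt d) + 1 ≤ n) :
    S.cayleyGraph.EdgeInBall (1 : G) n d := by
  intro t ht
  rcases h with h | h
  · have h1 : (S.cayleyGraph.dist (1 : G) (S.cayleyGraph.src d) : ℝ) + 1 ≤ n := by exact_mod_cast h
    exact (min_le_left _ _).trans (by linarith [ht.2])
  · have h1 : (S.cayleyGraph.dist (1 : G) (S.cayleyGraph.tgt d) : ℝ) + 1 ≤ n := by exact_mod_cast h
    exact (min_le_right _ _).trans (by linarith [ht.1])

theorem le_of_edgeInBall {n : ℕ} {d : G × A} (h : S.cayleyGraph.EdgeInBall (1 : G) n d) :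
    S.cayleyGraph.dist (1 : G) (S.cayleyGraph.src d) + 1 ≤ n ∨
      S.cayleyGraph.dist (1 : G) (S.cayleyGraph.tgt d) + 1 ≤ n := by
  have h1 := h (1 / 2) ⟨by norm_num, by norm_num⟩
  rcases min_le_iff.mp h1 with h2 | h2
  · left
    have : (S.cayleyGraph.dist (1 : G) (S.cayleyGraph.src d) : ℝ) < n := by linarith
    exact_mod_cast this
  · right
    have : (S.cayleyGraph.dist (1 : G) (S.cayleyGraph.tgt d) : ℝ) < n := by linarith
    exact_mod_cast this

end SymGen

/-! ### Strips: one setting for intrinsic and extrinsic tameness -/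

open unitInterval in
/-- A combing of a loop labelled `w` in a 2-complex that maps to the Cayley graph, level-increasing with
respect to the coarse distance of that complex. `H i` is the combing of the `i`-th edge. -/
structure TameStrip.{u, v, w} {G : Type*} [Group G] {A : Type*} [InvolutiveInv A] (S : SymGen G A)
    (K : ℕ) (word : List A) where
  Y : TwoComplex.{u, v, w}
  y : Y.V
  connected : ∀ v, ∃ p, Y.IsPath y p v
  len_le : ∀ f, Y.len f ≤ K
  lab : Y.D → A
  π : Y.V → G
  π_base : π y = 1
  π_tgt : ∀ d, π (Y.tgt d) = π (Y.src d) * S.rep (lab d)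
  bd : List Y.D
  lab_bd : bd.map lab = word
  bd_isPath : Y.IsPath y bd y
  H : ℕ → I → I → Y.Space
  continuous_H : ∀ i < bd.length, Continuous fun x : I × I => H i x.1 x.2
  H_zero : ∀ i < bd.length, ∀ p, H i p 0 = TwoComplex.vertexPt y
  H_one : ∀ i (hi : i < bd.length) p, H i p 1 = TwoComplex.edgePt bd[i] p
  mono : ∀ i < bd.length, ∀ p s t, s ≤ t →
    TwoComplex.coarseDist y (H i p s) ≤ TwoComplex.coarseDist y (H i p t)
  skel : ∀ i < bd.length, ∀ t, H i 1 t ∈ Y.skel1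
  glue : ∀ i, i + 1 < bd.length → ∀ t, H i 1 t = H (i + 1) 0 t

theorem SerreGraph.IsPath.map_cayley {Γ : SerreGraph} {G : Type*} [Group G] {A : Type*}
    [InvolutiveInv A] {S : SymGen G A} {π : Γ.V → G} {lab : Γ.D → A}
    (h : ∀ d, π (Γ.tgt d) = π (Γ.src d) * S.rep (lab d)) {a b : Γ.V} {p : List Γ.D}
    (hp : Γ.IsPath a p b) :
    S.cayleyGraph.IsPath (π a) (p.map fun d => (π (Γ.src d), lab d)) (π b) := by
  induction p generalizing a with
  | nil => exact congrArg π hp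
  | cons d p ih =>
    obtain ⟨h1, h2⟩ := hp
    refine ⟨congrArg π h1, ?_⟩
    have := ih h2
    rw [h] at this
    exact this

namespace TameStrip

open TwoComplex

variable {G : Type*} [Group G] {A : Type*} [InvolutiveInv A] {S : SymGen G A} {K : ℕ}
  {word : List A} (T : TameStrip S K word)

theorem dist_π_le (v : T.Y.V) : S.cayleyGraph.dist (1 : G) (T.π v) ≤ T.Y.dist T.y v := by
  obtain ⟨p, hp⟩ := T.connected v
  obtain ⟨q, hq, hl⟩ := hp.exists_dist
  have h2 : S.cayleyGraph.dist (T.π T.y) (T.π v) ≤ T.Y.dist T.y v :=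
    (hq.map_cayley T.π_tgt).dist_le.trans_eq ((List.length_map _).trans hl)
  rwa [T.π_base] at h2

/-- The map to the Cayley graph does not increase distances from the base, so it carries edges of
the ball to edges of the ball. -/
theorem exists_path_of_joined {n k : ℕ} {a b : T.Y.V} (h : JoinedInBall T.y n k a b) :
    ∃ p : List (G × A), S.cayleyGraph.IsPath (T.π a) p (T.π b) ∧ p.length ≤ k ∧
      ∀ d ∈ p, S.cayleyGraph.EdgeInBall (1 : G) n d := by
  obtain ⟨p, h1, h2, h3⟩ := h
  refine ⟨_, h1.map_cayley T.π_tgt, (List.length_map _).le.trans h2, ?_⟩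
  intro d hd
  obtain ⟨e, he, rfl⟩ := List.mem_map.mp hd
  apply S.edgeInBall_of_le
  have h4 : S.cayleyGraph.tgt (T.π (T.Y.src e), T.lab e) = T.π (T.Y.tgt e) := (T.π_tgt e).symm
  rw [h4]
  have h5 := T.dist_π_le (T.Y.src e)
  have h6 := T.dist_π_le (T.Y.tgt e)
  change S.cayleyGraph.dist (1 : G) (T.π (T.Y.src e)) + 1 ≤ n ∨ _
  rcases (edgeDist_le_iff _ _ _).mp (h3 e he) with h | h
  · left; omega
  · right; omega

/-- Cutting the loop at a point. -/
theorem exists_cut {u v : List A} (hw : word = u ++ v) :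
    ∃ (b c : List T.Y.D) (m : T.Y.V), T.bd = b ++ c ∧ b.length = u.length ∧
      T.Y.IsPath T.y b m ∧ T.Y.IsPath m c T.y ∧ c.map T.lab = v ∧ T.π m = S.eval u := by
  have h1 := T.lab_bd.trans hw
  obtain ⟨b, c, h2, h3, h4⟩ := List.map_eq_append_iff.mp h1
  have h5 := T.bd_isPath
  rw [h2] at h5
  obtain ⟨m, h6, h7⟩ := SerreGraph.isPath_append.mp h5
  refine ⟨b, c, m, h2, by rw [← h3, List.length_map], h6, h7, h4, ?_⟩
  have h8 : T.π m = T.π T.y * S.eval (List.map (Prod.snd : G × A → A)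
      (List.map (fun d => ((T.π (T.Y.src d), T.lab d) : G × A)) b)) :=
    (S.exists_word_of_isPath (h6.map_cayley T.π_tgt)).2
  rw [T.π_base, one_mul, List.map_map] at h8
  rw [h8, ← h3]
  rfl

/-- The map to the Cayley graph bounds the distance from below, and an arc of the loop of length at
most `n` bounds it from above. Geodesic arcs in the loop thus fix the levels of the edges under
study. -/
theorem dist_eq_of_cut {b c : List T.Y.D} {m : T.Y.V} {n : ℕ} (hb : T.Y.IsPath T.y b m)
    (hc : T.Y.IsPath m c T.y) (hn : b.length ≤ n ∨ c.length ≤ n)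
    (hm : S.cayleyGraph.dist (1 : G) (T.π m) = n) : T.Y.dist T.y m = n := by
  refine le_antisymm ?_ (hm ▸ T.dist_π_le m)
  rcases hn with hn | hn
  · exact hb.dist_le.trans hn
  · have := hc.reverse.dist_le
    rw [List.length_reverse, List.length_map] at this
    exact this.trans hn

/-- The end of the edge lies in the ball itself, so `joinedInBall_of_tame` applies with `v` the end
and exit time 1. -/
theorem flat (T : TameStrip S K word) {u v : List A} {a : A} {n : ℕ} (hw : word = u ++ a :: v) (hu : u.length = n)
    (hv : v.length = n) (h1 : S.cayleyGraph.dist (1 : G) (S.eval u) = n)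
    (h2 : S.cayleyGraph.dist (1 : G) (S.eval u * S.rep a) = n) :
    ∃ p : List (G × A), S.cayleyGraph.IsPath (S.eval u) p (S.eval u * S.rep a) ∧ p.length ≤ K ∧
      ∀ d ∈ p, S.cayleyGraph.EdgeInBall (1 : G) n d := by
  obtain ⟨b, c, m, h3, h4, h5, h6, h7, h8⟩ := T.exists_cut hw
  obtain ⟨e, c, rfl⟩ : ∃ e c', c = e :: c' := by
    cases c with
    | nil => simp at h7
    | cons e c => exact ⟨e, c, rfl⟩
  obtain ⟨h9, h10⟩ := h6
  simp only [List.map_cons, List.cons.injEq] at h7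
  obtain ⟨rfl, h11⟩ := h7
  subst h9
  have hπt : T.π (T.Y.tgt e) = S.eval u * S.rep (T.lab e) := by rw [T.π_tgt, h8]
  have hi : u.length < T.bd.length := by rw [h3]; simp [h4]
  have hget : T.bd[u.length] = e := by simp [h3, ← h4]
  have hds := T.dist_eq_of_cut h5 (c := e :: c) ⟨rfl, h10⟩ (Or.inl (h4.trans hu).le) (by rw [h8, h1])
  have hdt := T.dist_eq_of_cut (h5.append (SerreGraph.isPath_singleton e)) h10
    (n := n) (Or.inr (by rw [← hv, ← h11, List.length_map])) (by rw [hπt, h2])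
  have := joinedInBall_of_tame T.connected T.len_le (e := e) (v := T.Y.tgt e) (H := T.H u.length)
    (T.continuous_H _ hi) (T.H_zero _ hi) (fun p => by rw [T.H_one _ hi, hget]) (T.mono _ hi)
    hds hdt.ge (Or.inl rfl) (ts := 1)
    (fun t _ => Or.inl ((T.mono _ hi 1 t 1 unitInterval.le_one').trans (by
      rw [T.H_one _ hi, hget, coarseDist_edgePt_one, hdt])))
    (Or.inr ⟨rfl, rfl⟩)
  have h12 := T.exists_path_of_joined this
  rw [h8, hπt] at h12
  exact h12

/-- The two edges at the peak share the fibre over its top vertex. That fibre exits the ball at some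
`v`, and each edge, directed upwards, connects its lower end to this same `v`; hence the bound `K +
K`. -/
theorem peak (T : TameStrip S K word) {u v : List A} {a b : A} {n : ℕ} (hw : word = u ++ a :: b :: v) (hu : u.length = n)
    (hv : v.length = n) (h1 : S.cayleyGraph.dist (1 : G) (S.eval u) = n)
    (h2 : S.cayleyGraph.dist (1 : G) (S.eval u * S.rep a) = n + 1)
    (h2' : S.cayleyGraph.dist (1 : G) (S.eval u * S.rep a * S.rep b) = n) :
    ∃ p : List (G × A), S.cayleyGraph.IsPath (S.eval u) p (S.eval u * S.rep a * S.rep b) ∧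
      p.length ≤ K + K ∧ ∀ d ∈ p, S.cayleyGraph.EdgeInBall (1 : G) n d := by
  obtain ⟨β, c, m, h3, h4, h5, h6, h7, h8⟩ := T.exists_cut hw
  obtain ⟨e, e', c, rfl⟩ : ∃ e e' c', c = e :: e' :: c' := by
    rcases c with _ | ⟨e, _ | ⟨e', c⟩⟩
    · simp at h7
    · simp at h7
    · exact ⟨e, e', c, rfl⟩
  obtain ⟨h9, h10, h10'⟩ := h6
  simp only [List.map_cons, List.cons.injEq] at h7
  obtain ⟨rfl, rfl, h11⟩ := h7
  subst h9
  have hπt : T.π (T.Y.tgt e) = S.eval u * S.rep (T.lab e) := by rw [T.π_tgt, h8]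
  have hπt' : T.π (T.Y.tgt e') = S.eval u * S.rep (T.lab e) * S.rep (T.lab e') := by
    rw [T.π_tgt, h10, hπt]
  have hi : u.length < T.bd.length := by rw [h3]; simp [h4]
  have hi' : u.length + 1 < T.bd.length := by rw [h3]; simp [h4]
  have hget : T.bd[u.length] = e := by simp [h3, ← h4]
  have hget' : T.bd[u.length + 1] = e' := by simp [h3, ← h4]
  have hds := T.dist_eq_of_cut h5 (c := e :: e' :: c) ⟨rfl, h10, h10'⟩ (Or.inl (h4.trans hu).le)
    (by rw [h8, h1])
  have hdm := T.dist_eq_of_cut (h5.append (SerreGraph.isPath_singleton e)) (c := e' :: c)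
    ⟨h10, h10'⟩ (n := n + 1) (Or.inl (by simp [h4, hu])) (by rw [hπt, h2])
  have hdt := T.dist_eq_of_cut ((h5.append (SerreGraph.isPath_singleton e)).append
    (q := [e']) ⟨h10, rfl⟩) h10' (n := n) (Or.inr (by rw [← hv, ← h11, List.length_map]))
    (by rw [hπt', h2'])
  obtain ⟨v, ts, h12, h13⟩ := exists_exit_edge T.connected (n := n) (γ := T.H u.length 1)
    ((T.continuous_H _ hi).comp (Continuous.prodMk_right (1 : unitInterval))) (T.H_zero _ hi 1)
    (m := T.Y.tgt e) (by rw [T.H_one _ hi, hget, edgePt_one]) hdm (T.skel _ hi) (T.mono _ hi 1)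
  have hJ1 := joinedInBall_of_tame T.connected T.len_le (e := e) (v := v) (H := T.H u.length)
    (T.continuous_H _ hi) (T.H_zero _ hi) (fun p => by rw [T.H_one _ hi, hget]) (T.mono _ hi)
    hds (by omega) (Or.inr (by omega)) h12 (Or.inl h13)
  have hgl : ∀ t, T.H (u.length + 1) 0 t = T.H u.length 1 t := fun t => (T.glue _ hi' t).symm
  have htinv : T.Y.tgt (T.Y.inv e') = T.Y.tgt e := by rw [SerreGraph.tgt_inv, h10]
  have hJ2 := joinedInBall_of_tame T.connected T.len_le (e := T.Y.inv e') (v := v)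
    (H := fun p t => T.H (u.length + 1) (unitInterval.symm p) t)
    ((T.continuous_H _ hi').comp
      (f := fun x : unitInterval × unitInterval => (unitInterval.symm x.1, x.2)) (by fun_prop))
    (fun p => T.H_zero _ hi' _)
    (fun p => by rw [T.H_one _ hi', hget', edgePt_flip, unitInterval.symm_symm])
    (fun p => T.mono _ hi' _)
    hdt (by rw [htinv]; omega) (Or.inr (by rw [htinv]; omega)) (ts := ts)
    (by simpa only [unitInterval.symm_one, hgl] using h12)
    (by simpa only [unitInterval.symm_one, hgl] using Or.inl h13)
  have h14 := T.exists_path_of_joined (hJ1.trans hJ2.symm)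
  rw [h8] at h14
  rw [← hπt']
  exact h14

end TameStrip

/-- Close the flat edge or the peak up by geodesics from and to the identity and fill the resulting
loop. -/
theorem SymGen.almostConvex_of_strips {G : Type*} [Group G] {A : Type*} [InvolutiveInv A]
    (S : SymGen G A) (K : ℕ)
    (hT : ∀ w : List A, S.eval w = 1 → w ≠ [] → Nonempty (TameStrip S K w)) : S.AlmostConvex := by
  have hback : ∀ g : G, ∃ v : List A, S.eval v = g⁻¹ ∧ v.length = S.cayleyGraph.dist (1 : G) g := by
    intro g
    obtain ⟨v, h1, h2⟩ := S.exists_geodesic g 1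
    exact ⟨v, eq_inv_of_mul_eq_one_right h1, by rw [h2, S.dist_comm]⟩
  have hgeo : ∀ g : G, ∃ u : List A, S.eval u = g ∧ u.length = S.cayleyGraph.dist (1 : G) g := by
    intro g
    obtain ⟨u, h1, h2⟩ := S.exists_geodesic 1 g
    exact ⟨u, by rwa [one_mul] at h1, h2⟩
  have hflat : ∀ (n : ℕ) (g : G) (a : A), S.cayleyGraph.dist (1 : G) g = n →
      S.cayleyGraph.dist (1 : G) (g * S.rep a) = n →
      ∃ p : List (G × A), S.cayleyGraph.IsPath g p (g * S.rep a) ∧ p.length ≤ K ∧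
        ∀ d ∈ p, S.cayleyGraph.EdgeInBall (1 : G) n d := by
    intro n g a h1 h2
    obtain ⟨u, rfl, hu⟩ := hgeo g
    obtain ⟨v, hv, hv'⟩ := hback (S.eval u * S.rep a)
    obtain ⟨T⟩ := hT (u ++ a :: v) (by rw [S.eval_append, S.eval_cons, hv]; group) (by simp)
    exact T.flat rfl (hu.trans h1) (hv'.trans h2) h1 h2
  -- A peak or two flat edges cost `K + K`. The 2 pays for a midpoint of level below `n`, where the
  -- two edges are already in the ball.
  refine ⟨K + K + 2, ?_⟩
  intro n g h hg hh hgh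
  obtain ⟨x, hx, hl⟩ := S.exists_geodesic g h
  rcases x with _ | ⟨a, _ | ⟨b, _ | ⟨c, x⟩⟩⟩
  · rw [S.eval_nil, mul_one] at hx
    exact ⟨[], hx, by simp, by simp⟩
  · rw [S.eval_singleton] at hx
    subst hx
    obtain ⟨p, h1, h2, h3⟩ := hflat n g a hg hh
    exact ⟨p, h1, by omega, h3⟩
  · rw [S.eval_cons, S.eval_singleton, ← mul_assoc] at hx
    subst hx
    have hd1 : S.cayleyGraph.dist (1 : G) (g * S.rep a) ≤ n + 1 := by
      have := SerreGraph.dist_tgt_le (Γ := S.cayleyGraph) S.cayley_connected (g, a)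
      rw [show S.cayleyGraph.src (g, a) = g from rfl, hg] at this
      exact this
    rcases Nat.lt_trichotomy (S.cayleyGraph.dist (1 : G) (g * S.rep a)) n with hm | hm | hm
    · refine ⟨S.wordPath g [a, b], ?_, by rw [S.length_wordPath]; simp, ?_⟩
      · have := S.isPath_wordPath g [a, b]
        rwa [S.eval_cons, S.eval_singleton, ← mul_assoc] at this
      · intro d hd
        simp only [SymGen.wordPath, List.mem_cons, List.not_mem_nil, or_false] at hd
        apply S.edgeInBall_of_le
        rcases hd with rfl | rfl
        · exact Or.inr hm
        · exact Or.inl hm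
    · obtain ⟨p, h1, h2, h3⟩ := hflat n g a hg hm
      obtain ⟨p', h1', h2', h3'⟩ := hflat n _ b hm hh
      refine ⟨p ++ p', SerreGraph.IsPath.append h1 h1', by simp only [List.length_append]; omega, ?_⟩
      intro d hd
      rcases List.mem_append.mp hd with hd | hd
      · exact h3 d hd
      · exact h3' d hd
    · obtain ⟨u, rfl, hu⟩ := hgeo g
      obtain ⟨v, hv, hv'⟩ := hback (S.eval u * S.rep a * S.rep b)
      obtain ⟨T⟩ := hT (u ++ a :: b :: v)
        (by rw [S.eval_append, S.eval_cons, S.eval_cons, hv]; group) (by simp)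
      obtain ⟨p, h1, h2, h3⟩ := T.peak rfl (hu.trans hg) (hv'.trans hh) hg (by omega) hh
      exact ⟨p, h1, by omega, h3⟩
  · simp only [List.length_cons] at hl
    omega

/-! ### Combed diagrams as strips -/

namespace FinPresentation

open TwoComplex

variable {G : Type*} [Group G] {A : Type*} [InvolutiveInv A] {S : SymGen G A}
  (P : FinPresentation S)

theorem exists_length_le : ∃ K, ∀ r ∈ P.R, r.length ≤ K := by
  obtain ⟨K, hK⟩ := (P.finite.image List.length).bddAbove
  exact ⟨K, fun r hr => hK ⟨r, hr, rfl⟩⟩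

theorem almostConvex_of_intrinsic (h : P.IsIntrinsicTameFilling id) : S.AlmostConvex := by
  obtain ⟨K, hK⟩ := P.exists_length_le
  refine S.almostConvex_of_strips K fun w hw hne => ?_
  obtain ⟨Δ, ψ, hψ, htame⟩ := h.2 w hw
  obtain ⟨π, hπ⟩ := Δ.exists_vertexProjection hne
  have hmem : ∀ i p, edgePt (Δ.bd i) p ∈ Δ.boundary := fun i p => Or.inr ⟨i, p, rfl⟩
  have hmono : ∀ p s t, s ≤ t → coarseDist Δ.base (ψ (p, s)) ≤ coarseDist Δ.base (ψ (p, t)) := by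
    intro p s t hst
    rcases hst.eq_or_lt with rfl | hst
    · exact le_rfl
    · exact htame p s t hst
  let H : ℕ → unitInterval → unitInterval → Δ.Y.Space := fun i p t =>
    if hi : i < w.length then ψ (⟨edgePt (Δ.bd ⟨i, hi⟩) p, hmem _ _⟩, t) else vertexPt Δ.base
  have hH : ∀ i (hi : i < w.length) p t, H i p t = ψ (⟨edgePt (Δ.bd ⟨i, hi⟩) p, hmem _ _⟩, t) :=
    fun i hi p t => dif_pos hi
  refine ⟨⟨Δ.Y, Δ.base, Δ.connected, fun f => ?_, Δ.label, π, hπ.1, hπ.2, List.ofFn Δ.bd, ?_,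
    Δ.bd_isPath, H, ?_, ?_, ?_, ?_, ?_, ?_⟩⟩
  · simpa using hK _ (Δ.label_face f)
  · apply List.ext_getElem <;> simp [Δ.label_bd]
  all_goals simp only [List.length_ofFn, List.getElem_ofFn]
  · intro i hi
    simp only [hH i hi]
    refine hψ.continuous.comp ?_
    refine Continuous.prodMk (Continuous.subtype_mk ?_ _) continuous_snd
    exact (continuous_edgePt _).comp continuous_fst
  · intro i hi p
    rw [hH i hi, hψ.map_zero]
  · intro i hi p
    rw [hH i hi, hψ.map_one]
  · intro i hi p s t hst
    rw [hH i hi, hH i hi]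
    exact hmono _ _ _ hst
  · intro i hi t
    rw [hH i hi]
    exact hψ.map_skel0 _ ⟨_, edgePt_one _⟩ t
  · intro i hi t
    rw [hH i (by omega), hH (i + 1) hi]
    congr 3
    rw [edgePt_one, edgePt_zero, SerreGraph.tgt_eq_src_of_isPath Δ.bd_isPath,
      finRotate_mk_of_lt hi]

theorem VanKampenDiagram.continuous_projection {P : FinPresentation S} {w : List A}
    {Δ : P.VanKampenDiagram w} (π : Δ.Y.V → G) (hπ : Δ.IsVertexProjection π) :
    Continuous (VanKampenDiagram.projection π hπ) := by
  refine continuous_coinduced_dom.mpr (continuous_sum_dom.mpr ⟨continuous_sigma fun v => ?_,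
    continuous_sum_dom.mpr ⟨continuous_sigma fun d => ?_, continuous_sigma fun f => ?_⟩⟩)
  · exact continuous_const
  · exact continuous_edgePt (Y := P.cayleyComplex) _
  · exact continuous_facePt (Y := P.cayleyComplex) _

/-- The strip is the projected combing, and its complex is the Cayley complex with `π = id`, since
that is where the extrinsic levels are measured. -/
theorem almostConvex_of_extrinsic (h : P.IsExtrinsicTameFilling id) : S.AlmostConvex := by
  obtain ⟨K, hK⟩ := P.exists_length_le
  refine S.almostConvex_of_strips K fun w hw hne => ?_
  obtain ⟨Δ, ψ, π, hπ, hψ, htame⟩ := h.2 w hw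
  have hmem : ∀ i p, edgePt (Δ.bd i) p ∈ Δ.boundary := fun i p => Or.inr ⟨i, p, rfl⟩
  set pr := VanKampenDiagram.projection π hπ with hpr
  have hprc : Continuous pr := VanKampenDiagram.continuous_projection π hπ
  have hmono : ∀ p s t, s ≤ t → coarseDist (Y := P.cayleyComplex) (1 : G) (pr (ψ (p, s))) ≤
      coarseDist (Y := P.cayleyComplex) (1 : G) (pr (ψ (p, t))) := by
    intro p s t hst
    rcases hst.eq_or_lt with rfl | hst
    · exact le_rfl
    · exact htame p s t hst
  let H : ℕ → unitInterval → unitInterval → P.cayleyComplex.Space := fun i p t =>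
    if hi : i < w.length then pr (ψ (⟨edgePt (Δ.bd ⟨i, hi⟩) p, hmem _ _⟩, t)) else
      vertexPt (Y := P.cayleyComplex) (1 : G)
  have hH : ∀ i (hi : i < w.length) p t,
      H i p t = pr (ψ (⟨edgePt (Δ.bd ⟨i, hi⟩) p, hmem _ _⟩, t)) :=
    fun i hi p t => dif_pos hi
  have hbase : pr (vertexPt Δ.base) = vertexPt (Y := P.cayleyComplex) (1 : G) :=
    congrArg (vertexPt (Y := P.cayleyComplex)) hπ.1
  obtain ⟨bd, hbd, hlab, hlen, hget⟩ : ∃ bd : List (G × A), S.cayleyGraph.IsPath (1 : G) bd (1 : G) ∧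
      bd.map Prod.snd = w ∧ bd.length = w.length ∧ ∀ i (hi : i < bd.length) (hi' : i < w.length),
        bd[i] = (π (Δ.Y.src (Δ.bd ⟨i, hi'⟩)), Δ.label (Δ.bd ⟨i, hi'⟩)) := by
    have hpath := Δ.bd_isPath.map_cayley hπ.2
    rw [hπ.1] at hpath
    refine ⟨(List.ofFn Δ.bd).map fun d => ((π (Δ.Y.src d), Δ.label d) : G × A), hpath, ?_,
      by simp, by simp⟩
    apply List.ext_getElem <;> simp [Δ.label_bd]
  refine ⟨⟨P.cayleyComplex, (1 : G), S.cayley_connected, fun f => hK _ f.2.2, Prod.snd, id, rfl,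
    fun d => rfl, bd, hlab, hbd, H, ?_, ?_, ?_, ?_, ?_, ?_⟩⟩
  · intro i hi
    replace hi : i < w.length := lt_of_lt_of_eq hi hlen
    simp only [hH i hi]
    refine hprc.comp (hψ.continuous.comp ?_)
    refine Continuous.prodMk (Continuous.subtype_mk ?_ _) continuous_snd
    exact (continuous_edgePt _).comp continuous_fst
  · intro i hi p
    replace hi : i < w.length := lt_of_lt_of_eq hi hlen
    rw [hH i hi, hψ.map_zero, hbase]
  · intro i hi p
    have hi' : i < w.length := lt_of_lt_of_eq hi hlen
    rw [hH i hi', hψ.map_one]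
    exact congrArg (fun d => edgePt (Y := P.cayleyComplex) d p) (hget i hi hi').symm
  · intro i hi p s t hst
    replace hi : i < w.length := lt_of_lt_of_eq hi hlen
    rw [hH i hi, hH i hi]
    exact hmono _ _ _ hst
  · intro i hi t
    replace hi : i < w.length := lt_of_lt_of_eq hi hlen
    rw [hH i hi]
    rcases hψ.map_skel0 ⟨edgePt (Δ.bd ⟨i, hi⟩) 1, hmem _ _⟩ ⟨_, edgePt_one _⟩ t with ⟨v, hv⟩ | ⟨d, s, hd⟩
    · rw [hv]
      exact Or.inl ⟨π v, rfl⟩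
    · rw [hd]
      exact Or.inr ⟨(π (Δ.Y.src d), Δ.label d), s, rfl⟩
  · intro i hi t
    replace hi : i + 1 < w.length := lt_of_lt_of_eq hi hlen
    rw [hH i (by omega), hH (i + 1) hi]
    congr 4
    rw [edgePt_one, edgePt_zero, SerreGraph.tgt_eq_src_of_isPath Δ.bd_isPath,
      finRotate_mk_of_lt hi]

end FinPresentation


/-! ## Almost convexity gives a reduction of loops, and a finite presentation -/

namespace SymGen

variable {G : Type*} [Group G] {A : Type*} [InvolutiveInv A] (S : SymGen G A)

/-- The distance from the identity. -/
noncomputable def level (g : G) : ℕ := S.cayleyGraph.dist (1 : G) g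

theorem level_one : S.level 1 = 0 := SerreGraph.dist_self (Γ := S.cayleyGraph) (1 : G)

theorem level_mul_le (g : G) (a : A) : S.level (g * S.rep a) ≤ S.level g + 1 :=
  SerreGraph.dist_tgt_le (Γ := S.cayleyGraph) S.cayley_connected (g, a)

theorem level_le_mul (g : G) (a : A) : S.level g ≤ S.level (g * S.rep a) + 1 := by
  have := S.level_mul_le (g * S.rep a) a⁻¹
  rwa [S.rep_inv, mul_inv_cancel_right] at this

theorem wordPath_append (g : G) (u v : List A) :
    S.wordPath g (u ++ v) = S.wordPath g u ++ S.wordPath (g * S.eval u) v := by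
  induction u generalizing g with
  | nil => simp [wordPath, eval_nil]
  | cons a u ih => simp [wordPath, ih, eval_cons, mul_assoc]

theorem exists_of_mem_wordPath {g : G} {w : List A} {e : G × A} (h : e ∈ S.wordPath g w) :
    ∃ u v, w = u ++ e.2 :: v ∧ e.1 = g * S.eval u := by
  induction w generalizing g with
  | nil => simp [wordPath] at h
  | cons a w ih =>
    rcases List.mem_cons.mp h with rfl | h
    · exact ⟨[], w, rfl, by simp [eval_nil]⟩
    · obtain ⟨u, v, rfl, h2⟩ := ih h
      exact ⟨a :: u, v, rfl, by rw [h2, eval_cons, mul_assoc]⟩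

/-- The edge lies in the ball of radius `n`. -/
def LowEdge (n : ℕ) (e : G × A) : Prop := S.level e.1 < n ∨ S.level (e.1 * S.rep e.2) < n

/-- A word labels a path in the ball of radius `n` when read from `g`. -/
def LowWord (n : ℕ) (g : G) (w : List A) : Prop := ∀ e ∈ S.wordPath g w, S.LowEdge n e

theorem LowEdge.level_le {S : SymGen G A} {n : ℕ} {e : G × A} (h : S.LowEdge n e) :
    S.level e.1 ≤ n ∧ S.level (e.1 * S.rep e.2) ≤ n := by
  have h1 := S.level_mul_le e.1 e.2
  have h2 := S.level_le_mul e.1 e.2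
  rcases h with h | h <;> constructor <;> omega

theorem AlmostConvex.exists_lowWord {S : SymGen G A} (h : S.AlmostConvex) :
    ∃ k, ∀ (n : ℕ) (g : G) (w : List A), w.length ≤ 2 → S.level g = n →
      S.level (g * S.eval w) = n →
      ∃ s, s.length ≤ k ∧ S.eval s = S.eval w ∧ S.LowWord n g s := by
  obtain ⟨k, hk⟩ := h
  refine ⟨k, fun n g w hw h1 h2 => ?_⟩
  obtain ⟨p, hp, hl, hb⟩ := hk n g (g * S.eval w) h1 h2 ((S.dist_le_length g w).trans hw)
  obtain ⟨h3, h4⟩ := S.exists_word_of_isPath hp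
  refine ⟨p.map Prod.snd, (List.length_map _).trans_le hl, (mul_left_cancel h4).symm, ?_⟩
  intro e he
  rw [← h3] at he
  exact S.le_of_edgeInBall (hb e he)

/-- Every loop can be reduced to the trivial loop by pushing flat edges and peaks down. -/
theorem loop_induction {k : ℕ} (hk : ∀ (n : ℕ) (g : G) (w : List A), w.length ≤ 2 → S.level g = n →
      S.level (g * S.eval w) = n → ∃ s, s.length ≤ k ∧ S.eval s = S.eval w ∧ S.LowWord n g s)
    {M : List A → Prop} (nil : M [])
    (flat : ∀ (n : ℕ) (u v s : List A) (a : A), s.length ≤ k → S.eval s = S.rep a →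
      S.level (S.eval u) = n → S.level (S.eval u * S.rep a) = n → S.LowWord n (S.eval u) s →
      S.eval (u ++ s ++ v) = 1 → M (u ++ s ++ v) → M (u ++ [a] ++ v))
    (peak : ∀ (n : ℕ) (u v s : List A) (a b : A), s.length ≤ k → S.eval s = S.rep a * S.rep b →
      S.level (S.eval u) = n → S.level (S.eval u * S.rep a) = n + 1 →
      S.level (S.eval u * S.rep a * S.rep b) = n → S.LowWord n (S.eval u) s →
      S.eval (u ++ s ++ v) = 1 → M (u ++ s ++ v) → M (u ++ [a, b] ++ v))
    {w : List A} (hw : S.eval w = 1) : M w := by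
  classical
  -- Among loops with all vertices at level at most `n`, the edges outside the ball are the flat
  -- ones at level `n`. Replacing one by a low path lowers their number.
  have stepB : ∀ n : ℕ, (∀ w, S.eval w = 1 → S.LowWord n 1 w → M w) →
      ∀ w, S.eval w = 1 →
        (∀ e ∈ S.wordPath 1 w, S.level e.1 ≤ n ∧ S.level (e.1 * S.rep e.2) ≤ n) → M w := by
    intro n hA w
    induction hc : (S.wordPath 1 w).countP (fun e => decide (¬ S.LowEdge n e))
      using Nat.strong_induction_on generalizing w with
    | h c ih =>
    intro hw hb
    by_cases hlow : S.LowWord n 1 w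
    · exact hA w hw hlow
    simp only [LowWord, not_forall] at hlow
    obtain ⟨⟨g, a⟩, he, hne⟩ := hlow
    obtain ⟨u, v, h1, h2⟩ := S.exists_of_mem_wordPath he
    simp only [one_mul] at h1 h2
    subst h2
    subst h1
    have hble := hb _ he
    have hne' := hne
    simp only [LowEdge, not_or, not_lt] at hne'
    have l1 := le_antisymm hble.1 hne'.1
    have l2 := le_antisymm hble.2 hne'.2
    obtain ⟨s, hs1, hs2, hs3⟩ := hk n (S.eval u) [a] (by simp) l1 (by rwa [S.eval_singleton])
    rw [S.eval_singleton] at hs2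
    have hev : S.eval (u ++ s ++ v) = 1 := by
      rw [← hw]
      simp only [S.eval_append, S.eval_cons, hs2, mul_assoc]
    have e1 : S.wordPath 1 (u ++ a :: v) = S.wordPath 1 u ++ (S.eval u, a) ::
        S.wordPath (S.eval u * S.rep a) v := by
      rw [S.wordPath_append, one_mul]; rfl
    have e2 : S.wordPath 1 (u ++ s ++ v) = S.wordPath 1 u ++ S.wordPath (S.eval u) s ++
        S.wordPath (S.eval u * S.rep a) v := by
      rw [S.wordPath_append, S.wordPath_append, S.eval_append, hs2, one_mul, one_mul]
    have := flat n u v s a hs1 hs2 l1 l2 hs3 hev (ih _ ?_ _ rfl hev ?_)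
    · simpa using this
    · rw [← hc, e1, e2, List.countP_append, List.countP_append, List.countP_append,
        List.countP_cons_of_pos (by simpa using hne),
        (List.countP_eq_zero (p := fun e => decide (¬ S.LowEdge n e))
          (l := S.wordPath (S.eval u) s)).mpr (fun e he => by simpa using hs3 e he)]
      omega
    · intro e he
      rw [e2, List.mem_append, List.mem_append] at he
      rw [e1] at hb
      rcases he with (he | he) | he
      · exact hb e (List.mem_append_left _ he)
      · exact (hs3 e he).level_le
      · exact hb e (List.mem_append_right _ (List.mem_cons_of_mem _ he))
  -- A loop in the ball of radius `n + 1` meets level `n + 1` only in peaks, because both edges at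
  -- such a vertex must descend. Replacing a peak by a low path lowers the number of edges that
  -- touch level `n + 1`.
  have stepA : ∀ n : ℕ, (∀ w, S.eval w = 1 →
        (∀ e ∈ S.wordPath 1 w, S.level e.1 ≤ n ∧ S.level (e.1 * S.rep e.2) ≤ n) → M w) →
      ∀ w, S.eval w = 1 → S.LowWord (n + 1) 1 w → M w := by
    intro n hB w
    induction hc : (S.wordPath 1 w).countP
        (fun e => decide (¬ (S.level e.1 ≤ n ∧ S.level (e.1 * S.rep e.2) ≤ n)))
      using Nat.strong_induction_on generalizing w with
    | h c ih =>
    intro hw hlow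
    by_cases hb : ∀ e ∈ S.wordPath 1 w, S.level e.1 ≤ n ∧ S.level (e.1 * S.rep e.2) ≤ n
    · exact hB w hw hb
    obtain ⟨u, a, b, v, rfl, hm⟩ : ∃ u a b v, w = u ++ a :: b :: v ∧
        n < S.level (S.eval u * S.rep a) := by
      simp only [not_forall] at hb
      obtain ⟨⟨g, a⟩, he, hne⟩ := hb
      obtain ⟨u, v, h1, h2⟩ := S.exists_of_mem_wordPath he
      simp only [one_mul] at h1 h2
      subst h2
      subst h1
      rcases not_and_or.mp hne with h | h
      · rcases List.eq_nil_or_concat u with rfl | ⟨u, c, rfl⟩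
        · simp [S.eval_nil, S.level_one] at h
        · refine ⟨u, c, a, v, by simp, ?_⟩
          simpa [S.eval_append, S.eval_singleton] using h
      · rcases v with _ | ⟨b, v⟩
        · rw [S.eval_append, S.eval_singleton] at hw
          simp [hw, S.level_one] at h
        · exact ⟨u, a, b, v, rfl, by simpa using h⟩
    have e1 : S.wordPath 1 (u ++ a :: b :: v) = S.wordPath 1 u ++ (S.eval u, a) ::
        (S.eval u * S.rep a, b) :: S.wordPath (S.eval u * S.rep a * S.rep b) v := by
      rw [S.wordPath_append, one_mul]; rfl
    have ha : S.LowEdge (n + 1) (S.eval u, a) := hlow _ (by rw [e1]; simp)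
    have hb' : S.LowEdge (n + 1) (S.eval u * S.rep a, b) := hlow _ (by rw [e1]; simp)
    have l3 := S.level_mul_le (S.eval u) a
    have l4 := S.level_le_mul (S.eval u * S.rep a) b
    simp only [LowEdge] at ha hb'
    have l1 : S.level (S.eval u) = n := by omega
    have l2 : S.level (S.eval u * S.rep a) = n + 1 := by omega
    have l5 : S.level (S.eval u * S.rep a * S.rep b) = n := by omega
    have hab : S.eval [a, b] = S.rep a * S.rep b := by rw [S.eval_cons, S.eval_singleton]
    obtain ⟨s, hs1, hs2, hs3⟩ := hk n (S.eval u) [a, b] (by simp) l1 (by rwa [hab, ← mul_assoc])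
    rw [hab] at hs2
    have hev : S.eval (u ++ s ++ v) = 1 := by
      rw [← hw]
      simp only [S.eval_append, S.eval_cons, hs2, mul_assoc]
    have e2 : S.wordPath 1 (u ++ s ++ v) = S.wordPath 1 u ++ S.wordPath (S.eval u) s ++
        S.wordPath (S.eval u * S.rep a * S.rep b) v := by
      rw [S.wordPath_append, S.wordPath_append, S.eval_append, hs2, one_mul, one_mul, mul_assoc]
    have := peak n u v s a b hs1 hs2 l1 l2 l5 hs3 hev (ih _ ?_ _ rfl hev ?_)
    · simpa using this
    · rw [← hc, e1, e2, List.countP_append, List.countP_append, List.countP_append,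
        List.countP_cons_of_pos (by simp; omega), List.countP_cons,
        (List.countP_eq_zero
          (p := fun e => decide (¬ (S.level e.1 ≤ n ∧ S.level (e.1 * S.rep e.2) ≤ n)))
          (l := S.wordPath (S.eval u) s)).mpr (fun e he => by simpa using (hs3 e he).level_le)]
      omega
    · intro e he
      rw [e2, List.mem_append, List.mem_append] at he
      rw [LowWord, e1] at hlow
      rcases he with (he | he) | he
      · exact hlow e (List.mem_append_left _ he)
      · exact (hs3 e he).imp (fun h => by omega) (fun h => by omega)
      · exact hlow e (List.mem_append_right _ (List.mem_cons_of_mem _ (List.mem_cons_of_mem _ he)))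
  -- The two steps alternate down to radius 0, whose ball contains no edge, so that only the empty
  -- word is left.
  have hA : ∀ n : ℕ, ∀ w, S.eval w = 1 → S.LowWord n 1 w → M w := by
    intro n
    induction n with
    | zero =>
      intro w _ hl
      rcases w with _ | ⟨a, w⟩
      · exact nil
      · have := hl (1, a) (by simp [wordPath])
        simp [LowEdge] at this
    | succ n ih => exact stepA n (stepB n ih)
  have hbound : ∀ l : List (G × A), ∃ n, ∀ e ∈ l, S.LowEdge n e := by
    intro l
    induction l with
    | nil => exact ⟨0, by simp⟩
    | cons e l ih =>
      obtain ⟨n, hn⟩ := ih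
      refine ⟨n + S.level e.1 + 1, ?_⟩
      intro e' he'
      rcases List.mem_cons.mp he' with rfl | he'
      · left; omega
      · exact (hn e' he').imp (fun h => by omega) (fun h => by omega)
  obtain ⟨n, hn⟩ := hbound (S.wordPath 1 w)
  exact hA n w hw hn

theorem eval_of_freeReduction {r r' : List A} (h : FreeReduction r r') :
    S.eval r' = S.eval r ∧ r'.length ≤ r.length := by
  cases h with
  | step x y a =>
    refine ⟨by simp [S.eval_append, S.eval_cons, S.rep_inv], ?_⟩
    simp only [List.length_append, List.length_cons]
    omega

theorem eval_of_reflTransGen {r r' : List A} (h : Relation.ReflTransGen FreeReduction r r') :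
    S.eval r' = S.eval r ∧ r'.length ≤ r.length := by
  induction h with
  | refl => exact ⟨rfl, le_rfl⟩
  | tail _ h ih =>
    have h1 := S.eval_of_freeReduction h
    exact ⟨h1.1.trans ih.1, h1.2.trans ih.2⟩

/-- The presentation whose relators are the short words that represent the identity. -/
def shortPresentation [Finite A] {k : ℕ}
    (hk : ∀ (n : ℕ) (g : G) (w : List A), w.length ≤ 2 → S.level g = n →
      S.level (g * S.eval w) = n → ∃ s, s.length ≤ k ∧ S.eval s = S.eval w ∧ S.LowWord n g s) :
    FinPresentation S where
  R := {r | r ≠ [] ∧ r.length ≤ k + 2 ∧ S.eval r = 1}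
  finite := (List.finite_length_le A (k + 2)).subset fun r hr => hr.2.1
  nil_notMem h := h.1 rfl
  inv_mem r hr := ⟨by simpa using hr.1, by simpa using hr.2.1, by rw [S.eval_inverse, hr.2.2, inv_one]⟩
  rotate_mem r hr i := by
    refine ⟨by simpa using hr.1, by simpa using hr.2.1, ?_⟩
    have h2 := hr.2.2
    rw [List.rotate_eq_drop_append_take_mod, S.eval_append]
    rw [← List.take_append_drop (i % r.length) r, S.eval_append] at h2
    exact mul_eq_one_iff_eq_inv.mpr (eq_inv_of_mul_eq_one_right h2)
  reduced_mem r hr r' h _ hne := by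
    have := S.eval_of_reflTransGen h
    exact ⟨hne, this.2.trans hr.2.1, this.1.trans hr.2.2⟩
  ker_eq := by
    set N := Subgroup.normalClosure
      (Set.range (fun a : A => FreeGroup.of a * FreeGroup.of a⁻¹) ∪
      (fun r : List A => (r.map FreeGroup.of).prod) '' {r | r ≠ [] ∧ r.length ≤ k + 2 ∧ S.eval r = 1})
      with hN
    have hlift : ∀ r : List A, FreeGroup.lift S.rep (r.map FreeGroup.of).prod = S.eval r := by
      intro r
      rw [map_list_prod, List.map_map, eval]
      congr 2
      funext a
      simp
    apply le_antisymm
    -- Words over `A` are multiplied out in the quotient by the relators. The relators of length at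
    -- most `k + 2` allow each replacement in `loop_induction`, so words representing 1 die in the
    -- quotient.
    · let f : A → FreeGroup A ⧸ N := fun a => QuotientGroup.mk' N (FreeGroup.of a)
      let F : List A → FreeGroup A ⧸ N := fun w => (w.map f).prod
      have hF : ∀ w : List A, F w = QuotientGroup.mk' N (w.map FreeGroup.of).prod := by
        intro w
        rw [map_list_prod, List.map_map]
        rfl
      have hinv : ∀ a, f a⁻¹ = (f a)⁻¹ := by
        intro a
        rw [eq_comm, inv_eq_iff_mul_eq_one]
        simp only [f]
        rw [← map_mul]
        exact (QuotientGroup.eq_one_iff _).mpr (Subgroup.subset_normalClosure (Or.inl ⟨a, rfl⟩))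
      have hFa : ∀ u v, F (u ++ v) = F u * F v := fun u v => by simp [F]
      have hFi : ∀ w : List A, F (w.map (·⁻¹)).reverse = (F w)⁻¹ := by
        intro w
        induction w with
        | nil => simp [F]
        | cons a w ih =>
          rw [List.map_cons, List.reverse_cons, hFa, ih]
          simp only [F, List.map_cons, List.prod_cons, List.map_nil, List.prod_nil, mul_one, hinv]
          exact (mul_inv_rev (f a) _).symm
      have hrel : ∀ r : List A, r ≠ [] → r.length ≤ k + 2 → S.eval r = 1 → F r = 1 := by
        intro r h1 h2 h3
        rw [hF]
        exact (QuotientGroup.eq_one_iff _).mpr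
          (Subgroup.subset_normalClosure (Or.inr ⟨r, ⟨h1, h2, h3⟩, rfl⟩))
      have hsub : ∀ t s : List A, t ≠ [] → t.length ≤ 2 → s.length ≤ k → S.eval s = S.eval t →
          F t = F s := by
        intro t s h0 h1 h2 h3
        have := hrel (t ++ (s.map (·⁻¹)).reverse) (by simp [h0])
          (by simp only [List.length_append, List.length_reverse, List.length_map]; omega)
          (by rw [S.eval_append, S.eval_inverse, h3, mul_inv_cancel])
        rw [hFa, hFi] at this
        exact mul_inv_eq_one.mp this
      have hloop : ∀ w, S.eval w = 1 → F w = 1 := by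
        intro w hw
        refine S.loop_induction hk (M := fun w => F w = 1) (by simp [F]) ?_ ?_ hw
        · intro n u v s a h1 h2 _ _ _ _ h3
          rw [hFa, hFa, hsub [a] s (by simp) (by simp) h1 (by rw [h2, S.eval_singleton]), ← hFa, ← hFa]
          exact h3
        · intro n u v s a b h1 h2 _ _ _ _ _ h3
          rw [hFa, hFa, hsub [a, b] s (by simp) (by simp) h1
            (by rw [h2, S.eval_cons, S.eval_singleton]), ← hFa, ← hFa]
          exact h3
      -- The relators `a a⁻¹` identify the formal inverse letter with the inverse in the free group,
      -- so positive words over `A` represent every class.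
      have hword : ∀ z : FreeGroup A, ∃ w : List A, QuotientGroup.mk' N z = F w ∧
          FreeGroup.lift S.rep z = S.eval w := by
        intro z
        induction z using FreeGroup.induction_on with
        | C1 => exact ⟨[], by simp [F], by simp [S.eval_nil]⟩
        | of a => exact ⟨[a], by simp [F, f], by simp [S.eval_singleton]⟩
        | inv_of a _ =>
          exact ⟨[a⁻¹], by simp only [F, List.map_singleton, List.prod_singleton, hinv]; rfl,
            by simp [S.eval_singleton, S.rep_inv]⟩
        | mul x y hx hy =>
          obtain ⟨u, hu, hu'⟩ := hx
          obtain ⟨v, hv, hv'⟩ := hy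
          exact ⟨u ++ v, by rw [map_mul, hu, hv, hFa], by rw [map_mul, hu', hv', S.eval_append]⟩
      intro z hz
      obtain ⟨w, h1, h2⟩ := hword z
      rw [MonoidHom.mem_ker] at hz
      rw [hloop w (h2.symm.trans hz)] at h1
      exact (QuotientGroup.eq_one_iff _).mp h1
    · refine Subgroup.normalClosure_le_normal ?_
      rintro _ (⟨a, rfl⟩ | ⟨r, hr, rfl⟩)
      · simp [MonoidHom.mem_ker, S.rep_inv]
      · exact (hlift r).trans hr.2.2

end SymGen


/-! ## Extending a 2-complex by an edge -/

/-- Conditions on consecutive sides become conditions on a cyclic list, which may be cut and rotated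
freely. -/
theorem Cycle.chain_of_forall_finRotate {α : Type*} {R : α → α → Prop} {l : List α}
    (h : ∀ k : Fin l.length, R (l.get k) (l.get (finRotate _ k))) : Cycle.Chain R (l : Cycle α) := by
  rcases l with _ | ⟨a, t⟩
  · exact Cycle.Chain.nil R
  rw [Cycle.chain_coe_cons, List.isChain_iff_getElem]
  intro i hi
  simp only [List.length_cons, List.length_append, List.length_nil] at hi
  have hi' : i < (a :: t).length := by simp only [List.length_cons]; omega
  have := h ⟨i, hi'⟩
  rcases Nat.lt_or_ge (i + 1) (a :: t).length with h1 | h1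
  · rw [TwoComplex.finRotate_mk_of_lt h1] at this
    simp only [← List.cons_append]
    rw [List.getElem_append_left hi', List.getElem_append_left h1]
    exact this
  · rw [TwoComplex.finRotate_mk_of_ge hi' h1] at this
    simp only [← List.cons_append]
    rw [List.getElem_append_left hi', List.getElem_append_right h1]
    simpa using this

/-- In a cyclic chain, an element may be replaced by a chain with compatible ends. -/
theorem Cycle.chain_replace {α : Type*} {R : α → α → Prop} {x : α} {s t : List α}
    (h : Cycle.Chain R ((x :: t : List α) : Cycle α)) (hs : s.IsChain R) (hne : s ≠ [])
    (hl : ∀ y, R x y → ∀ z ∈ s.getLast?, R z y) (hf : ∀ y, R y x → ∀ z ∈ s.head?, R y z) :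
    Cycle.Chain R ((s ++ t : List α) : Cycle α) := by
  obtain ⟨a, s', rfl⟩ := List.exists_cons_of_ne_nil hne
  rw [Cycle.chain_coe_cons] at h
  rw [List.cons_append, Cycle.chain_coe_cons, List.append_assoc, ← List.cons_append,
    List.isChain_append]
  have h2 : (t ++ [x]).IsChain R := h.tail
  rw [List.isChain_append] at h2
  refine ⟨hs, ?_, ?_⟩
  · rw [List.isChain_append]
    refine ⟨h2.1, by simp, ?_⟩
    intro y hy z hz
    simp only [List.head?_cons, Option.mem_def, Option.some.injEq] at hz
    subst hz
    exact hf y (h2.2.2 y hy x (by simp)) _ (by simp)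
  · intro z hz y hy
    rcases t with _ | ⟨b, t⟩
    · simp only [List.nil_append, List.head?_cons, Option.mem_def, Option.some.injEq] at hy
      subst hy
      refine hf z (hl x ?_ z hz) _ (by simp)
      simpa using h
    · simp only [List.cons_append, List.head?_cons, Option.mem_def, Option.some.injEq] at hy
      subst hy
      refine hl _ ?_ z hz
      simp only [List.cons_append, List.isChain_cons_cons] at h
      exact h.1

/-! ### The extended graph and the extended complex -/

namespace SerreGraph

/-- Map the vertices by `i` and add an edge from `a` to `b`. -/
def addEdge (Γ : SerreGraph.{0, 0}) {V' : Type} (i : Γ.V → V') (a b : V') : SerreGraph.{0, 0} where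
  V := V'
  D := Γ.D ⊕ Bool
  inv := Sum.map Γ.inv not
  src := Sum.elim (fun d => i (Γ.src d)) (fun c => cond c b a)
  inv_inv d := by rcases d with d | c <;> simp [Γ.inv_inv]
  inv_ne d := by rcases d with d | c <;> simp [Γ.inv_ne]

theorem IsPath.addEdge {Γ : SerreGraph.{0, 0}} {V' : Type} (i : Γ.V → V') (a b : V') {u v : Γ.V}
    {p : List Γ.D} (h : Γ.IsPath u p v) : (Γ.addEdge i a b).IsPath (i u) (p.map Sum.inl) (i v) := by
  induction p generalizing u with
  | nil => exact congrArg i h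
  | cons d p ih => exact ⟨congrArg i h.1, ih h.2⟩

end SerreGraph

namespace TwoComplex

/-- Data for extending a 2-complex by an edge from `a` to `b` and some 2-cells. -/
structure Extension (Y : TwoComplex.{0, 0, 0}) where
  V' : Type
  i : Y.V → V'
  a : V'
  b : V'
  Φ : Type
  r : Φ → List (Y.D ⊕ Bool)
  r_ne : ∀ φ, r φ ≠ []
  r_isPath : ∀ φ, ∃ v, (Y.toSerreGraph.addEdge i a b).IsPath v (r φ) v

namespace Extension

variable {Y : TwoComplex.{0, 0, 0}} (E : Y.Extension)

/-- The extended complex. -/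
def complex : TwoComplex.{0, 0, 0} where
  toSerreGraph := Y.toSerreGraph.addEdge E.i E.a E.b
  F := Y.F ⊕ E.Φ
  len := Sum.elim Y.len (fun φ => (E.r φ).length)
  len_pos f := by
    rcases f with f | φ
    · exact Y.len_pos f
    · exact List.length_pos_iff.mpr (E.r_ne φ)
  side := fun
    | .inl f => fun k => Sum.inl (Y.side f k)
    | .inr φ => fun k => (E.r φ).get k
  side_closed f k := by
    rcases f with f | φ
    · exact congrArg E.i (Y.side_closed f k)
    · obtain ⟨v, hv⟩ := E.r_isPath φ
      have : (Y.toSerreGraph.addEdge E.i E.a E.b).IsPath v (List.ofFn (E.r φ).get) v := by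
        exact (List.ofFn_get (E.r φ)).symm ▸ hv
      exact SerreGraph.tgt_eq_src_of_isPath this k

/-- The vertices of the complex, in the extended complex. -/
def vtx (v : Y.V) : E.complex.V := E.i v

/-- The edges of the complex, in the extended complex. -/
def edg (d : Y.D) : E.complex.D := Sum.inl d

/-- The 2-cells of the complex, in the extended complex. -/
def fac (f : Y.F) : E.complex.F := Sum.inl f

/-- The new edge and its inverse. -/
def new (c : Bool) : E.complex.D := Sum.inr c

/-- The new 2-cells. -/
def cell (φ : E.Φ) : E.complex.F := Sum.inr φ

/-- The boundary circuits of the new 2-cells. -/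
def rel (φ : E.Φ) : List E.complex.D := E.r φ

/-- The initial vertex of the new edge. -/
def start : E.complex.V := E.a

/-- The terminal vertex of the new edge. -/
def finish : E.complex.V := E.b

theorem inv_edg (d : Y.D) : E.complex.inv (E.edg d) = E.edg (Y.inv d) := rfl
theorem src_edg (d : Y.D) : E.complex.src (E.edg d) = E.vtx (Y.src d) := rfl
theorem tgt_edg (d : Y.D) : E.complex.tgt (E.edg d) = E.vtx (Y.tgt d) := rfl
theorem inv_new (c : Bool) : E.complex.inv (E.new c) = E.new !c := rfl
theorem src_new_false : E.complex.src (E.new false) = E.start := rfl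
theorem tgt_new_false : E.complex.tgt (E.new false) = E.finish := rfl

theorem edg_injective : Function.Injective E.edg := Sum.inl_injective

theorem edg_or_new (e : E.complex.D) : (∃ d, e = E.edg d) ∨ ∃ c, e = E.new c := by
  rcases e with d | c
  · exact Or.inl ⟨d, rfl⟩
  · exact Or.inr ⟨c, rfl⟩

theorem isPath_edg {u v : Y.V} {p : List Y.D} (h : Y.IsPath u p v) :
    E.complex.IsPath (E.vtx u) (p.map E.edg) (E.vtx v) :=
  h.addEdge E.i E.a E.b

/-- The inclusion. -/
def incl : Y.Space → E.complex.Space :=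
  Quot.lift
    (fun
      | .inl ⟨v, _⟩ => vertexPt (E.vtx v)
      | .inr (.inl ⟨d, t⟩) => edgePt (E.edg d) t
      | .inr (.inr ⟨f, z⟩) => facePt (E.fac f) z)
    (by
      intro x y h
      cases h with
      | src d => exact edgePt_zero (E.edg d)
      | flip d t => exact edgePt_flip (E.edg d) t
      | arc f k t => exact facePt_arc (E.fac f) k t)

theorem incl_vertexPt (v : Y.V) : E.incl (vertexPt v) = vertexPt (E.vtx v) := rfl

theorem incl_edgePt (d : Y.D) (t : unitInterval) :
    E.incl (edgePt d t) = edgePt (E.edg d) t := rfl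

theorem incl_facePt (f : Y.F) (z : Metric.closedBall (0 : ℂ) 1) :
    E.incl (facePt f z) = facePt (E.fac f) z := rfl

theorem continuous_incl : Continuous E.incl := by
  refine continuous_coinduced_dom.mpr (continuous_sum_dom.mpr ⟨continuous_sigma fun v => ?_,
    continuous_sum_dom.mpr ⟨continuous_sigma fun d => ?_, continuous_sigma fun f => ?_⟩⟩)
  · exact continuous_const
  · exact continuous_edgePt (E.edg d)
  · exact continuous_facePt (E.fac f)

theorem incl_mem_skel1 {p : Y.Space} (h : p ∈ Y.skel1) : E.incl p ∈ E.complex.skel1 := by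
  rcases h with ⟨v, rfl⟩ | ⟨d, t, rfl⟩
  · exact Or.inl ⟨E.vtx v, rfl⟩
  · exact Or.inr ⟨E.edg d, t, rfl⟩

theorem edgeDist_edg {y : Y.V} (h : ∀ v, E.complex.dist (E.vtx y) (E.vtx v) = Y.dist y v) (d : Y.D) :
    edgeDist (E.vtx y) (E.edg d) = edgeDist y d := by
  rw [edgeDist, edgeDist, src_edg, tgt_edg, h, h]

/-- Levels of edges and 2-cells are computed from their vertices, so it is enough that the new edge
creates no shortcut. -/
theorem coarseDist_incl {y : Y.V} (h : ∀ v, E.complex.dist (E.vtx y) (E.vtx v) = Y.dist y v)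
    (p : Y.Space) : coarseDist (E.vtx y) (E.incl p) = coarseDist y p := by
  obtain ⟨c, hc⟩ := exists_mem_openCell p
  rw [coarseDist_eq y hc]
  cases c with
  | vertex v =>
    obtain rfl : p = vertexPt v := hc
    rw [E.incl_vertexPt, coarseDist_vertexPt, h]
    rfl
  | edge d =>
    obtain ⟨t, h0, h1, rfl⟩ := hc
    rw [E.incl_edgePt, coarseDist_edgePt _ _ h0.ne' h1.ne, E.edgeDist_edg h]
    rfl
  | face f =>
    obtain ⟨z, hz, rfl⟩ := hc
    rw [E.incl_facePt, coarseDist_facePt _ _ hz, cellDist, cellDist]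
    congr 1
    exact Finset.sup'_congr _ rfl fun k _ => E.edgeDist_edg h _

end Extension

/-! ### Planarity under extension -/

/-- The complex with boundary circuit `l` is a disc diagram in the plane: together with an outer polygon
attached along the inverse of `l` it is a sphere. -/
structure PlanarDisc (Y : TwoComplex.{0, 0, 0}) (l : List Y.D) : Prop where
  finite_V : Finite Y.V
  finite_D : Finite Y.D
  finite_F : Finite Y.F
  surj : ∀ d, (∃ f k, Y.side f k = d) ∨ Y.inv d ∈ l
  card : Nat.card (Σ f, Fin (Y.len f)) + l.length = Nat.card Y.D
  -- Quantifying over equivalence relations replaces the generated relation: in an extension, a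
  -- relation only has to be restricted to the old edges. The cyclic chain form does not depend on
  -- the starting point of the boundary.
  link : ∀ E : Y.D → Y.D → Prop, Equivalence E →
    (∀ f k, E (Y.inv (Y.side f k)) (Y.side f (finRotate _ k))) →
    Cycle.Chain (fun d d' => E (Y.inv d) d') (l : Cycle Y.D) →
    ∀ d d', Y.src d = Y.src d' → E d d'
  euler : 2 * (Nat.card Y.V + Nat.card Y.F) = Nat.card Y.D + 2
  nil : l = [] → IsEmpty Y.D

theorem card_extension_sides {Y : TwoComplex.{0, 0, 0}} [Finite Y.F] (E : Y.Extension) [Finite E.Φ] :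
    Nat.card (Σ f, Fin (E.complex.len f)) =
      Nat.card (Σ f, Fin (Y.len f)) + Nat.card (Σ φ, Fin (E.rel φ).length) := by
  rw [← Nat.card_sum]
  exact Nat.card_congr (Equiv.sumSigmaDistrib (α := Y.F) (β := E.Φ) (fun f => Fin (E.complex.len f)))

/-- The Euler count gains one vertex and two directed edges. Around `m` the new edge is inserted
between two consecutive boundary edges, so the link there remains one cycle, and the link of the new
vertex is a single edge. -/
theorem PlanarDisc.spur {Y : TwoComplex.{0, 0, 0}} {u v : List Y.D} (h : Y.PlanarDisc (u ++ v))
    {y m : Y.V} (hu : Y.IsPath y u m) (hv : Y.IsPath m v y) (E : Y.Extension)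
    (hV : E.V' = Option Y.V) (hi : Function.Injective E.vtx) (ha : E.start = E.vtx m)
    (hb : ∀ v, E.vtx v ≠ E.finish) [hΦ : IsEmpty E.Φ] :
    E.complex.PlanarDisc (u.map E.edg ++ [E.new false, E.new true] ++ v.map E.edg) := by
  have := h.finite_V
  have := h.finite_D
  have := h.finite_F
  have fV : Finite E.V' := by rw [hV]; infer_instance
  refine ⟨fV, inferInstanceAs (Finite (Y.D ⊕ Bool)), inferInstanceAs (Finite (Y.F ⊕ E.Φ)), ?_, ?_, ?_,
    ?_, by simp⟩
  · intro e
    rcases E.edg_or_new e with ⟨d, rfl⟩ | ⟨c, rfl⟩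
    · rcases h.surj d with ⟨f, k, rfl⟩ | hd
      · exact Or.inl ⟨E.fac f, k, rfl⟩
      · right
        have h1 : E.complex.inv (E.edg d) = E.edg (Y.inv d) := rfl
        rw [h1]
        rcases List.mem_append.mp hd with hd | hd <;> simp [E.edg_injective.eq_iff, hd]
    · right
      have h1 : E.complex.inv (E.new c) = E.new (!c) := rfl
      rw [h1]
      cases c <;> simp
  · have h1 := h.card
    have h2 : Nat.card E.complex.D = Nat.card Y.D + 2 := by
      rw [show E.complex.D = (Y.D ⊕ Bool) from rfl, Nat.card_sum]
      simp
    rw [card_extension_sides, h2, ← h1]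
    simp only [Nat.card_of_isEmpty, List.length_append, List.length_map, List.length_cons,
      List.length_nil]
    omega
  · intro R hR hcor hch
    have hrot : ((u.map E.edg ++ [E.new false, E.new true] ++ v.map E.edg : List E.complex.D) :
        Cycle E.complex.D) = ((E.new false :: E.new true :: (v ++ u).map E.edg :
          List E.complex.D) : Cycle E.complex.D) := by
      rw [Cycle.coe_eq_coe, List.append_assoc]
      refine List.isRotated_append.trans ?_
      rw [List.map_append]
      exact List.IsRotated.refl _
    rw [hrot, Cycle.chain_coe_cons, List.cons_append] at hch
    have hch' := List.isChain_cons_cons.mp hch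
    -- The two corners of the outer polygon on either side of the new edge combine, by transitivity
    -- through `new false`, to the old corner at `m`.
    have hold : ∀ d d', Y.src d = Y.src d' → R (E.edg d) (E.edg d') := by
      refine h.link (fun d d' => R (E.edg d) (E.edg d')) ⟨fun _ => hR.refl _,
        fun h => hR.symm h, fun h h' => hR.trans h h'⟩ (fun f k => hcor (E.fac f) k) ?_
      rw [show ((u ++ v : List Y.D) : Cycle Y.D) = ((v ++ u : List Y.D) : Cycle Y.D) from
        Cycle.coe_eq_coe.mpr List.isRotated_append]
      generalize v ++ u = t at hch'
      rcases t with _ | ⟨t1, t⟩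
      · exact Cycle.Chain.nil _
      rw [Cycle.chain_coe_cons]
      obtain ⟨_, h2⟩ := hch'
      simp only [List.map_cons, List.cons_append, List.isChain_cons_cons] at h2
      obtain ⟨h3, h4⟩ := h2
      rw [← List.cons_append, List.isChain_append] at h4 ⊢
      refine ⟨?_, by simp, ?_⟩
      · have := h4.1
        rw [← List.map_cons, List.isChain_map] at this
        exact this
      · intro d hd d' hd'
        simp only [List.head?_cons, Option.mem_def, Option.some.injEq] at hd'
        subst hd'
        have h5 := h4.2.2 (E.edg d) (by
          rw [← List.map_cons, List.getLast?_map, Option.mem_def.mp hd]; rfl) (E.new false) (by simp)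
        exact hR.trans h5 h3
    have hnew : ∀ d, E.vtx m = E.vtx (Y.src d) → R (E.new false) (E.edg d) := by
      intro d hd
      have hpath : Y.IsPath m (v ++ u) m := hv.append hu
      -- If the old boundary is empty, the field `nil` says that there are no old edges to compare
      -- with.
      obtain ⟨t1, t, ht⟩ : ∃ t1 t, v ++ u = t1 :: t := by
        refine List.exists_cons_of_ne_nil fun h0 => ?_
        have hnil : u ++ v = [] := by
          rw [List.append_eq_nil_iff] at h0 ⊢
          exact h0.symm
        exact (h.nil hnil).false d
      rw [ht] at hpath hch'
      have h3 : R (E.new false) (E.edg t1) := by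
        have h2 := hch'.2
        simp only [List.map_cons, List.cons_append, List.isChain_cons_cons] at h2
        exact h2.1
      exact hR.trans h3 (hold _ _ (hpath.1.trans (hi hd)))
    intro e e' hs
    rcases E.edg_or_new e with ⟨d, rfl⟩ | ⟨c, rfl⟩ <;>
      rcases E.edg_or_new e' with ⟨d', rfl⟩ | ⟨c', rfl⟩
    · exact hold _ _ (hi hs)
    · cases c'
      · exact hR.symm (hnew d (ha.symm.trans hs.symm))
      · exact absurd hs (hb _)
    · cases c
      · exact hnew d' (ha.symm.trans hs)
      · exact absurd hs.symm (hb _)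
    · cases c <;> cases c'
      · exact hR.refl _
      · exact absurd (ha.symm.trans hs) (hb _)
      · exact absurd (ha.symm.trans hs.symm) (hb _)
      · exact hR.refl _
  · have h2 : Nat.card E.complex.D = Nat.card Y.D + 2 := by
      rw [show E.complex.D = (Y.D ⊕ Bool) from rfl, Nat.card_sum]
      simp
    have h3 : Nat.card E.complex.V = Nat.card Y.V + 1 := by
      rw [show E.complex.V = E.V' from rfl, hV]
      exact Finite.card_option
    have h4 : Nat.card E.complex.F = Nat.card Y.F := by
      rw [show E.complex.F = (Y.F ⊕ E.Φ) from rfl, Nat.card_sum]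
      simp
    have := h.euler
    omega

/-- The Euler count gains one 2-cell and two directed edges. The path `s` leaves the boundary, but
its corners on the outer side become corners of the new 2-cell. -/
theorem PlanarDisc.attach {Y : TwoComplex.{0, 0, 0}} {u s v : List Y.D}
    (h : Y.PlanarDisc (u ++ s ++ v)) (hs : s ≠ []) {p q : Y.V} (hpath : Y.IsPath p s q)
    (E : Y.Extension) (hV : Nat.card E.V' = Nat.card Y.V) [fV : Finite E.V']
    (hi : Function.Injective E.vtx)
    (ha : E.start = E.vtx p) (hb : E.finish = E.vtx q) [hΦ : Unique E.Φ]
    (hr : E.rel default = E.new false :: (s.map fun d => E.edg (Y.inv d)).reverse) :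
    E.complex.PlanarDisc (u.map E.edg ++ [E.new false] ++ v.map E.edg) := by
  have := h.finite_V
  have := h.finite_D
  have := h.finite_F
  have hside : ∀ e ∈ E.rel default, ∃ f k, E.complex.side f k = e := by
    intro e he
    obtain ⟨k, hk⟩ := List.mem_iff_get.mp he
    exact ⟨E.cell default, k, hk⟩
  have hD : Nat.card E.complex.D = Nat.card Y.D + 2 := by
    rw [show E.complex.D = (Y.D ⊕ Bool) from rfl, Nat.card_sum]
    simp
  refine ⟨fV, inferInstanceAs (Finite (Y.D ⊕ Bool)), inferInstanceAs (Finite (Y.F ⊕ E.Φ)), ?_, ?_, ?_,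
    ?_, by simp⟩
  · intro e
    rcases E.edg_or_new e with ⟨d, rfl⟩ | ⟨c, rfl⟩
    · rcases h.surj d with ⟨f, k, rfl⟩ | hd
      · exact Or.inl ⟨E.fac f, k, rfl⟩
      · have h1 : E.complex.inv (E.edg d) = E.edg (Y.inv d) := rfl
        rw [h1]
        rw [List.mem_append, List.mem_append] at hd
        rcases hd with (hd | hd) | hd
        · right; simp [E.edg_injective.eq_iff, hd]
        · left
          apply hside
          rw [hr]
          refine List.mem_cons_of_mem _ (List.mem_reverse.mpr (List.mem_map.mpr ⟨_, hd, ?_⟩))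
          rw [Y.inv_inv]
        · right; simp [E.edg_injective.eq_iff, hd]
    · have h1 : E.complex.inv (E.new c) = E.new (!c) := rfl
      rw [h1]
      cases c
      · left
        apply hside
        rw [hr]
        exact List.mem_cons_self
      · right; simp
  · have h1 := h.card
    rw [card_extension_sides, hD, ← h1]
    have h2 : Nat.card (Σ φ, Fin (E.rel φ).length) = s.length + 1 := by
      rw [Nat.card_congr (Equiv.uniqueSigma (fun φ => Fin (E.rel φ).length)), hr]
      simp
    rw [h2]
    simp only [List.length_append, List.length_map, List.length_cons,
      List.length_nil]
    omega
  · intro R hR hcor hch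
    have hrot : ((u.map E.edg ++ [E.new false] ++ v.map E.edg : List E.complex.D) :
        Cycle E.complex.D) = ((E.new false :: (v ++ u).map E.edg :
          List E.complex.D) : Cycle E.complex.D) := by
      rw [Cycle.coe_eq_coe, List.append_assoc]
      refine List.isRotated_append.trans ?_
      rw [List.map_append]
      exact List.IsRotated.refl _
    rw [hrot] at hch
    have hcor' : Cycle.Chain (fun d d' => R (E.complex.inv d) d')
        ((E.rel default : List E.complex.D) : Cycle E.complex.D) :=
      Cycle.chain_of_forall_finRotate fun k => hcor (E.cell default) k
    rw [hr, Cycle.chain_coe_cons, ← List.cons_append, List.isChain_append] at hcor'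
    obtain ⟨hc1, -, hc2⟩ := hcor'
    obtain ⟨hc3, hc4⟩ := List.isChain_cons.mp hc1
    have hchain : (s.map E.edg : List E.complex.D).IsChain (fun d d' => R (E.complex.inv d) d') := by
      rw [List.isChain_reverse, List.isChain_map] at hc4
      rw [List.isChain_map]
      refine hc4.imp fun d d' hdd => ?_
      have hdd' : R (E.edg (Y.inv (Y.inv d'))) (E.edg (Y.inv d)) := hdd
      rw [Y.inv_inv] at hdd'
      exact hR.symm hdd'
    have hlast : ∀ z ∈ s.getLast?, R (E.new true) (E.edg (Y.inv z)) := by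
      intro z hz
      exact hc3 (E.edg (Y.inv z)) (by
        rw [List.head?_reverse, List.getLast?_map, Option.mem_def.mp hz]; rfl)
    have hfirst : ∀ z ∈ s.head?, R (E.edg z) (E.new false) := by
      intro z hz
      have h1 := hc2 (E.edg (Y.inv z)) (by
        obtain ⟨s1, s', rfl⟩ := List.exists_cons_of_ne_nil hs
        simp only [List.head?_cons, Option.mem_def, Option.some.injEq] at hz
        subst hz
        rw [List.map_cons, List.reverse_cons, ← List.cons_append, List.getLast?_append]
        rfl) (E.new false) (by simp)
      have h2 : R (E.edg (Y.inv (Y.inv z))) (E.new false) := h1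
      rwa [Y.inv_inv] at h2
    -- The old boundary condition is recovered by putting `s` back in place of the new edge. The end
    -- corners of the new 2-cell identify `new false` with the first edge of `s`, and `new true`
    -- with the inverse of its last.
    have hch' := Cycle.chain_replace hch hchain (by simpa using hs)
      (by
        intro d hd z hz
        rw [List.getLast?_map] at hz
        obtain ⟨z', hz', rfl⟩ := Option.mem_map.mp hz
        exact hR.trans (hR.symm (hlast z' hz')) hd)
      (by
        intro d hd z hz
        rw [List.head?_map] at hz
        obtain ⟨z', hz', rfl⟩ := Option.mem_map.mp hz
        exact hR.trans hd (hR.symm (hfirst z' hz')))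
    have hold : ∀ d d', Y.src d = Y.src d' → R (E.edg d) (E.edg d') := by
      refine h.link (fun d d' => R (E.edg d) (E.edg d')) ⟨fun _ => hR.refl _,
        fun h => hR.symm h, fun h h' => hR.trans h h'⟩ (fun f k => hcor (E.fac f) k) ?_
      rw [show ((u ++ s ++ v : List Y.D) : Cycle Y.D) = ((s ++ (v ++ u) : List Y.D) : Cycle Y.D) from
        Cycle.coe_eq_coe.mpr (by
          rw [List.append_assoc]
          refine List.isRotated_append.trans ?_
          rw [List.append_assoc])]
      rw [← List.map_append, ← Cycle.map_coe, Cycle.chain_map] at hch'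
      exact hch'
    -- Every directed edge is linked to an old one with the same initial vertex, which reduces the
    -- link condition to the old complex.
    have hdiv : ∀ e : E.complex.D, ∃ d, E.complex.src e = E.vtx (Y.src d) ∧ R e (E.edg d) := by
      intro e
      rcases E.edg_or_new e with ⟨d, rfl⟩ | ⟨c, rfl⟩
      · exact ⟨d, rfl, hR.refl _⟩
      cases c
      · obtain ⟨s1, s', rfl⟩ := List.exists_cons_of_ne_nil hs
        exact ⟨s1, by rw [hpath.1]; exact ha, hR.symm (hfirst s1 (by simp))⟩
      · obtain ⟨s', s1, rfl⟩ := List.eq_nil_or_concat s |>.resolve_left hs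
        rw [List.concat_eq_append] at hpath
        obtain ⟨_, _, h2⟩ := SerreGraph.isPath_append.mp hpath
        refine ⟨Y.inv s1, ?_, hlast s1 (by simp)⟩
        have h3 : Y.src (Y.inv s1) = q := h2.2
        rw [h3]
        exact hb
    intro d d' hdd
    obtain ⟨e, he, he'⟩ := hdiv d
    obtain ⟨e', hf, hf'⟩ := hdiv d'
    exact hR.trans he' (hR.trans (hold _ _ (hi (he.symm.trans (hdd.trans hf)))) (hR.symm hf'))
  · have h4 : Nat.card E.complex.F = Nat.card Y.F + 1 := by
      rw [show E.complex.F = (Y.F ⊕ E.Φ) from rfl, Nat.card_sum]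
      simp
    have h3 : Nat.card E.complex.V = Nat.card Y.V := hV
    have := h.euler
    omega

end TwoComplex


/-! ## Combings of the 1-skeleton -/

open unitInterval

/-- A map of the boundary of the square to the circle extends to a map of the square to the disc that
takes the interior to the interior. -/
theorem exists_squareMap {b₀ b₁ l r : I → ℂ} (hb₀ : Continuous b₀) (hb₁ : Continuous b₁)
    (hl : Continuous l) (hr : Continuous r) (nb₀ : ∀ t, ‖b₀ t‖ = 1) (nb₁ : ∀ t, ‖b₁ t‖ = 1)
    (nl : ∀ t, ‖l t‖ = 1) (nr : ∀ t, ‖r t‖ = 1) (h00 : b₀ 0 = l 0) (h10 : b₀ 1 = r 0)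
    (h01 : b₁ 0 = l 1) (h11 : b₁ 1 = r 1) :
    ∃ Θ : I × I → Metric.closedBall (0 : ℂ) 1, Continuous Θ ∧ (∀ τ, (Θ (τ, 0) : ℂ) = b₀ τ) ∧
      (∀ τ, (Θ (τ, 1) : ℂ) = b₁ τ) ∧ (∀ t, (Θ (0, t) : ℂ) = l t) ∧ (∀ t, (Θ (1, t) : ℂ) = r t) ∧
      ∀ τ t : I, τ ≠ 0 → τ ≠ 1 → t ≠ 0 → t ≠ 1 → ‖(Θ (τ, t) : ℂ)‖ < 1 := by
  -- Coons interpolation: the sum of the two linear interpolations between opposite sides, minus the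
  -- bilinear interpolation of the corner values. It agrees with the given maps on the boundary but
  -- may leave the disc.
  let F : I × I → ℂ := fun x => ((1 - x.2 : ℝ) : ℂ) * b₀ x.1 + ((x.2 : ℝ) : ℂ) * b₁ x.1 +
    ((1 - x.1 : ℝ) : ℂ) * l x.2 + ((x.1 : ℝ) : ℂ) * r x.2 -
    (((1 - x.1 : ℝ) : ℂ) * ((1 - x.2 : ℝ) : ℂ) * b₀ 0 + ((x.1 : ℝ) : ℂ) * ((1 - x.2 : ℝ) : ℂ) * b₀ 1 +
      ((1 - x.1 : ℝ) : ℂ) * ((x.2 : ℝ) : ℂ) * b₁ 0 + ((x.1 : ℝ) : ℂ) * ((x.2 : ℝ) : ℂ) * b₁ 1)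
  have hF : Continuous F := by fun_prop
  -- The factor `c / max 1 ‖F‖` brings the values back to the disc. Since `c` is 1 exactly on the
  -- boundary of the square, the boundary values are kept and the interior is pushed off the circle.
  let c : I × I → ℝ := fun x => 1 - x.1 * (1 - x.1) * (x.2 * (1 - x.2))
  have hc : Continuous c := by fun_prop
  have hc0 : ∀ x, 0 ≤ c x := by
    rintro ⟨⟨a, ha0, ha1⟩, ⟨b, hb0, hb1⟩⟩
    change 0 ≤ 1 - a * (1 - a) * (b * (1 - b))
    have h1 : a * (1 - a) ≤ 1 := by nlinarith
    have h2 : b * (1 - b) ≤ 1 := by nlinarith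
    have h3 : 0 ≤ a * (1 - a) := mul_nonneg ha0 (by linarith)
    have h4 : 0 ≤ b * (1 - b) := mul_nonneg hb0 (by linarith)
    nlinarith
  have hc1 : ∀ x, c x ≤ 1 := by
    rintro ⟨⟨a, ha0, ha1⟩, ⟨b, hb0, hb1⟩⟩
    change 1 - a * (1 - a) * (b * (1 - b)) ≤ 1
    have h3 : 0 ≤ a * (1 - a) := mul_nonneg ha0 (by linarith)
    have h4 : 0 ≤ b * (1 - b) := mul_nonneg hb0 (by linarith)
    nlinarith [mul_nonneg h3 h4]
  have hnorm : ∀ x, ‖((c x / max 1 ‖F x‖ : ℝ) : ℂ) * F x‖ ≤ c x := by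
    intro x
    have hm : 0 < max 1 ‖F x‖ := lt_max_of_lt_left one_pos
    rw [norm_mul, Complex.norm_real, Real.norm_of_nonneg (div_nonneg (hc0 x) hm.le), div_mul_eq_mul_div,
      div_le_iff₀ hm]
    exact mul_le_mul_of_nonneg_left (le_max_right _ _) (hc0 x)
  have hval : ∀ x z, F x = z → ‖z‖ = 1 → c x = 1 → ((c x / max 1 ‖F x‖ : ℝ) : ℂ) * F x = z := by
    intro x z h1 h2 h3
    rw [h1, h2, h3]
    simp
  refine ⟨fun x => ⟨((c x / max 1 ‖F x‖ : ℝ) : ℂ) * F x, mem_closedBall_zero_iff.mpr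
    ((hnorm x).trans (hc1 x))⟩, ?_, ?_, ?_, ?_, ?_, ?_⟩
  · refine Continuous.subtype_mk (Continuous.mul ?_ hF) _
    refine Complex.continuous_ofReal.comp (hc.div (continuous_const.max hF.norm) fun x => ?_)
    exact (lt_max_of_lt_left one_pos).ne'
  · intro τ
    refine hval _ _ ?_ (nb₀ τ) (by simp [c])
    simp only [F, ← h00, ← h10]
    push_cast
    simp
  · intro τ
    refine hval _ _ ?_ (nb₁ τ) (by simp [c])
    simp only [F, ← h01, ← h11]
    push_cast
    simp
  · intro t
    refine hval _ _ ?_ (nl t) (by simp [c])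
    simp only [F]
    push_cast
    simp
  · intro t
    refine hval _ _ ?_ (nr t) (by simp [c])
    simp only [F]
    push_cast
    simp
  · intro τ t h0 h1 h2 h3
    refine (hnorm (τ, t)).trans_lt ?_
    have a0 := unitInterval.pos_iff_ne_zero.mpr h0
    have a1 := unitInterval.lt_one_iff_ne_one.mpr h1
    have b0 := unitInterval.pos_iff_ne_zero.mpr h2
    have b1 := unitInterval.lt_one_iff_ne_one.mpr h3
    have a0' : (0 : ℝ) < τ := a0
    have a1' : (τ : ℝ) < 1 := a1
    have b0' : (0 : ℝ) < t := b0
    have b1' : (t : ℝ) < 1 := b1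
    change 1 - (τ : ℝ) * (1 - τ) * (t * (1 - t)) < 1
    have := mul_pos (mul_pos a0' (sub_pos.mpr a1')) (mul_pos b0' (sub_pos.mpr b1'))
    linarith

/-- Concatenation of the maps `e d`, where `d` runs through a list. -/
noncomputable def pathGlue {D T : Type*} (e : D → I → T) (z : T) : List D → ℝ → T
  | [], _ => z
  | d :: s, p => if p ≤ 1 then e d (Set.projIcc 0 1 zero_le_one p) else pathGlue e z s (p - 1)

/-- The index and the parameter depend only on `p`, not on the maps glued. For a combing they are
therefore the same at all times. -/
theorem pathGlue_cases {D : Type*} {s : List D} (hs : s ≠ []) {p : ℝ} (h0 : 0 ≤ p)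
    (h1 : p ≤ s.length) : ∃ (i : ℕ) (hi : i < s.length) (τ : I), p = i + τ ∧
      ∀ {T : Type} (e : D → I → T) (z : T), pathGlue e z s p = e s[i] τ := by
  induction s generalizing p with
  | nil => exact absurd rfl hs
  | cons d s ih =>
    by_cases hp : p ≤ 1
    · refine ⟨0, by simp, ⟨p, h0, hp⟩, by simp, fun e z => ?_⟩
      rw [pathGlue, if_pos hp, Set.projIcc_of_mem zero_le_one ⟨h0, hp⟩]
      rfl
    · have hne : s ≠ [] := by
        rintro rfl
        simp at h1
        exact hp h1
      obtain ⟨i, hi, τ, h2, h3⟩ := ih hne (p := p - 1) (by linarith)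
        (by simp only [List.length_cons] at h1; push_cast at h1; linarith)
      refine ⟨i + 1, by simpa using hi, τ, by push_cast; linarith, fun e z => ?_⟩
      rw [pathGlue, if_neg hp, h3]
      rfl

namespace TwoComplex

/-- A combing of the 1-skeleton from the base vertex, along which the coarse distance increases:
`vert v` is the path that ends at `v`, and `edge d τ` is the one that ends at `edgePt d τ`. -/
structure Combing (Y : TwoComplex.{0, 0, 0}) (y : Y.V) where
  vert : Y.V → I → Y.Space
  edge : Y.D → I → I → Y.Space
  continuous_vert : ∀ v, Continuous (vert v)
  continuous_edge : ∀ d, Continuous fun x : I × I => edge d x.1 x.2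
  edge_src : ∀ d t, edge d 0 t = vert (Y.src d) t
  edge_inv : ∀ d τ t, edge (Y.inv d) τ t = edge d (σ τ) t
  vert_zero : ∀ v, vert v 0 = vertexPt y
  edge_zero : ∀ d τ, edge d τ 0 = vertexPt y
  vert_one : ∀ v, vert v 1 = vertexPt v
  edge_one : ∀ d τ, edge d τ 1 = edgePt d τ
  vert_base : ∀ t, vert y t = vertexPt y
  vert_skel : ∀ v t, vert v t ∈ Y.skel1
  vert_mono : ∀ v, Monotone fun t => coarseDist y (vert v t)
  edge_mono : ∀ d τ, Monotone fun t => coarseDist y (edge d τ t)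

/-- The speed-up `t ↦ min (2t) 1`. -/
noncomputable def firstHalf (t : I) : I := Set.projIcc 0 1 zero_le_one (2 * t : ℝ)

/-- The delay `t ↦ max (2t - 1) 0`. -/
noncomputable def secondHalf (t : I) : I := Set.projIcc 0 1 zero_le_one (2 * t - 1 : ℝ)

theorem continuous_firstHalf : Continuous firstHalf :=
  continuous_projIcc.comp (by fun_prop)

theorem continuous_secondHalf : Continuous secondHalf :=
  continuous_projIcc.comp (by fun_prop)

theorem monotone_firstHalf : Monotone firstHalf := fun s t h =>
  Set.monotone_projIcc _ (by have : (s : ℝ) ≤ t := h; linarith)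

theorem monotone_secondHalf : Monotone secondHalf := fun s t h =>
  Set.monotone_projIcc _ (by have : (s : ℝ) ≤ t := h; linarith)

theorem firstHalf_zero : firstHalf 0 = 0 := Set.projIcc_of_le_left _ (by simp)

theorem firstHalf_of_ge {t : I} (h : 1 / 2 ≤ (t : ℝ)) : firstHalf t = 1 :=
  Set.projIcc_of_right_le _ (by linarith)

theorem secondHalf_of_le {t : I} (h : (t : ℝ) ≤ 1 / 2) : secondHalf t = 0 :=
  Set.projIcc_of_le_left _ (by linarith)

theorem coe_secondHalf {t : I} (h : 1 / 2 ≤ (t : ℝ)) : (secondHalf t : ℝ) = 2 * t - 1 := by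
  rw [secondHalf, Set.projIcc_of_mem zero_le_one ⟨by linarith, by linarith [t.2.2]⟩]

theorem secondHalf_one : secondHalf 1 = 1 := Set.projIcc_of_right_le _ (by norm_num)

namespace Combing

variable {Y : TwoComplex.{0, 0, 0}} {y : Y.V} (C : Y.Combing y)

theorem edge_tgt (d : Y.D) (t : I) : C.edge d 1 t = C.vert (Y.tgt d) t := by
  have := C.edge_inv d 0 t
  rw [unitInterval.symm_zero] at this
  rw [← this, C.edge_src]
  rfl

/-- The combing that stands still in the second half of the time. -/
noncomputable def rescale : Y.Combing y where
  vert v t := C.vert v (firstHalf t)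
  edge d τ t := C.edge d τ (firstHalf t)
  continuous_vert v := (C.continuous_vert v).comp continuous_firstHalf
  continuous_edge d := (C.continuous_edge d).comp
    (continuous_fst.prodMk (continuous_firstHalf.comp continuous_snd))
  edge_src d t := C.edge_src d _
  edge_inv d τ t := C.edge_inv d τ _
  vert_zero v := by rw [firstHalf_zero, C.vert_zero]
  edge_zero d τ := by rw [firstHalf_zero, C.edge_zero]
  vert_one v := by rw [firstHalf_of_ge (by norm_num), C.vert_one]
  edge_one d τ := by rw [firstHalf_of_ge (by norm_num), C.edge_one]
  vert_base t := C.vert_base _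
  vert_skel v t := C.vert_skel v _
  vert_mono v := (C.vert_mono v).comp monotone_firstHalf
  edge_mono d τ := (C.edge_mono d τ).comp monotone_firstHalf

theorem rescale_vert {t : I} (h : 1 / 2 ≤ (t : ℝ)) (v : Y.V) : C.rescale.vert v t = vertexPt v :=
  (congrArg (C.vert v) (firstHalf_of_ge h)).trans (C.vert_one v)

theorem rescale_edge {t : I} (h : 1 / 2 ≤ (t : ℝ)) (d : Y.D) (τ : I) :
    C.rescale.edge d τ t = edgePt d τ :=
  (congrArg (C.edge d τ) (firstHalf_of_ge h)).trans (C.edge_one d τ)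

/-- The combing along an edge path, at parameter `p`. -/
noncomputable def alongPath (v : Y.V) (s : List Y.D) (p : ℝ) (t : I) : Y.Space :=
  pathGlue (fun d τ => C.edge d τ t) (C.vert v t) s p

theorem alongPath_of_le {u v : Y.V} {s : List Y.D} (h : Y.IsPath u s v) {p : ℝ} (hp : p ≤ 0) (t : I) :
    C.alongPath v s p t = C.vert u t := by
  rcases s with _ | ⟨d, s⟩
  · obtain rfl : u = v := h
    rfl
  · rw [alongPath, pathGlue, if_pos (by linarith), Set.projIcc_of_le_left _ hp, ← h.1]
    exact C.edge_src d t

theorem alongPath_of_ge {u v : Y.V} {s : List Y.D} (h : Y.IsPath u s v) {p : ℝ}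
    (hp : (s.length : ℝ) ≤ p) (t : I) : C.alongPath v s p t = C.vert v t := by
  induction s generalizing u p with
  | nil => rfl
  | cons d s ih =>
    simp only [List.length_cons] at hp
    push_cast at hp
    rw [alongPath, pathGlue]
    split_ifs with h1
    · have hl : (s.length : ℝ) ≤ 0 := by linarith
      have hp1 : 1 ≤ p := by linarith [(Nat.cast_nonneg s.length : (0 : ℝ) ≤ s.length)]
      have hs : s = [] := List.length_eq_zero_iff.mp (by exact_mod_cast le_antisymm hl (Nat.cast_nonneg _))
      subst hs
      obtain ⟨-, h2⟩ := h
      have h2' : Y.tgt d = v := h2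
      rw [Set.projIcc_of_right_le _ hp1, ← h2']
      exact C.edge_tgt d t
    · exact ih h.2 (by linarith)

theorem continuous_alongPath {u v : Y.V} {s : List Y.D} (h : Y.IsPath u s v) :
    Continuous fun x : ℝ × I => C.alongPath v s x.1 x.2 := by
  induction s generalizing u with
  | nil => exact (C.continuous_vert v).comp continuous_snd
  | cons d s ih =>
    have h2 := ih h.2
    refine Continuous.if_le (f := fun x : ℝ × I => x.1) (g := fun _ => (1 : ℝ))
      (f' := fun x : ℝ × I => C.edge d (Set.projIcc 0 1 zero_le_one x.1) x.2)
      (g' := fun x : ℝ × I => C.alongPath v s (x.1 - 1) x.2) ?_ ?_ continuous_fst continuous_const ?_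
    · exact (C.continuous_edge d).comp
        (((continuous_projIcc (h := zero_le_one)).comp continuous_fst).prodMk continuous_snd)
    · exact h2.comp (f := fun x : ℝ × I => (x.1 - 1, x.2)) (by fun_prop)
    · intro x hx
      have hx' : x.1 = 1 := hx
      rw [C.alongPath_of_le h.2 (by linarith), hx', Set.projIcc_right]
      exact C.edge_tgt d _

/-- Each fibre of the combing along a path is a fibre of the combing over one edge or vertex, from
which monotonicity and the endpoint values are inherited. -/
theorem alongPath_cases {u v : Y.V} {s : List Y.D} (h : Y.IsPath u s v) {p : ℝ}
    (h0 : 0 ≤ p) (h1 : p ≤ s.length) :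
    (∀ t, C.alongPath v s p t = C.vert v t) ∨
      ∃ d ∈ s, ∃ τ, ∀ t, C.alongPath v s p t = C.edge d τ t := by
  by_cases hs : s = []
  · subst hs
    exact Or.inl fun t => rfl
  · obtain ⟨i, hi, τ, -, h3⟩ := pathGlue_cases hs h0 h1
    exact Or.inr ⟨s[i], List.getElem_mem hi, τ, fun t => h3 _ _⟩

/-- Extension of a combing to a complex with one more edge. -/
def extend (E : Y.Extension) (hd : ∀ v, E.complex.dist (E.vtx y) (E.vtx v) = Y.dist y v)
    (vert' : E.complex.V → I → E.complex.Space) (X : I → I → E.complex.Space)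
    (hvert : ∀ v t, vert' (E.vtx v) t = E.incl (C.vert v t))
    (hV : ∀ v, (∃ v', v = E.vtx v') ∨ (Continuous (vert' v) ∧ vert' v 0 = vertexPt (E.vtx y) ∧
      vert' v 1 = vertexPt v ∧ (∀ t, vert' v t ∈ E.complex.skel1) ∧
      Monotone fun t => coarseDist (E.vtx y) (vert' v t)))
    (hX : Continuous fun x : I × I => X x.1 x.2) (hsrc : ∀ t, X 0 t = vert' E.start t)
    (htgt : ∀ t, X 1 t = vert' E.finish t) (hX0 : ∀ τ, X τ 0 = vertexPt (E.vtx y))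
    (hX1 : ∀ τ, X τ 1 = edgePt (E.new false) τ)
    (hXm : ∀ τ, Monotone fun t => coarseDist (E.vtx y) (X τ t)) :
    E.complex.Combing (E.vtx y) where
  vert := vert'
  edge e τ t := Sum.elim (fun d => E.incl (C.edge d τ t)) (fun c => cond c (X (σ τ) t) (X τ t)) e
  continuous_vert v := by
    rcases hV v with ⟨v, rfl⟩ | h
    · simp only [funext (hvert v)]
      exact E.continuous_incl.comp (C.continuous_vert v)
    · exact h.1
  continuous_edge e := by
    rcases e with d | _ | _
    · exact E.continuous_incl.comp (C.continuous_edge d)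
    · exact hX
    · exact hX.comp (f := fun x : I × I => (σ x.1, x.2)) (by fun_prop)
  edge_src e t := by
    rcases e with d | _ | _
    · exact (congrArg E.incl (C.edge_src d t)).trans (hvert _ t).symm
    · exact hsrc t
    · change X (σ 0) t = _
      rw [unitInterval.symm_zero]
      exact htgt t
  edge_inv e τ t := by
    rcases e with d | _ | _
    · exact congrArg E.incl (C.edge_inv d τ t)
    · rfl
    · change X τ t = X (σ (σ τ)) t
      rw [unitInterval.symm_symm]
  vert_zero v := by
    rcases hV v with ⟨v, rfl⟩ | h
    · rw [hvert, C.vert_zero, E.incl_vertexPt]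
    · exact h.2.1
  edge_zero e τ := by
    rcases e with d | _ | _
    · exact congrArg E.incl (C.edge_zero d τ)
    · exact hX0 τ
    · exact hX0 _
  vert_one v := by
    rcases hV v with ⟨v, rfl⟩ | h
    · rw [hvert, C.vert_one, E.incl_vertexPt]
    · exact h.2.2.1
  edge_one e τ := by
    rcases e with d | _ | _
    · exact congrArg E.incl (C.edge_one d τ)
    · exact hX1 τ
    · exact (hX1 _).trans (edgePt_flip (E.new true) τ).symm
  vert_base t := by rw [hvert, C.vert_base, E.incl_vertexPt]
  vert_skel v t := by
    rcases hV v with ⟨v, rfl⟩ | h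
    · rw [hvert]
      exact E.incl_mem_skel1 (C.vert_skel v t)
    · exact h.2.2.2.1 t
  vert_mono v := by
    rcases hV v with ⟨v, rfl⟩ | h
    · simp only [hvert, E.coarseDist_incl hd]
      exact C.vert_mono v
    · exact h.2.2.2.2
  edge_mono e τ := by
    rcases e with d | _ | _
    · simp only [Sum.elim_inl, E.coarseDist_incl hd]
      exact C.edge_mono d τ
    · exact hXm τ
    · exact hXm _

end Combing

end TwoComplex


/-! ### Extending combings over a spur and over a new 2-cell -/

open unitInterval

namespace TwoComplex

theorem monotone_ite_half {α : Type*} [Preorder α] {a b : I → α} (ha : Monotone a) (hb : Monotone b)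
    (h : ∀ s t : I, (s : ℝ) ≤ 1 / 2 → 1 / 2 ≤ (t : ℝ) → a s ≤ b t) :
    Monotone fun t : I => if (t : ℝ) ≤ 1 / 2 then a t else b t := by
  intro s t hst
  have hst' : (s : ℝ) ≤ t := hst
  dsimp only
  split_ifs with h1 h2 h2
  · exact ha hst
  · exact h s t h1 (not_le.mp h2).le
  · linarith
  · exact hb hst

theorem monotone_coarseDist_edgePt {Y : TwoComplex} {y : Y.V} {d : Y.D} {n : ℕ}
    (h0 : Y.dist y (Y.src d) = n) (h1 : Y.dist y (Y.tgt d) = n + 1) :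
    Monotone fun t => coarseDist y (edgePt d t) := by
  have he : edgeDist y d = n + 1 / 2 := by
    rw [edgeDist, h0, h1, min_eq_left (by exact_mod_cast Nat.le_succ n)]
  intro s t hst
  dsimp only
  rcases eq_or_ne s 0 with rfl | hs0
  · rw [coarseDist_edgePt_zero, h0]
    rcases eq_or_ne t 0 with rfl | ht0
    · rw [coarseDist_edgePt_zero, h0]
    rcases eq_or_ne t 1 with rfl | ht1
    · rw [coarseDist_edgePt_one, h1]
      push_cast
      linarith
    · rw [coarseDist_edgePt _ _ ht0 ht1, he]
      linarith
  · have ht0 : t ≠ 0 := fun h => hs0 (le_antisymm (h ▸ hst) unitInterval.nonneg')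
    rcases eq_or_ne t 1 with rfl | ht1
    · rcases eq_or_ne s 1 with rfl | hs1
      · exact le_rfl
      · rw [coarseDist_edgePt_one, h1, coarseDist_edgePt _ _ hs0 hs1, he]
        push_cast
        linarith
    · have hs1 : s ≠ 1 := fun h => ht1 (le_antisymm unitInterval.le_one' (h ▸ hst))
      rw [coarseDist_edgePt _ _ hs0 hs1, coarseDist_edgePt _ _ ht0 ht1]

/-- Attach an edge at the vertex `m`. -/
def spurExt (Y : TwoComplex.{0, 0, 0}) (m : Y.V) : Y.Extension where
  V' := Option Y.V
  i := some
  a := some m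
  b := none
  Φ := Empty
  r := Empty.elim
  r_ne φ := φ.elim
  r_isPath φ := φ.elim

/-- Attach an edge from `p` to `q` and a 2-cell that fills the circuit that it forms with the path
`s`. -/
def attachExt (Y : TwoComplex.{0, 0, 0}) {p q : Y.V} {s : List Y.D} (h : Y.IsPath p s q) :
    Y.Extension where
  V' := Y.V
  i := id
  a := p
  b := q
  Φ := Unit
  r _ := Sum.inr false :: (s.map fun d => Sum.inl (Y.inv d)).reverse
  r_ne _ := by simp
  r_isPath _ := by
    refine ⟨p, rfl, ?_⟩
    have h1 : List.map (Sum.inl : Y.D → Y.D ⊕ Bool) (s.map Y.inv).reverse =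
      (s.map fun d => Sum.inl (Y.inv d)).reverse := by simp
    exact Eq.mp (congrArg (fun l => (Y.toSerreGraph.addEdge id p q).IsPath q l p) h1)
      (h.reverse.addEdge id p q)

namespace Combing

variable {Y : TwoComplex.{0, 0, 0}} {y : Y.V} (C : Y.Combing y)

/-- The combing after attaching an edge at `m`. -/
theorem exists_spur {m : Y.V} {n : ℕ}
    (hd : ∀ v, (Y.spurExt m).complex.dist ((Y.spurExt m).vtx y) ((Y.spurExt m).vtx v) = Y.dist y v)
    (hm : Y.dist y m = n)
    (hfinish : (Y.spurExt m).complex.dist ((Y.spurExt m).vtx y) (Y.spurExt m).finish = n + 1)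
    (hC : ∀ t : I, 1 / 2 ≤ (t : ℝ) → C.vert m t = vertexPt m) :
    ∃ C' : (Y.spurExt m).complex.Combing ((Y.spurExt m).vtx y),
      (∀ v t, C'.vert ((Y.spurExt m).vtx v) t = (Y.spurExt m).incl (C.vert v t)) ∧
      (∀ d τ t, C'.edge ((Y.spurExt m).edg d) τ t = (Y.spurExt m).incl (C.edge d τ t)) ∧
      (∀ t : I, (t : ℝ) ≤ 1 / 2 → C'.vert (Y.spurExt m).finish t = (Y.spurExt m).incl (C.vert m t)) ∧
      ∀ t : I, 1 / 2 ≤ (t : ℝ) →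
        C'.vert (Y.spurExt m).finish t = edgePt ((Y.spurExt m).new false) (secondHalf t) := by
  set E := Y.spurExt m with hE
  have hstart : E.start = E.vtx m := rfl
  -- The first half of the time goes to the old path to `m`. In the second half the path runs up the
  -- new edge, stopping at parameter `τ`.
  let X : I → I → E.complex.Space := fun τ t =>
    if (t : ℝ) ≤ 1 / 2 then E.incl (C.vert m t) else edgePt (E.new false) (τ * secondHalf t)
  have hX1 : ∀ τ (t : I), (t : ℝ) ≤ 1 / 2 → X τ t = E.incl (C.vert m t) := fun τ t h => if_pos h
  have hX2 : ∀ τ (t : I), 1 / 2 ≤ (t : ℝ) → X τ t = edgePt (E.new false) (τ * secondHalf t) := by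
    intro τ t h
    by_cases h' : (t : ℝ) ≤ 1 / 2
    · rw [hX1 τ t h', hC t h, secondHalf_of_le h', mul_zero, edgePt_zero]
      rfl
    · exact if_neg h'
  have hXc : Continuous fun x : I × I => X x.1 x.2 := by
    refine Continuous.if_le (f := fun x : I × I => (x.2 : ℝ)) (g := fun _ => (1 / 2 : ℝ))
      (f' := fun x : I × I => E.incl (C.vert m x.2))
      (g' := fun x : I × I => edgePt (E.new false) (x.1 * secondHalf x.2)) ?_ ?_ (by fun_prop)
      continuous_const ?_
    · exact E.continuous_incl.comp ((C.continuous_vert m).comp continuous_snd)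
    · exact (continuous_edgePt _).comp
        (continuous_fst.mul (continuous_secondHalf.comp continuous_snd))
    · intro x hx
      have hx' : (x.2 : ℝ) = 1 / 2 := hx
      rw [← hX1 x.1 x.2 hx'.le, hX2 x.1 x.2 hx'.ge]
  have hXm : ∀ τ, Monotone fun t => coarseDist (E.vtx y) (X τ t) := by
    intro τ
    have hfun : (fun t => coarseDist (E.vtx y) (X τ t)) = fun t : I => if (t : ℝ) ≤ 1 / 2 then
        coarseDist y (C.vert m t) else
        coarseDist (E.vtx y) (edgePt (E.new false) (τ * secondHalf t)) := by
      funext t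
      split_ifs with h
      · rw [hX1 τ t h, E.coarseDist_incl hd]
      · rw [hX2 τ t (not_le.mp h).le]
    have hmono := monotone_coarseDist_edgePt (y := E.vtx y) (d := E.new false) (n := n)
      (by rw [E.src_new_false, hstart, hd, hm]) (by rw [E.tgt_new_false, hfinish])
    rw [hfun]
    refine monotone_ite_half (C.vert_mono m) ?_ ?_
    · intro s t hst
      exact hmono (mul_le_mul_right (monotone_secondHalf hst) τ)
    · intro s t _ _
      refine ((C.vert_mono m) (unitInterval.le_one' (t := s))).trans ?_
      refine le_trans ?_ (hmono (unitInterval.nonneg' (t := τ * secondHalf t)))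
      dsimp only
      rw [C.vert_one, coarseDist_vertexPt, coarseDist_edgePt_zero, E.src_new_false, hstart, hd]
  let vert' : E.complex.V → I → E.complex.Space := fun v t =>
    Option.elim (α := Y.V) v (X 1 t) (fun v => E.incl (C.vert v t))
  have hv0 : X 1 0 = vertexPt (E.vtx y) := by
    rw [hX1 _ _ (by norm_num), C.vert_zero, E.incl_vertexPt]
  refine ⟨C.extend E hd vert' X (fun v t => rfl) ?_ hXc ?_ ?_ ?_ ?_ hXm, fun v t => rfl,
    fun d τ t => rfl, fun t ht => hX1 1 t ht, fun t ht => (hX2 1 t ht).trans (by rw [one_mul])⟩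
  · rintro (_ | v)
    · refine Or.inr ⟨hXc.comp (Continuous.prodMk_right (1 : I)), hv0, ?_, ?_, hXm 1⟩
      · refine (hX2 1 1 (by norm_num)).trans ?_
        rw [one_mul, secondHalf_one, edgePt_one, E.tgt_new_false]
        rfl
      · intro t
        by_cases h : (t : ℝ) ≤ 1 / 2
        · exact (congrArg (· ∈ E.complex.skel1) (hX1 1 t h)).mpr
            (E.incl_mem_skel1 (C.vert_skel m t))
        · exact Or.inr ⟨_, _, hX2 1 t (not_le.mp h).le⟩
    · exact Or.inl ⟨v, rfl⟩
  · intro t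
    by_cases h : (t : ℝ) ≤ 1 / 2
    · exact hX1 0 t h
    · rw [hX2 0 t (not_le.mp h).le, zero_mul, edgePt_zero, E.src_new_false]
      refine (congrArg E.incl (hC t (not_le.mp h).le)).symm
  · intro t
    rfl
  · intro τ
    rw [hX1 _ _ (by norm_num), C.vert_zero, E.incl_vertexPt]
  · intro τ
    rw [hX2 _ _ (by norm_num), secondHalf_one, mul_one]

theorem alongPath_append {p' p q : Y.V} {s₀ s : List Y.D} (h₀ : Y.IsPath p' s₀ p)
    (h : Y.IsPath p s q) {x : ℝ} (hx : 0 ≤ x) (t : I) :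
    C.alongPath q (s₀ ++ s) (s₀.length + x) t = C.alongPath q s x t := by
  induction s₀ generalizing p' with
  | nil => simp
  | cons d s₀ ih =>
    simp only [List.length_cons, List.cons_append]
    push_cast
    rw [alongPath, pathGlue]
    split_ifs with h1
    · have h2 : (0 : ℝ) ≤ s₀.length := Nat.cast_nonneg _
      have hs : s₀ = [] := List.length_eq_zero_iff.mp
        (by exact_mod_cast le_antisymm (by linarith : (s₀.length : ℝ) ≤ 0) h2)
      subst hs
      have h3 : Y.tgt d = p := h₀.2
      rw [Set.projIcc_of_right_le _ (by linarith), C.alongPath_of_le h (by simp at h1; linarith), ← h3]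
      exact C.edge_tgt d t
    · have := ih h₀.2
      rw [show (s₀.length : ℝ) + 1 + x - 1 = s₀.length + x by ring]
      exact this

end Combing

/-- The point of the circle at parameter `x / N`. -/
noncomputable def circlePt (N : ℕ) (x : ℝ) : ℂ := (Circle.exp (2 * Real.pi * (x / N)) : ℂ)

theorem coe_arcPoint (n k : ℕ) (t : I) : (arcPoint n k t : ℂ) = circlePt n (k + t) := rfl

theorem continuous_circlePt (N : ℕ) : Continuous (circlePt N) := by
  unfold circlePt
  fun_prop

theorem norm_circlePt (N : ℕ) (x : ℝ) : ‖circlePt N x‖ = 1 := Circle.norm_coe _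

theorem circlePt_self {N : ℕ} (hN : N ≠ 0) : circlePt N N = circlePt N 0 := by
  have hN' : (N : ℝ) ≠ 0 := Nat.cast_ne_zero.mpr hN
  rw [circlePt, circlePt, div_self hN', mul_one, zero_div, mul_zero, Circle.exp_two_pi, Circle.exp_zero]

section Attach

variable {Y : TwoComplex.{0, 0, 0}} {p q : Y.V} {s : List Y.D} (h : Y.IsPath p s q)

theorem attachExt_len : (Y.attachExt h).complex.len ((Y.attachExt h).cell ()) = s.length + 1 := by
  change (Sum.inr false :: (s.map fun d => Sum.inl (Y.inv d)).reverse : List (Y.D ⊕ Bool)).length = _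
  simp

theorem attachExt_side_zero (h0 : 0 < (Y.attachExt h).complex.len ((Y.attachExt h).cell ())) :
    (Y.attachExt h).complex.side ((Y.attachExt h).cell ()) ⟨0, h0⟩ = (Y.attachExt h).new false := rfl

/-- Side 0 is the new edge, and the path follows backwards, so edge number `i` of the path is side
`s.length - i`. -/
theorem attachExt_side {i : ℕ} (hi : i < s.length)
    (hk : s.length - i < (Y.attachExt h).complex.len ((Y.attachExt h).cell ())) :
    (Y.attachExt h).complex.side ((Y.attachExt h).cell ()) ⟨s.length - i, hk⟩ =
      (Y.attachExt h).edg (Y.inv s[i]) := by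
  have key : ∀ hk', (Sum.inr false :: (s.map fun d => Sum.inl (Y.inv d)).reverse :
      List (Y.D ⊕ Bool))[s.length - i]'hk' = Sum.inl (Y.inv s[i]) := by
    intro hk'
    rw [List.getElem_cons, dif_neg (by omega), List.getElem_reverse, List.getElem_map]
    congr 3
    simp only [List.length_map]
    omega
  exact key hk

theorem facePt_attachExt_top {z : Metric.closedBall (0 : ℂ) 1} {τ : I}
    (hz : (z : ℂ) = circlePt (s.length + 1) τ) :
    facePt ((Y.attachExt h).cell ()) z = edgePt ((Y.attachExt h).new false) τ := by
  have h0 : 0 < (Y.attachExt h).complex.len ((Y.attachExt h).cell ()) := TwoComplex.len_pos _ _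
  rw [← attachExt_side_zero h h0, ← facePt_arc]
  congr 1
  apply Subtype.ext
  rw [coe_arcPoint, hz]
  change circlePt _ _ = circlePt _ ((0 : ℕ) + (τ : ℝ))
  rw [Nat.cast_zero, zero_add]
  exact congrArg (fun n => circlePt n τ) (attachExt_len h).symm

/-- Going backwards around the circle of `s.length + 1` arcs from the start of the new edge
traverses the path `s`, which explains the parameter `s.length + 1 - x`. -/
theorem facePt_attachExt_bottom {z : Metric.closedBall (0 : ℂ) 1} {x : ℝ} (h0 : 0 ≤ x)
    (h1 : x ≤ s.length) (hz : (z : ℂ) = circlePt (s.length + 1) (s.length + 1 - x)) {y : Y.V}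
    (C : Y.Combing y) :
    facePt ((Y.attachExt h).cell ()) z = (Y.attachExt h).incl (C.alongPath q s x 1) := by
  rcases eq_or_ne s [] with rfl | hs
  · obtain rfl : x = 0 := le_antisymm (by simpa using h1) h0
    rw [facePt_attachExt_top h (τ := 1) (by rw [hz]; simp), edgePt_one, Extension.tgt_new_false,
      C.alongPath_of_le h le_rfl, C.vert_one, Extension.incl_vertexPt]
    exact congrArg _ (show (Y.attachExt h).finish = (Y.attachExt h).vtx p from h.symm)
  · obtain ⟨i, hi, τ, hx, hg⟩ := pathGlue_cases hs h0 h1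
    rw [Combing.alongPath, hg, C.edge_one, Extension.incl_edgePt, edgePt_flip, Extension.inv_edg]
    have hk : s.length - i < (Y.attachExt h).complex.len ((Y.attachExt h).cell ()) := by
      rw [attachExt_len h]; omega
    rw [← attachExt_side h hi hk, ← facePt_arc]
    congr 1
    apply Subtype.ext
    rw [coe_arcPoint, hz]
    have hx' : (s.length : ℝ) + 1 - x = ((s.length - i : ℕ) : ℝ) + (σ τ : I) := by
      rw [hx, unitInterval.coe_symm_eq, Nat.cast_sub hi.le]
      ring
    rw [hx']
    exact congrArg (fun n => circlePt n _) (attachExt_len h).symm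

end Attach

/-- The combing after attaching an edge and a 2-cell along the path `s₀ ++ s`. -/
theorem Combing.exists_attach {Y : TwoComplex.{0, 0, 0}} {y : Y.V} (C : Y.Combing y) {p' p q : Y.V}
    {s₀ s : List Y.D} (h₀ : Y.IsPath p' s₀ p) (hs : Y.IsPath p s q) {n : ℕ}
    (hd : ∀ v, (Y.attachExt (h₀.append hs)).complex.dist ((Y.attachExt (h₀.append hs)).vtx y)
      ((Y.attachExt (h₀.append hs)).vtx v) = Y.dist y v)
    (hq : Y.dist y q ≤ n) (hlow : ∀ d ∈ s, ∀ τ, coarseDist y (edgePt d τ) ≤ n)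
    (hup : ∀ d ∈ s₀ ++ s, edgeDist y d ≤ n + 1 / 2)
    (hnew : edgeDist ((Y.attachExt (h₀.append hs)).vtx y) ((Y.attachExt (h₀.append hs)).new false) =
      n + 1 / 2)
    (hCq : ∀ t : I, 1 / 2 ≤ (t : ℝ) → C.vert q t = vertexPt q)
    (hCs : ∀ d ∈ s, ∀ τ, ∀ t : I, 1 / 2 ≤ (t : ℝ) → C.edge d τ t = edgePt d τ)
    (hC₁ : ∀ t : I, (t : ℝ) ≤ 1 / 2 → C.vert p' t = C.vert p t)
    (hC₂ : ∀ t : I, 1 / 2 ≤ (t : ℝ) →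
      C.vert p' t = C.alongPath q (s₀ ++ s) (s₀.length * (2 - 2 * t)) 1) :
    Nonempty ((Y.attachExt (h₀.append hs)).complex.Combing ((Y.attachExt (h₀.append hs)).vtx y)) := by
  set E := Y.attachExt (h₀.append hs) with hE
  have hstart : E.start = E.vtx p' := rfl
  have hfinish : E.finish = E.vtx q := rfl
  have hlen : (s₀ ++ s).length = s₀.length + s.length := List.length_append
  have hlen' : ((s₀ ++ s).length : ℝ) = s₀.length + s.length := by exact_mod_cast hlen
  have hc0 : (0 : ℝ) ≤ s₀.length := Nat.cast_nonneg _
  have hL0 : (0 : ℝ) ≤ s.length := Nat.cast_nonneg _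
  set N := (s₀ ++ s).length + 1 with hN
  have hN' : (N : ℝ) = s₀.length + s.length + 1 := by rw [hN]; push_cast [hlen]; ring
  -- The square is mapped onto the new 2-cell with bottom the low path `s`, top the new edge, right
  -- side the point `q`, and left side `s₀` run backwards from `p` to `p'`. The left side must match
  -- the existing path to `p'`, which is `hC₂`.
  obtain ⟨Θ, hΘ, hb, ht, hl, hr, hint⟩ := exists_squareMap
    (b₀ := fun τ => circlePt N (N - (s₀.length + τ * s.length))) (b₁ := fun τ => circlePt N τ)
    (l := fun t => circlePt N (N - s₀.length * (1 - t))) (r := fun _ => circlePt N 1)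
    ((continuous_circlePt N).comp (by fun_prop)) ((continuous_circlePt N).comp (by fun_prop))
    ((continuous_circlePt N).comp (by fun_prop)) continuous_const
    (fun _ => norm_circlePt _ _) (fun _ => norm_circlePt _ _) (fun _ => norm_circlePt _ _)
    (fun _ => norm_circlePt _ _) (by simp) (by congr 1; rw [hN', Set.Icc.coe_one]; ring)
    (by
      have := circlePt_self (N := N) (Nat.succ_ne_zero (s₀ ++ s).length)
      simp only [Set.Icc.coe_zero, Set.Icc.coe_one, sub_self, mul_zero, sub_zero]
      exact this.symm) (by simp)
  have hNN : (N : ℝ) = (s₀ ++ s).length + 1 := by rw [hN]; push_cast; ring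
  rw [hNN] at hb hl
  have hfb : ∀ τ : I, facePt (E.cell ()) (Θ (τ, 0)) = E.incl (C.alongPath q s (τ * s.length) 1) := by
    intro τ
    have hτ : (τ : ℝ) * s.length ≤ s.length := mul_le_of_le_one_left hL0 τ.2.2
    have hτ' : 0 ≤ (τ : ℝ) * s.length := mul_nonneg τ.2.1 hL0
    rw [facePt_attachExt_bottom (h₀.append hs) (x := s₀.length + τ * s.length) (by linarith)
      (by linarith) (hb τ) C, C.alongPath_append h₀ hs hτ']
  have hft : ∀ τ : I, facePt (E.cell ()) (Θ (τ, 1)) = edgePt (E.new false) τ := fun τ =>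
    facePt_attachExt_top (h₀.append hs) (ht τ)
  have hfr : ∀ t : I, facePt (E.cell ()) (Θ (1, t)) = vertexPt E.finish := by
    intro t
    rw [facePt_attachExt_top (h₀.append hs) (τ := 1) (by rw [hr]; simp [hN]), edgePt_one]
    rfl
  have hfl : ∀ t : I, facePt (E.cell ()) (Θ (0, t)) =
      E.incl (C.alongPath q (s₀ ++ s) (s₀.length * (1 - t)) 1) := by
    intro t
    have h1 : (s₀.length : ℝ) * (1 - t) ≤ s₀.length :=
      mul_le_of_le_one_right hc0 (by linarith [t.2.1])
    exact facePt_attachExt_bottom (h₀.append hs) (mul_nonneg hc0 (by linarith [t.2.2])) (by linarith)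
      (hl t) C
  have hstat : ∀ (τ t : I), 1 / 2 ≤ (t : ℝ) →
      C.alongPath q s (τ * s.length) t = C.alongPath q s (τ * s.length) 1 := by
    intro τ t h
    rcases C.alongPath_cases hs (mul_nonneg τ.2.1 hL0) (mul_le_of_le_one_left hL0 τ.2.2) with
      h1 | ⟨d, hd, τ', h1⟩
    · rw [h1, h1, hCq t h, C.vert_one]
    · rw [h1, h1, hCs d hd τ' t h, C.edge_one]
  have hlevel : ∀ τ : I, coarseDist y (C.alongPath q s (τ * s.length) 1) ≤ n := by
    intro τ
    rcases C.alongPath_cases hs (mul_nonneg τ.2.1 hL0) (mul_le_of_le_one_left hL0 τ.2.2) with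
      h1 | ⟨d, hd, τ', h1⟩
    · rw [h1, C.vert_one, coarseDist_vertexPt]
      exact_mod_cast hq
    · rw [h1, C.edge_one]
      exact hlow d hd τ'
  have hamono : ∀ τ : I, Monotone fun t => coarseDist y (C.alongPath q s (τ * s.length) t) := by
    intro τ
    rcases C.alongPath_cases hs (mul_nonneg τ.2.1 hL0) (mul_le_of_le_one_left hL0 τ.2.2) with
      h1 | ⟨d, hd, τ', h1⟩
    · simp only [h1]
      exact C.vert_mono q
    · simp only [h1]
      exact C.edge_mono d τ'
  have hzero : ∀ τ : I, C.alongPath q s (τ * s.length) 0 = vertexPt y := by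
    intro τ
    rcases C.alongPath_cases hs (mul_nonneg τ.2.1 hL0) (mul_le_of_le_one_left hL0 τ.2.2) with
      h1 | ⟨d, hd, τ', h1⟩
    · rw [h1, C.vert_zero]
    · rw [h1, C.edge_zero]
  -- No side exceeds level `n + 1/2`, and the new edge attains it; subtracting 1/4 gives the level
  -- of the cell.
  have hface : cellDist (E.vtx y) (.face (E.cell ())) = n + 1 / 4 := by
    have hsides : ∀ k, edgeDist (E.vtx y) (E.complex.side (E.cell ()) k) ≤ n + 1 / 2 := by
      rintro ⟨k, hk⟩
      rcases Nat.eq_zero_or_pos k with rfl | hk0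
      · rw [attachExt_side_zero, hnew]
      · have hk2 : k < (s₀ ++ s).length + 1 := by rwa [attachExt_len (h₀.append hs)] at hk
        obtain ⟨i, hi, rfl⟩ : ∃ i, i < (s₀ ++ s).length ∧ k = (s₀ ++ s).length - i :=
          ⟨(s₀ ++ s).length - k, by omega, by omega⟩
        rw [attachExt_side (h₀.append hs) hi hk, E.edgeDist_edg hd, edgeDist_inv]
        exact hup _ (List.getElem_mem hi)
    have hsup : Finset.univ.sup' ⟨⟨0, E.complex.len_pos (E.cell ())⟩, Finset.mem_univ _⟩
        (fun k => edgeDist (E.vtx y) (E.complex.side (E.cell ()) k)) = (n : ℚ) + 1 / 2 := by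
      apply le_antisymm
      · exact Finset.sup'_le _ _ fun k _ => hsides k
      · have := Finset.le_sup' (fun k => edgeDist (E.vtx y) (E.complex.side (E.cell ()) k))
          (Finset.mem_univ ⟨0, E.complex.len_pos (E.cell ())⟩)
        refine le_trans (le_of_eq ?_) this
        exact hnew.symm
    rw [cellDist, hsup]
    ring
  -- In the first half the old combing moves to the point of `s` at proportion `τ`, and in the
  -- second half the path crosses the cell to the new edge. For `τ` other than 0 and 1 the second
  -- half has levels at most `n`, then `n + 1/4`, then `n + 1/2`. The two extreme fibres are the old
  -- ones over `p'` and `q`.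
  let X : I → I → E.complex.Space := fun τ t =>
    if (t : ℝ) ≤ 1 / 2 then E.incl (C.alongPath q s (τ * s.length) t) else
      facePt (E.cell ()) (Θ (τ, secondHalf t))
  have hX1 : ∀ τ (t : I), (t : ℝ) ≤ 1 / 2 → X τ t = E.incl (C.alongPath q s (τ * s.length) t) :=
    fun τ t h => if_pos h
  have hX2 : ∀ τ (t : I), 1 / 2 ≤ (t : ℝ) → X τ t = facePt (E.cell ()) (Θ (τ, secondHalf t)) := by
    intro τ t h
    by_cases h' : (t : ℝ) ≤ 1 / 2
    · rw [hX1 τ t h', secondHalf_of_le h', hfb, hstat τ t h]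
    · exact if_neg h'
  have hXc : Continuous fun x : I × I => X x.1 x.2 := by
    refine Continuous.if_le (f := fun x : I × I => (x.2 : ℝ)) (g := fun _ => (1 / 2 : ℝ))
      (f' := fun x : I × I => E.incl (C.alongPath q s (x.1 * s.length) x.2))
      (g' := fun x : I × I => facePt (E.cell ()) (Θ (x.1, secondHalf x.2))) ?_ ?_ (by fun_prop)
      continuous_const ?_
    · exact E.continuous_incl.comp ((C.continuous_alongPath hs).comp
        (f := fun x : I × I => ((x.1 : ℝ) * s.length, x.2)) (by fun_prop))
    · exact (continuous_facePt _).comp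
        (hΘ.comp (continuous_fst.prodMk (continuous_secondHalf.comp continuous_snd)))
    · intro x hx
      have hx' : (x.2 : ℝ) = 1 / 2 := hx
      rw [← hX1 x.1 x.2 hx'.le, hX2 x.1 x.2 hx'.ge]
  have hsrc : ∀ t, X 0 t = E.incl (C.vert p' t) := by
    intro t
    rcases le_total (t : ℝ) (1 / 2) with h | h
    · rw [hX1 0 t h, hC₁ t h, C.alongPath_of_le hs (by simp)]
    · rw [hX2 0 t h, hfl, hC₂ t h, coe_secondHalf h]
      congr 3
      ring
  have htgt : ∀ t, X 1 t = E.incl (C.vert q t) := by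
    intro t
    rcases le_total (t : ℝ) (1 / 2) with h | h
    · rw [hX1 1 t h, C.alongPath_of_ge hs (by simp)]
    · rw [hX2 1 t h, hfr, hCq t h, E.incl_vertexPt, hfinish]
  have hXm : ∀ τ, Monotone fun t => coarseDist (E.vtx y) (X τ t) := by
    intro τ
    rcases eq_or_ne τ 0 with rfl | hτ0
    · simp only [hsrc, E.coarseDist_incl hd]
      exact C.vert_mono p'
    rcases eq_or_ne τ 1 with rfl | hτ1
    · simp only [htgt, E.coarseDist_incl hd]
      exact C.vert_mono q
    have hval : ∀ u : I, u ≠ 0 → coarseDist (E.vtx y) (facePt (E.cell ()) (Θ (τ, u))) =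
        if u = 1 then (n : ℚ) + 1 / 2 else n + 1 / 4 := by
      intro u hu
      split_ifs with h
      · rw [h, hft, coarseDist_edgePt _ _ hτ0 hτ1, hnew]
      · rw [coarseDist_facePt _ _ (hint τ u hτ0 hτ1 hu h), hface]
    have hval0 : coarseDist (E.vtx y) (facePt (E.cell ()) (Θ (τ, 0))) ≤ n := by
      rw [hfb, E.coarseDist_incl hd]
      exact hlevel τ
    have hfm : Monotone fun u : I => coarseDist (E.vtx y) (facePt (E.cell ()) (Θ (τ, u))) := by
      intro u u' huu
      dsimp only
      rcases eq_or_ne u' 0 with rfl | hu'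
      · rw [le_antisymm huu unitInterval.nonneg']
      rcases eq_or_ne u 0 with rfl | hu
      · refine hval0.trans ?_
        rw [hval u' hu']
        split_ifs <;> linarith
      · rw [hval u hu, hval u' hu']
        split_ifs with h1 h2
        · exact le_rfl
        · exact absurd (le_antisymm unitInterval.le_one' (h1 ▸ huu)) h2
        · linarith
        · exact le_rfl
    have hfun : (fun t => coarseDist (E.vtx y) (X τ t)) = fun t : I => if (t : ℝ) ≤ 1 / 2 then
        coarseDist y (C.alongPath q s (τ * s.length) t) else
        coarseDist (E.vtx y) (facePt (E.cell ()) (Θ (τ, secondHalf t))) := by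
      funext t
      split_ifs with h
      · rw [hX1 τ t h, E.coarseDist_incl hd]
      · rw [hX2 τ t (not_le.mp h).le]
    rw [hfun]
    refine monotone_ite_half (hamono τ) (hfm.comp monotone_secondHalf) ?_
    intro a b _ _
    refine ((hamono τ) (unitInterval.le_one' (t := a))).trans ?_
    refine le_trans (le_of_eq ?_) (hfm (unitInterval.nonneg' (t := secondHalf b)))
    dsimp only
    rw [hfb, E.coarseDist_incl hd]
  refine ⟨C.extend E hd (fun v t => E.incl (C.vert v t)) X (fun v t => rfl)
    (fun v => Or.inl ⟨v, rfl⟩) hXc hsrc htgt ?_ ?_ hXm⟩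
  · intro τ
    rw [hX1 _ _ (by norm_num), hzero, E.incl_vertexPt]
  · intro τ
    rw [hX2 _ _ (by norm_num), secondHalf_one, hft]

end TwoComplex


/-! ## Diagrams with a combing -/

namespace TwoComplex

open unitInterval

namespace Extension

variable {Y : TwoComplex.{0, 0, 0}} (E : Y.Extension) {A : Type*} [InvolutiveInv A] (ℓ : Y.D → A) (a : A)

/-- Extension of a labelling, the new edge being labelled `a`. -/
def label : E.complex.D → A := Sum.elim ℓ (fun c => cond c a⁻¹ a)

theorem map_label_edg (l : List Y.D) : (l.map E.edg).map (E.label ℓ a) = l.map ℓ := by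
  rw [List.map_map]
  rfl

end Extension

theorem coarseDist_edgePt_le {Y : TwoComplex} {y : Y.V} (hc : ∀ v, ∃ p, Y.IsPath y p v) {n : ℕ}
    {d : Y.D} (h : edgeDist y d ≤ n) (τ : I) : coarseDist y (edgePt d τ) ≤ n := by
  rcases eq_or_ne τ 0 with rfl | h0
  · rw [coarseDist_edgePt_zero]
    exact_mod_cast dist_src_le_of_edgeDist_le hc h
  rcases eq_or_ne τ 1 with rfl | h1
  · rw [coarseDist_edgePt_one]
    exact_mod_cast dist_tgt_le_of_edgeDist_le hc h
  · rwa [coarseDist_edgePt _ _ h0 h1]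

end TwoComplex

/-- The path given by `geo` is an upper bound, and a shorter path would map to a shorter path in the
Cayley graph. -/
theorem SerreGraph.dist_eq_level {Γ : SerreGraph} {G : Type*} [Group G] {A : Type*}
    [InvolutiveInv A] {S : SymGen G A} {π : Γ.V → G} {lab : Γ.D → A}
    (hπ : ∀ d, π (Γ.tgt d) = π (Γ.src d) * S.rep (lab d)) {y : Γ.V} (hy : π y = 1)
    (geo : ∀ v, ∃ p, Γ.IsPath y p v ∧ p.length = S.level (π v)) (v : Γ.V) :
    Γ.dist y v = S.level (π v) := by
  obtain ⟨p, hp, hl⟩ := geo v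
  refine le_antisymm (hl ▸ hp.dist_le) ?_
  obtain ⟨q, hq, hl'⟩ := hp.exists_dist
  have h2 : S.cayleyGraph.dist (π y) (π v) ≤ Γ.dist y v :=
    (hq.map_cayley hπ).dist_le.trans_eq ((List.length_map _).trans hl')
  rwa [hy] at h2

theorem SerreGraph.IsPath.map_eq_wordPath {Γ : SerreGraph} {G : Type*} [Group G] {A : Type*}
    [InvolutiveInv A] {S : SymGen G A} {π : Γ.V → G} {lab : Γ.D → A}
    (hπ : ∀ d, π (Γ.tgt d) = π (Γ.src d) * S.rep (lab d)) {a b : Γ.V} {p : List Γ.D}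
    (hp : Γ.IsPath a p b) :
    p.map (fun d => ((π (Γ.src d), lab d) : G × A)) = S.wordPath (π a) (p.map lab) ∧
      π b = π a * S.eval (p.map lab) := by
  have h := S.exists_word_of_isPath (hp.map_cayley hπ)
  have h2 : List.map (Prod.snd : G × A → A)
      (p.map (fun d => ((π (Γ.src d), lab d) : G × A))) = p.map lab := by
    rw [List.map_map]
    rfl
  rw [← h2]
  exact h

namespace FinPresentation

open TwoComplex

variable {G : Type*} [Group G] {A : Type*} [InvolutiveInv A] {S : SymGen G A}

/-- A van Kampen diagram whose boundary circuit is given by a list, such that the distance from the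
base vertex is the same in the diagram and in the Cayley graph. -/
structure Diagram (P : FinPresentation S) (w : List A) where
  Y : TwoComplex.{0, 0, 0}
  base : Y.V
  label : Y.D → A
  label_inv : ∀ d, label (Y.inv d) = (label d)⁻¹
  label_face : ∀ f, List.ofFn (fun k => label (Y.side f k)) ∈ P.R
  bd : List Y.D
  bd_isPath : Y.IsPath base bd base
  map_bd : bd.map label = w
  π : Y.V → G
  π_base : π base = 1
  π_tgt : ∀ d, π (Y.tgt d) = π (Y.src d) * S.rep (label d)
  geo : ∀ v, ∃ p, Y.IsPath base p v ∧ p.length = S.level (π v)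
  planar : Y.PlanarDisc bd

namespace Diagram

variable {P : FinPresentation S} {w : List A}

theorem dist_eq (F : P.Diagram w) (v : F.Y.V) : F.Y.dist F.base v = S.level (F.π v) :=
  SerreGraph.dist_eq_level F.π_tgt F.π_base F.geo v

theorem connected (F : P.Diagram w) (v : F.Y.V) : ∃ p, F.Y.IsPath F.base p v :=
  (F.geo v).imp fun _ h => h.1

theorem edgeDist_eq (F : P.Diagram w) (d : F.Y.D) : edgeDist F.base d =
    min (S.level (F.π (F.Y.src d)) : ℚ) (S.level (F.π (F.Y.tgt d)) : ℚ) + 1 / 2 := by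
  rw [edgeDist, F.dist_eq, F.dist_eq]

/-- The diagram that consists of one vertex. -/
def trivial (P : FinPresentation S) : P.Diagram [] where
  Y := { V := Unit, D := Empty, inv := id, src := Empty.elim, inv_inv := fun d => d.elim,
         inv_ne := fun d => d.elim, F := Empty, len := Empty.elim, len_pos := fun f => f.elim,
         side := fun f => f.elim, side_closed := fun f => f.elim }
  base := ()
  label := Empty.elim
  label_inv d := d.elim
  label_face f := f.elim
  bd := []
  bd_isPath := rfl
  map_bd := rfl
  π _ := 1
  π_base := rfl
  π_tgt d := d.elim
  geo v := ⟨[], rfl, S.level_one.symm⟩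
  planar :=
    { finite_V := inferInstanceAs (Finite Unit)
      finite_D := inferInstanceAs (Finite Empty)
      finite_F := inferInstanceAs (Finite Empty)
      surj := fun d => d.elim
      card := by
        have : IsEmpty (Σ f : Empty, Fin (Empty.elim f)) := ⟨fun x => x.1.elim⟩
        exact (congrArg (· + 0) (Nat.card_of_isEmpty
          (α := Σ f : Empty, Fin (Empty.elim f)))).trans (Nat.card_of_isEmpty (α := Empty)).symm
      link := fun _ _ _ _ d => d.elim
      euler := by
        change 2 * (Nat.card Unit + Nat.card Empty) = Nat.card Empty + 2
        simp
      nil := fun _ => inferInstanceAs (IsEmpty Empty) }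

theorem nonempty_combing_trivial (P : FinPresentation S) :
    Nonempty ((trivial P).Y.Combing (trivial P).base) :=
  ⟨{ vert := fun _ _ => vertexPt (trivial P).base
     edge := fun d => Empty.elim d
     continuous_vert := fun _ => continuous_const
     continuous_edge := fun d => Empty.elim d
     edge_src := fun d => Empty.elim d
     edge_inv := fun d => Empty.elim d
     vert_zero := fun _ => rfl
     edge_zero := fun d => Empty.elim d
     vert_one := fun _ => rfl
     edge_one := fun d => Empty.elim d
     vert_base := fun _ => rfl
     vert_skel := fun _ _ => Or.inl ⟨_, rfl⟩
     vert_mono := fun _ => monotone_const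
     edge_mono := fun d => Empty.elim d }⟩

/-- Attach an edge at a vertex of the boundary circuit. -/
def spur (F : P.Diagram w) {b₁ b₂ : List F.Y.D} (hbd : F.bd = b₁ ++ b₂) {m : F.Y.V}
    (h₁ : F.Y.IsPath F.base b₁ m) (h₂ : F.Y.IsPath m b₂ F.base) (a : A)
    (ha : S.level (F.π m * S.rep a) = S.level (F.π m) + 1) {w' : List A}
    (hw : b₁.map F.label ++ [a, a⁻¹] ++ b₂.map F.label = w') : P.Diagram w' where
  Y := (F.Y.spurExt m).complex
  base := (F.Y.spurExt m).vtx F.base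
  label := (F.Y.spurExt m).label F.label a
  label_inv e := by
    rcases e with d | _ | _
    · exact F.label_inv d
    · rfl
    · exact (inv_inv a).symm
  label_face f := by
    rcases f with f | φ
    · exact F.label_face f
    · exact φ.elim
  bd := b₁.map (F.Y.spurExt m).edg ++ [(F.Y.spurExt m).new false, (F.Y.spurExt m).new true] ++
    b₂.map (F.Y.spurExt m).edg
  bd_isPath := by
    refine SerreGraph.IsPath.append (SerreGraph.IsPath.append ((F.Y.spurExt m).isPath_edg h₁) ?_)
      ((F.Y.spurExt m).isPath_edg h₂)
    exact ⟨rfl, rfl, rfl⟩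
  map_bd := by
    rw [← hw, List.map_append, List.map_append, Extension.map_label_edg, Extension.map_label_edg]
    rfl
  π v := Option.elim (α := F.Y.V) v (F.π m * S.rep a) F.π
  π_base := F.π_base
  π_tgt e := by
    rcases e with d | _ | _
    · exact F.π_tgt d
    · rfl
    · change F.π m = F.π m * S.rep a * S.rep a⁻¹
      rw [S.rep_inv, mul_inv_cancel_right]
  geo v := by
    rcases v with _ | v
    · obtain ⟨p, hp, hl⟩ := F.geo m
      refine ⟨p.map (F.Y.spurExt m).edg ++ [(F.Y.spurExt m).new false],
        SerreGraph.IsPath.append ((F.Y.spurExt m).isPath_edg hp) ⟨rfl, rfl⟩, ?_⟩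
      rw [List.length_append, List.length_map, hl]
      exact ha.symm
    · obtain ⟨p, hp, hl⟩ := F.geo v
      exact ⟨p.map (F.Y.spurExt m).edg, (F.Y.spurExt m).isPath_edg hp, (List.length_map _).trans hl⟩
  planar := by
    have : IsEmpty (F.Y.spurExt m).Φ := inferInstanceAs (IsEmpty Empty)
    exact (hbd ▸ F.planar).spur h₁ h₂ (F.Y.spurExt m) rfl (Option.some_injective _) rfl
      (fun v => Option.some_ne_none v)

/-- Attach an edge and a 2-cell along a part of the boundary circuit. -/
def attach (F : P.Diagram w) {b₁ s b₂ : List F.Y.D} (hbd : F.bd = b₁ ++ s ++ b₂) (hs : s ≠ [])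
    {p q : F.Y.V} (h₁ : F.Y.IsPath F.base b₁ p) (h : F.Y.IsPath p s q)
    (h₂ : F.Y.IsPath q b₂ F.base) (a : A) (ha : F.π q = F.π p * S.rep a)
    (hr : a :: ((s.map F.label).map (·⁻¹)).reverse ∈ P.R) {w' : List A}
    (hw : b₁.map F.label ++ [a] ++ b₂.map F.label = w') : P.Diagram w' where
  Y := (F.Y.attachExt h).complex
  base := (F.Y.attachExt h).vtx F.base
  label := (F.Y.attachExt h).label F.label a
  label_inv e := by
    rcases e with d | _ | _
    · exact F.label_inv d
    · rfl
    · exact (inv_inv a).symm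
  label_face f := by
    rcases f with f | φ
    · exact F.label_face f
    · have h1 : ∀ (l : List (F.Y.attachExt h).complex.D) (g : (F.Y.attachExt h).complex.D → A),
          List.ofFn (fun k => g (l.get k)) = l.map g := by
        intro l g
        conv_rhs => rw [← List.ofFn_get l, List.map_ofFn]
        rfl
      have h2 : ((F.Y.attachExt h).new false ::
          (s.map fun d => (F.Y.attachExt h).edg (F.Y.inv d)).reverse).map
            ((F.Y.attachExt h).label F.label a) = a :: ((s.map F.label).map (·⁻¹)).reverse := by
        rw [List.map_cons, List.map_reverse, List.map_map, List.map_map]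
        refine congrArg (fun l => a :: List.reverse l) (List.map_congr_left fun d _ => ?_)
        exact F.label_inv d
      exact (congrArg (· ∈ P.R) ((h1 _ _).trans h2)).mpr hr
  bd := b₁.map (F.Y.attachExt h).edg ++ [(F.Y.attachExt h).new false] ++
    b₂.map (F.Y.attachExt h).edg
  bd_isPath := by
    refine SerreGraph.IsPath.append (SerreGraph.IsPath.append ((F.Y.attachExt h).isPath_edg h₁) ?_)
      ((F.Y.attachExt h).isPath_edg h₂)
    exact ⟨rfl, rfl⟩
  map_bd := by
    rw [← hw, List.map_append, List.map_append, Extension.map_label_edg, Extension.map_label_edg]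
    rfl
  π := F.π
  π_base := F.π_base
  π_tgt e := by
    rcases e with d | _ | _
    · exact F.π_tgt d
    · exact ha
    · change F.π p = F.π q * S.rep a⁻¹
      rw [S.rep_inv, ha, mul_inv_cancel_right]
  geo v := by
    obtain ⟨p, hp, hl⟩ := F.geo v
    exact ⟨p.map (F.Y.attachExt h).edg, (F.Y.attachExt h).isPath_edg hp, (List.length_map _).trans hl⟩
  planar := by
    have : Unique (F.Y.attachExt h).Φ := inferInstanceAs (Unique Unit)
    have := F.planar.finite_V
    have : Finite (F.Y.attachExt h).V' := inferInstanceAs (Finite F.Y.V)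
    exact (hbd ▸ F.planar).attach hs h (F.Y.attachExt h) rfl (fun _ _ h => h) rfl rfl rfl

/-- Cutting the boundary circuit into three parts. -/
theorem exists_cut {u s v : List A} (F : P.Diagram w) (hw : u ++ s ++ v = w) :
    ∃ (b₁ bs b₂ : List F.Y.D) (p q : F.Y.V), F.bd = b₁ ++ bs ++ b₂ ∧ b₁.map F.label = u ∧
      bs.map F.label = s ∧ b₂.map F.label = v ∧ F.Y.IsPath F.base b₁ p ∧ F.Y.IsPath p bs q ∧
      F.Y.IsPath q b₂ F.base ∧ F.π p = S.eval u ∧ F.π q = S.eval u * S.eval s := by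
  obtain ⟨b, b₂, h1, h2, h3⟩ := List.map_eq_append_iff.mp (F.map_bd.trans hw.symm)
  obtain ⟨b₁, bs, rfl, h4, h5⟩ := List.map_eq_append_iff.mp h2
  have hp := F.bd_isPath
  rw [h1] at hp
  obtain ⟨q, hp, h8⟩ := SerreGraph.isPath_append.mp hp
  obtain ⟨p, h6, h7⟩ := SerreGraph.isPath_append.mp hp
  have hπp : F.π p = S.eval u := by
    have := (h6.map_eq_wordPath F.π_tgt).2
    rwa [F.π_base, one_mul, h4] at this
  refine ⟨b₁, bs, b₂, p, q, h1, h4, h5, h3, h6, h7, h8, hπp, ?_⟩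
  rw [(h7.map_eq_wordPath F.π_tgt).2, hπp, h5]

/-- The part of the boundary circuit that is labelled by a low word is low. -/
theorem edgeDist_le_of_lowWord (F : P.Diagram w) {p q : F.Y.V} {bs : List F.Y.D}
    (h : F.Y.IsPath p bs q) {n : ℕ} (hlow : S.LowWord n (F.π p) (bs.map F.label)) :
    ∀ d ∈ bs, edgeDist F.base d ≤ n := by
  intro d hd
  rw [edgeDist_le_iff, F.dist_eq, F.dist_eq, F.π_tgt]
  have := hlow (F.π (F.Y.src d), F.label d) (by
    rw [← (h.map_eq_wordPath F.π_tgt).1]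
    exact List.mem_map.mpr ⟨d, hd, rfl⟩)
  exact this

end Diagram

/-! ### Combed diagrams for loops with a flat edge or a peak -/

open Diagram

variable {P : FinPresentation S}

/-- A diagram for the lowered loop receives the edge labelled `a` and one 2-cell along the low path.
Letters are nontrivial in the group, so this path is nonempty. With `s₀` empty, no vertex needs a
new combing path. -/
theorem exists_diagram_flat {n : ℕ} {u v s : List A} {a : A} (hs : S.eval s = S.rep a)
    (h1 : S.level (S.eval u) = n) (h2 : S.level (S.eval u * S.rep a) = n)
    (hlow : S.LowWord n (S.eval u) s) (hr : a :: (s.map (·⁻¹)).reverse ∈ P.R)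
    (ih : ∃ F : P.Diagram (u ++ s ++ v), Nonempty (F.Y.Combing F.base)) :
    ∃ F : P.Diagram (u ++ [a] ++ v), Nonempty (F.Y.Combing F.base) := by
  generalize hw : u ++ s ++ v = w₀ at ih
  obtain ⟨F, ⟨C⟩⟩ := ih
  obtain ⟨b₁, bs, b₂, p, q, hbd, rfl, rfl, rfl, p1, p2, p3, hp, hq⟩ := F.exists_cut hw
  have hne : bs ≠ [] := by
    rintro rfl
    exact S.rep_ne_one a (by simpa [S.eval_nil] using hs.symm)
  rw [hs] at hq
  let F' := F.attach hbd hne p1 p2 p3 a (by rw [hq, hp]) hr rfl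
  refine ⟨F', ?_⟩
  have hlo := F.edgeDist_le_of_lowWord p2 (n := n) (by rw [hp]; exact hlow)
  refine C.rescale.exists_attach (s₀ := []) (p' := p) rfl p2 (n := n) ?_ ?_ ?_ ?_ ?_ ?_ ?_ ?_ ?_
  · intro v
    rw [F.dist_eq]
    exact F'.dist_eq _
  · rw [F.dist_eq, hq, h2]
  · intro d hd τ
    exact coarseDist_edgePt_le F.connected (hlo d hd) τ
  · intro d hd
    exact (hlo d hd).trans (by linarith)
  · refine (F'.edgeDist_eq _).trans ?_
    change min (S.level (F.π p) : ℚ) (S.level (F.π q) : ℚ) + 1 / 2 = _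
    rw [hp, hq, h1, h2, min_self]
  · exact fun t ht => C.rescale_vert ht q
  · exact fun d _ τ t ht => C.rescale_edge ht d τ
  · exact fun t _ => rfl
  · intro t ht
    rw [C.rescale_vert ht, List.nil_append, List.length_nil, Nat.cast_zero, zero_mul,
      C.rescale.alongPath_of_le p2 le_rfl, C.rescale.vert_one]

/-- A spur labelled `a` raises the top vertex; an edge labelled `b` and a 2-cell along `a⁻¹ s` then
complete the peak. The side `s₀` is the spur run downwards, which the combing of the top vertex
already climbs in the second half of the time. The construction also covers an empty `s`. -/
theorem exists_diagram_peak {n : ℕ} {u v s : List A} {a b : A} (hs : S.eval s = S.rep a * S.rep b)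
    (h1 : S.level (S.eval u) = n) (h2 : S.level (S.eval u * S.rep a) = n + 1)
    (h3 : S.level (S.eval u * S.rep a * S.rep b) = n)
    (hlow : S.LowWord n (S.eval u) s) (hr : b :: ((a⁻¹ :: s).map (·⁻¹)).reverse ∈ P.R)
    (ih : ∃ F : P.Diagram (u ++ s ++ v), Nonempty (F.Y.Combing F.base)) :
    ∃ F : P.Diagram (u ++ [a, b] ++ v), Nonempty (F.Y.Combing F.base) := by
  generalize hw : u ++ s ++ v = w₀ at ih
  obtain ⟨F, ⟨C⟩⟩ := ih
  obtain ⟨b₁, bs, b₂, p, q, hbd, rfl, rfl, rfl, p1, p2, p3, hp, hq⟩ := F.exists_cut hw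
  rw [hs, ← mul_assoc] at hq
  have hlo := F.edgeDist_le_of_lowWord p2 (n := n) (by rw [hp]; exact hlow)
  let E := F.Y.spurExt p
  let F₁ := F.spur (hbd.trans (List.append_assoc _ _ _)) p1 (p2.append p3) a
    (by rw [hp, h1, h2]) rfl
  have hd₁ : ∀ v, E.complex.dist (E.vtx F.base) (E.vtx v) = F.Y.dist F.base v := by
    intro v
    rw [F.dist_eq]
    exact F₁.dist_eq _
  have hfinish : E.complex.dist (E.vtx F.base) E.finish = n + 1 := by
    refine (F₁.dist_eq _).trans ?_
    change S.level (F.π p * S.rep a) = _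
    rw [hp, h2]
  have hdp : F.Y.dist F.base p = n := by rw [F.dist_eq, hp, h1]
  obtain ⟨C', c1, c2, c3, c4⟩ := C.rescale.exists_spur hd₁ hdp hfinish
    (fun t ht => C.rescale_vert ht p)
  have e1 : E.complex.IsPath (E.vtx F.base) (b₁.map E.edg ++ [E.new false]) E.finish :=
    SerreGraph.IsPath.append (E.isPath_edg p1) ⟨rfl, rfl⟩
  have e2 : E.complex.IsPath E.finish [E.new true] (E.vtx p) := ⟨rfl, rfl⟩
  have e3 := E.isPath_edg p2
  have e4 := E.isPath_edg p3
  have hbd₁ : b₁.map E.edg ++ [E.new false, E.new true] ++ (bs ++ b₂).map E.edg =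
      (b₁.map E.edg ++ [E.new false]) ++ ([E.new true] ++ bs.map E.edg) ++ b₂.map E.edg := by
    simp only [List.map_append, List.append_assoc, List.cons_append, List.nil_append]
  have hr₁ : b :: ((([E.new true] ++ bs.map E.edg).map (E.label F.label a)).map (·⁻¹)).reverse ∈
      P.R := by
    have : ([E.new true] ++ bs.map E.edg).map (E.label F.label a) = a⁻¹ :: bs.map F.label := by
      rw [List.map_append, E.map_label_edg]
      rfl
    rw [this]
    exact hr
  have hw₁ : (b₁.map E.edg ++ [E.new false]).map (E.label F.label a) ++ [b] ++
      (b₂.map E.edg).map (E.label F.label a) = b₁.map F.label ++ [a, b] ++ b₂.map F.label := by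
    have : [E.new false].map (E.label F.label a) = [a] := rfl
    rw [List.map_append, E.map_label_edg, E.map_label_edg, this]
    simp only [List.append_assoc, List.cons_append, List.nil_append]
  have hne : [E.new true] ++ bs.map E.edg ≠ [] := List.cons_ne_nil _ _
  let F₂ := F₁.attach hbd₁ hne e1 (e2.append e3) e4 b
    (by
      change F.π q = F.π p * S.rep a * S.rep b
      rw [hq, hp]) hr₁ hw₁
  refine ⟨F₂, ?_⟩
  have hlo₁ : ∀ d ∈ bs.map E.edg, edgeDist (E.vtx F.base) d ≤ n := by
    intro d hd
    obtain ⟨d', hd', rfl⟩ := List.mem_map.mp hd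
    rw [E.edgeDist_edg hd₁]
    exact hlo d' hd'
  refine C'.exists_attach e2 e3 (n := n) ?_ ?_ ?_ ?_ ?_ ?_ ?_ ?_ ?_
  · intro v
    exact (F₂.dist_eq _).trans (F₁.dist_eq v).symm
  · rw [hd₁, F.dist_eq, hq, h3]
  · intro d hd τ
    exact coarseDist_edgePt_le F₁.connected (hlo₁ d hd) τ
  · intro d hd
    rcases List.mem_append.mp hd with hd | hd
    · obtain rfl := List.mem_singleton.mp hd
      refine (F₁.edgeDist_eq _).le.trans ?_
      change min _ (S.level (F.π p) : ℚ) + 1 / 2 ≤ _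
      rw [hp, h1]
      gcongr
      exact min_le_right _ _
    · exact (hlo₁ d hd).trans (by linarith)
  · refine (F₂.edgeDist_eq _).trans ?_
    change min (S.level (F.π p * S.rep a) : ℚ) (S.level (F.π q) : ℚ) + 1 / 2 = _
    rw [hp, hq, h2, h3, min_eq_right (by exact_mod_cast Nat.le_succ n)]
  · intro t ht
    rw [c1, C.rescale_vert ht, E.incl_vertexPt]
  · intro d hd τ t ht
    obtain ⟨d, hd, rfl⟩ := List.mem_map.mp hd
    rw [c2, C.rescale_edge ht, E.incl_edgePt]
  · intro t ht
    rw [c3 t ht, c1]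
  · intro t ht
    have h5 : ((2 : ℝ) - 2 * t) ≤ 1 := by linarith
    have h6 : (0 : ℝ) ≤ 2 - 2 * t := by linarith [t.2.2]
    rw [c4 t ht, List.length_singleton, Nat.cast_one, one_mul, Combing.alongPath, List.singleton_append,
      pathGlue, if_pos h5, C'.edge_one, edgePt_flip (E.new true), E.inv_new]
    congr 1
    apply Subtype.ext
    rw [coe_secondHalf ht, unitInterval.coe_symm_eq, Set.projIcc_of_mem zero_le_one ⟨h6, h5⟩]
    ring

/-- Each move needs one relator, made of the one or two letters removed and a low path of length at
most `k`, hence of length at most `k + 2`. -/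
theorem exists_diagram [Finite A] {k : ℕ}
    (hk : ∀ (n : ℕ) (g : G) (w : List A), w.length ≤ 2 → S.level g = n →
      S.level (g * S.eval w) = n → ∃ s, s.length ≤ k ∧ S.eval s = S.eval w ∧ S.LowWord n g s)
    {w : List A} (hw : S.eval w = 1) :
    ∃ F : (S.shortPresentation hk).Diagram w, Nonempty (F.Y.Combing F.base) := by
  refine S.loop_induction hk
    (M := fun w => ∃ F : (S.shortPresentation hk).Diagram w, Nonempty (F.Y.Combing F.base))
    ⟨_, nonempty_combing_trivial _⟩ ?_ ?_ hw
  · intro n u v s a h1 h2 h3 h4 h5 _ ih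
    refine exists_diagram_flat h2 h3 h4 h5 ⟨by simp, ?_, ?_⟩ ih
    · simp only [List.length_cons, List.length_reverse, List.length_map]
      omega
    · rw [S.eval_cons, S.eval_inverse, h2, mul_inv_cancel]
  · intro n u v s a b h1 h2 h3 h4 h5 h6 _ ih
    refine exists_diagram_peak h2 h3 h4 h5 h6 ⟨by simp, ?_, ?_⟩ ih
    · simp only [List.length_cons, List.length_reverse, List.length_map]
      omega
    · rw [S.eval_cons, S.eval_inverse, S.eval_cons, h2, S.rep_inv]
      group

end FinPresentation


/-! ## Almost convexity implies tame fillings -/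

open unitInterval

theorem Cycle.chain_ofFn {α : Type*} {R : α → α → Prop} {n : ℕ} {b : Fin n → α}
    (h : ∀ i, R (b i) (b (finRotate n i))) : Cycle.Chain R (List.ofFn b : Cycle α) := by
  have key : ∀ (l : List α) (hl : l.length = n), (∀ i : Fin n, b i = l.get (i.cast hl.symm)) →
      Cycle.Chain R (l : Cycle α) := by
    rintro l rfl hb
    refine Cycle.chain_of_forall_finRotate fun k => ?_
    have := h k
    rwa [hb, hb] at this
  exact key _ (List.length_ofFn) fun i => by simp

namespace TwoComplex.Combing

variable {Y : TwoComplex.{0, 0, 0}} {y : Y.V} (C : Y.Combing y)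

/-- A combing of the 1-skeleton as a map on the space that is continuous on the 1-skeleton. -/
theorem exists_fiberMap : ∃ L : Y.Space → C(I, Y.Space), (∀ v t, L (vertexPt v) t = C.vert v t) ∧
    (∀ d τ t, L (edgePt d τ) t = C.edge d τ t) ∧ ContinuousOn L Y.skel1 := by
  let pv : Y.V → C(I, Y.Space) := fun v => ⟨C.vert v, C.continuous_vert v⟩
  let pe : Y.D → C(I, C(I, Y.Space)) := fun d =>
    ContinuousMap.curry ⟨fun x : I × I => C.edge d x.1 x.2, C.continuous_edge d⟩
  have h0 : ∀ d, pe d 0 = pv (Y.src d) := fun d => ContinuousMap.ext fun t => C.edge_src d t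
  have h1 : ∀ d, pe d 1 = pv (Y.tgt d) := fun d => ContinuousMap.ext fun t => C.edge_tgt d t
  have hflip : ∀ d τ, pe d τ = pe (Y.inv d) (σ τ) := fun d τ => ContinuousMap.ext fun t => by
    have := C.edge_inv d (σ τ) t
    rw [unitInterval.symm_symm] at this
    exact this.symm
  have hrot : ∀ f k, pe (Y.side f k) 1 = pe (Y.side f (finRotate _ k)) 0 := by
    intro f k
    rw [h0, h1, SerreGraph.tgt, Y.side_closed]
  -- The values on 2-cells are an arbitrary radial extension; only continuity on the 1-skeleton is
  -- claimed.
  obtain ⟨L, hLv, hLe, -⟩ := exists_lift (Y := Y) pv (fun d τ => pe d τ)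
    (fun f k t r => if r = 0 then pv y else pe (Y.side f k) t) h0 hflip
    (fun f k t => if_neg one_ne_zero) (fun f k k' t t' => by simp)
    (fun f k r => by rw [hrot])
  refine ⟨L, fun v t => by rw [hLv]; rfl, fun d τ t => by rw [hLe]; rfl, ?_⟩
  rw [continuousOn_iff']
  intro O hO
  -- The preimage on the 1-skeleton is thickened radially, omitting the centres of the cells, to an
  -- open set of the whole complex. This proves continuity for the subspace topology.
  obtain ⟨U, hUv, hUe, hUf⟩ := exists_lift (Y := Y) (T := Prop) (fun v => pv v ∈ O)
    (fun d τ => pe d τ ∈ O) (fun f k t r => r ≠ 0 ∧ pe (Y.side f k) t ∈ O)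
    (fun d => by rw [h0]) (fun d τ => by rw [hflip]) (fun f k t => by simp)
    (fun f k k' t t' => by simp) (fun f k r => by rw [hrot])
  refine ⟨{x | U x}, isOpen_space (fun d => ?_) (fun f k => ?_), ?_⟩
  · simp only [Set.mem_ofPred_eq, hUe]
    exact hO.preimage (pe d).continuous
  · simp only [Set.mem_ofPred_eq, hUf]
    exact (isOpen_ne.preimage continuous_snd).inter
      (hO.preimage ((pe (Y.side f k)).continuous.comp continuous_fst))
  · ext x
    simp only [Set.mem_inter_iff, Set.mem_preimage, Set.mem_ofPred_eq]
    refine and_congr_left fun hx => ?_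
    rcases hx with ⟨v, rfl⟩ | ⟨d, t, rfl⟩
    · rw [hLv, hUv]
    · rw [hLe, hUe]

/-- A combing of the 1-skeleton restricts to 1-combings of its subspaces. -/
theorem exists_oneCombing (C : Y.Combing y) {Z : Set Y.Space} (hZ : Z ⊆ Y.skel1) :
    ∃ ψ : Z × I → Y.Space, IsOneCombing y Z ψ ∧ IsTame y id ψ := by
  obtain ⟨L, hv, he, hc⟩ := C.exists_fiberMap
  have hL : Continuous fun p : Z => L p :=
    continuousOn_iff_continuous_domRestrict.mp (hc.mono hZ)
  have hcases : ∀ p : Z,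
      (∃ v, (p : Y.Space) = vertexPt v) ∨ ∃ d t, (p : Y.Space) = edgePt d t := fun p => hZ p.2
  refine ⟨fun x => L x.1 x.2, ⟨?_, ?_, ?_, ?_, ?_⟩, ?_⟩
  · exact (hL.comp continuous_fst).eval continuous_snd
  · intro p
    rcases hcases p with ⟨v, h⟩ | ⟨d, τ, h⟩
    · simp only [h, hv, C.vert_zero]
    · simp only [h, he, C.edge_zero]
  · intro p
    rcases hcases p with ⟨v, h⟩ | ⟨d, τ, h⟩
    · simp only [h, hv, C.vert_one]
    · simp only [h, he, C.edge_one]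
  · intro p h t
    simp only [h, hv, C.vert_base]
  · intro p ⟨v, h⟩ t
    simp only [h, hv, C.vert_skel]
  · intro p s t hst
    rcases hcases p with ⟨v, h⟩ | ⟨d, τ, h⟩
    · simp only [h, hv]
      exact C.vert_mono v hst.le
    · simp only [h, he]
      exact C.edge_mono d τ hst.le

end TwoComplex.Combing

theorem TwoComplex.cellDist_face_congr {X Y : TwoComplex} {x : X.V} {y : Y.V} {f' : X.F} {f : Y.F}
    (hlen : X.len f' = Y.len f)
    (h : ∀ k, edgeDist x (X.side f' k) = edgeDist y (Y.side f (k.cast hlen))) :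
    cellDist x (.face f') = cellDist y (.face f) := by
  change Finset.sup' _ _ _ - (1 / 4 : ℚ) = Finset.sup' _ _ _ - 1 / 4
  congr 1
  apply le_antisymm
  · refine Finset.sup'_le _ _ fun k _ => ?_
    rw [h]
    exact Finset.le_sup' (fun k => edgeDist y (Y.side f k)) (Finset.mem_univ _)
  · refine Finset.sup'_le _ _ fun k _ => ?_
    have := h (k.cast hlen.symm)
    rw [Fin.cast_cast, Fin.cast_eq_self] at this
    rw [← this]
    exact Finset.le_sup' (fun k => edgeDist x (X.side f' k)) (Finset.mem_univ _)

namespace FinPresentation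

open TwoComplex

variable {G : Type*} [Group G] {A : Type*} [InvolutiveInv A] {S : SymGen G A} {P : FinPresentation S}
  {w : List A}

namespace Diagram

theorem length_bd (F : P.Diagram w) : w.length = F.bd.length :=
  (congrArg List.length F.map_bd.symm).trans (List.length_map _)

/-- The boundary circuit as a function. -/
def bdFun (F : P.Diagram w) (i : Fin w.length) : F.Y.D := F.bd.get (i.cast F.length_bd)

theorem ofFn_bdFun (F : P.Diagram w) : List.ofFn F.bdFun = F.bd := by
  apply List.ext_getElem
  · rw [List.length_ofFn, F.length_bd]
  · intro i _ _
    rw [List.getElem_ofFn]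
    rfl

/-- The van Kampen diagram given by list data. -/
def toVanKampen (F : P.Diagram w) : P.VanKampenDiagram w where
  Y := F.Y
  finite_V := F.planar.finite_V
  finite_D := F.planar.finite_D
  finite_F := F.planar.finite_F
  base := F.base
  connected := F.connected
  label := F.label
  label_inv := F.label_inv
  label_face := F.label_face
  bd := F.bdFun
  bd_isPath := by
    rw [F.ofFn_bdFun]
    exact F.bd_isPath
  label_bd i := by
    obtain ⟨i, hi⟩ := i
    have : ∀ (l : List A) (hl : F.bd.map F.label = l) (hi : i < l.length)
        (hi' : i < F.bd.length), F.label F.bd[i] = l[i] := by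
      rintro _ rfl hi hi'
      rw [List.getElem_map]
    exact this w F.map_bd hi (F.length_bd ▸ hi)
  -- Surjectivity together with equality of the finite cardinalities gives injectivity, so
  -- `PlanarDisc` records only these two.
  sides_bijective := by
    have := F.planar.finite_D
    have := F.planar.finite_F
    refine Function.Surjective.bijective_of_nat_card_le ?_ ?_
    · intro d
      rcases F.planar.surj d with ⟨f, k, h⟩ | h
      · exact ⟨Sum.inl ⟨f, k⟩, h⟩
      · rw [← F.ofFn_bdFun, List.mem_ofFn] at h
        obtain ⟨i, hi⟩ := h
        refine ⟨Sum.inr i, ?_⟩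
        rw [Sum.elim_inr, hi, F.Y.inv_inv]
    · rw [Nat.card_sum, Nat.card_fin, F.length_bd, F.planar.card]
  link := by
    refine F.planar.link _ (Relation.EqvGen.is_equivalence _) ?_ ?_
    · intro f k
      exact Relation.EqvGen.rel _ _ (Or.inl ⟨f, k, rfl, rfl⟩)
    · rw [← F.ofFn_bdFun]
      exact Cycle.chain_ofFn fun i => Relation.EqvGen.rel _ _ (Or.inr ⟨i, rfl, rfl⟩)
  euler := F.planar.euler

theorem exists_oneCombing (F : P.Diagram w) (C : F.Y.Combing F.base) :
    ∃ ψ : F.toVanKampen.boundary × I → F.toVanKampen.Y.Space,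
      IsOneCombing F.toVanKampen.base F.toVanKampen.boundary ψ ∧
        IsTame F.toVanKampen.base id ψ := by
  refine C.exists_oneCombing (Z := F.toVanKampen.boundary) ?_
  rintro _ (rfl | ⟨i, t, rfl⟩)
  · exact Or.inl ⟨_, rfl⟩
  · exact Or.inr ⟨_, _, rfl⟩

theorem isVertexProjection (F : P.Diagram w) : F.toVanKampen.IsVertexProjection F.π :=
  ⟨F.π_base, F.π_tgt⟩

/-- The projection to the Cayley complex preserves the coarse distance. -/
theorem coarseDist_projection (F : P.Diagram w) (x : F.Y.Space) :
    coarseDist (Y := P.cayleyComplex) (1 : G)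
      (VanKampenDiagram.projection (Δ := F.toVanKampen) F.π F.isVertexProjection x) =
      coarseDist F.base x := by
  have hedge : ∀ d, edgeDist (Y := P.cayleyComplex) (1 : G) (F.π (F.Y.src d), F.label d) =
      edgeDist F.base d := by
    intro d
    rw [F.edgeDist_eq, F.π_tgt]
    rfl
  have hside : ∀ f (k : Fin (F.Y.len f)) (hk : (k : ℕ) < P.cayleyComplex.len
        (F.π (F.Y.src (F.Y.side f ⟨0, F.Y.len_pos f⟩)), ⟨_, F.label_face f⟩)),
      P.cayleyComplex.side (F.π (F.Y.src (F.Y.side f ⟨0, F.Y.len_pos f⟩)), ⟨_, F.label_face f⟩)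
        ⟨k, hk⟩ = (F.π (F.Y.src (F.Y.side f k)), F.label (F.Y.side f k)) := by
    intro f k hk
    refine Prod.ext ?_ ?_
    · exact (F.isVertexProjection.src_side f k k.2).symm
    · simp [cayleyComplex]
  obtain ⟨c, hc⟩ := exists_mem_openCell x
  rw [coarseDist_eq _ hc]
  cases c with
  | vertex v =>
    obtain rfl : x = vertexPt v := hc
    refine (coarseDist_vertexPt (Y := P.cayleyComplex) (1 : G) (F.π v)).trans ?_
    exact congrArg Nat.cast (F.dist_eq v).symm
  | edge d =>
    obtain ⟨t, h0, h1, rfl⟩ := hc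
    refine (coarseDist_edgePt (Y := P.cayleyComplex) (1 : G) (F.π (F.Y.src d), F.label d)
      h0.ne' h1.ne).trans (hedge d)
  | face f =>
    obtain ⟨z, hz, rfl⟩ := hc
    refine (coarseDist_facePt (Y := P.cayleyComplex) (1 : G)
      (F.π (F.Y.src (F.Y.side f ⟨0, F.Y.len_pos f⟩)), ⟨_, F.label_face f⟩) hz).trans ?_
    have hlen : P.cayleyComplex.len
        (F.π (F.Y.src (F.Y.side f ⟨0, F.Y.len_pos f⟩)), ⟨_, F.label_face f⟩) = F.Y.len f :=
      List.length_ofFn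
    refine cellDist_face_congr hlen fun k => ?_
    exact (congrArg (edgeDist (Y := P.cayleyComplex) (1 : G)) (hside f (k.cast hlen) k.2)).trans
      (hedge _)

end Diagram

theorem isNondecreasing_id : IsNondecreasing id := ⟨Set.mapsTo_id _, monotoneOn_id⟩

/-- Distances from the base are the same in the diagram and in the Cayley graph, so the projection
preserves levels and the same diagrams and combings prove both kinds of tameness. -/
theorem exists_tame_of_almostConvex [Finite A] (h : S.AlmostConvex) :
    ∃ P : FinPresentation S, P.IsIntrinsicTameFilling id ∧ P.IsExtrinsicTameFilling id := by
  obtain ⟨k, hk⟩ := h.exists_lowWord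
  refine ⟨S.shortPresentation hk, ⟨isNondecreasing_id, fun w hw => ?_⟩,
    ⟨isNondecreasing_id, fun w hw => ?_⟩⟩
  · obtain ⟨F, ⟨C⟩⟩ := exists_diagram hk hw
    obtain ⟨ψ, h1, h2⟩ := F.exists_oneCombing C
    exact ⟨F.toVanKampen, ψ, h1, h2⟩
  · obtain ⟨F, ⟨C⟩⟩ := exists_diagram hk hw
    obtain ⟨ψ, h1, h2⟩ := F.exists_oneCombing C
    refine ⟨F.toVanKampen, ψ, F.π, F.isVertexProjection, h1, fun p s t hst => ?_⟩
    have := h2 p s t hst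
    simp only [id] at this ⊢
    exact (F.coarseDist_projection _).le.trans (this.trans (F.coarseDist_projection _).ge)

end FinPresentation

theorem mainTheorem5 {G : Type*} [Group G] {A : Type*} [Finite A] [InvolutiveInv A]
    (S : SymGen G A) :
    List.TFAE [
      S.AlmostConvex,
      ∃ P : FinPresentation S, P.IsIntrinsicTameFilling id,
      ∃ P : FinPresentation S, P.IsExtrinsicTameFilling id] := by
  tfae_have 1 → 2 := fun h =>
    (FinPresentation.exists_tame_of_almostConvex h).imp fun _ hP => hP.1
  tfae_have 1 → 3 := fun h =>
    (FinPresentation.exists_tame_of_almostConvex h).imp fun _ hP => hP.2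
  tfae_have 2 → 1 := fun ⟨P, hP⟩ => P.almostConvex_of_intrinsic hP
  tfae_have 3 → 1 := fun ⟨P, hP⟩ => P.almostConvex_of_extrinsic hP
  tfae_finish
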